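/- Let $\chi(d)=\left(\frac{-1}{d}\right)$ for odd $d$ (so $\chi(d)=1$ if $d\equiv 1 \bmod 4$ and $\chi(d)=-1$ if $d\equiv 3\bmod 4$). For an integer $k\ge 1$ and $z$ in the upper half-plane $\mathbb H$ put $$E_{2k+1,\chi}(z)=\frac12\sum_{\substack{(c,d)\equiv(0,1)\ (\mathrm{mod}\ 2)\\ \gcd(c,d)=1}}\frac{\chi(d)}{(cz+d)^{2k+1}},\qquad G_{2k+1}(z)=z^{-(2k+1)}\,E_{2k+1,\chi}\!\left(\frac{z-1}{z}\right),$$ so that $G_{2k+1}=E_{2k+1,\chi}|_{2k+1}\left(\begin{smallmatrix}1&-1\\1&0\end{smallmatrix}\right)$ is the expansion of $E_{2k+1,\chi}$ at the cusp $1$. With $q=e^{2\pi i z}$ let $\lambda=\Theta_2^4/\Theta_3^4$ be the classical lambda function, where $\Theta_2(z)=q^{1/8}\sum_{n\in\mathbb Z}q^{n(n+1)/2}$ and $\Theta_3(z)=\sum_{n\in\mathbb Z}q^{n^2/2}$, and let $$D=\{z\in\mathbb H:\ -1\le \mathrm{Re}(z)\le 1,\ |z-\tfrac12|\ge\tfrac12,\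 |z+\tfrac12|\ge\tfrac12\}$$ be the standard fundamental domain of $\Gamma(2)$. **Theorem.** For every integer $k\ge1$, the function $G_{2k+1}$ has only finitely many zeros in $\mathbb H$ modulo $\Gamma(2)$, and at least $90\%$ of them, counted with multiplicity, have real $\lambda$-values in $(-\infty,0]$. Equivalently, at least $90\%$ of the zeros of $G_{2k+1}$ in $\mathbb H$ modulo $\Gamma(2)$, counted with multiplicity, are $\Gamma(2)$-equivalent to a point of the boundary line $\mathrm{Re}(z)=1$ of $D$. -/

import Mathlib

noncomputable section

namespace LevelTwoEisenstein

open Complex UpperHalfPlane ModularForm CongruenceSubgroup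
open scoped MatrixGroups Real

/-- The odd weight Eisenstein series with character
`E_{2k+1,χ}(z) = (1/2) ∑ χ(d) (cz+d)^{-(2k+1)}`,
summed over the pairs `(c,d)` of coprime integers with `(c,d) ≡ (0,1) mod 2`, where
`χ(d) = (-1/d)` is `1` for `d ≡ 1 mod 4` and `-1` for `d ≡ 3 mod 4`.
The sum converges absolutely for `k ≥ 1`. -/
def E (k : ℕ) (z : ℍ) : ℂ :=
  (1 / 2) * ∑' v : {v : ℤ × ℤ // v.1 ≡ 0 [ZMOD 2] ∧ v.2 ≡ 1 [ZMOD 2] ∧ IsCoprime v.1 v.2},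
    ((ZMod.χ₄ (v.1.2 : ZMod 4) : ℤ) : ℂ) * ((v.1.1 : ℂ) * (z : ℂ) + (v.1.2 : ℂ)) ^ (-(2 * k + 1 : ℤ))

/-- The matrix `[[1, -1], [1, 0]]`. -/
def γ₀ : SL(2, ℤ) := ⟨!![1, -1; 1, 0], by simp [Matrix.det_fin_two]⟩

/-- The Eisenstein series `G_{2k+1} = E_{2k+1,χ} |_{2k+1} γ₀`, that is,
`G_{2k+1}(z) = z^{-(2k+1)} E_{2k+1,χ}((z-1)/z)`. -/
def G (k : ℕ) : ℍ → ℂ := E k ∣[(2 * k + 1 : ℤ)] γ₀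

/-- `Θ₂(z) = q^{1/8} ∑_{n ∈ ℤ} q^{n(n+1)/2}` with `q = e^{2πiz}`. -/
def Θ₂ (z : ℍ) : ℂ :=
  cexp (π * Complex.I * z / 4) * ∑' n : ℤ, cexp (π * Complex.I * ((n : ℂ) * (n + 1)) * z)

/-- `Θ₃(z) = ∑_{n ∈ ℤ} q^{n²/2}` with `q = e^{2πiz}`. -/
def Θ₃ (z : ℍ) : ℂ := ∑' n : ℤ, cexp (π * Complex.I * (n : ℂ) ^ 2 * z)

/-- The classical lambda function `λ = Θ₂⁴ / Θ₃⁴`. -/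
def lam (z : ℍ) : ℂ := Θ₂ z ^ 4 / Θ₃ z ^ 4

/-- The set of `Γ(2)`-orbits in the upper half-plane. -/
abbrev Orbits : Type := MulAction.orbitRel.Quotient (CongruenceSubgroup.Gamma 2) ℍ

/-- The standard fundamental domain of `Γ(2)`, with its boundary. -/
def D : Set ℍ :=
  {z | -1 ≤ z.re ∧ z.re ≤ 1 ∧ 1 / 2 ≤ ‖(z : ℂ) - 1 / 2‖ ∧ 1 / 2 ≤ ‖(z : ℂ) + 1 / 2‖}

/-- The multiplicity of an orbit as a zero of `G_{2k+1}`: the order of vanishing at a point of the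
orbit (it is the same at all points of the orbit, as `G_{2k+1}` is modular for `Γ(2)`; it is `0` if
`G_{2k+1}` does not vanish there). -/
def mult (k : ℕ) (q : Orbits) : ℕ :=
  analyticOrderNatAt (G k ∘ ofComplex) ((Quotient.out q : ℍ) : ℂ)

/-- The number of zeros of `G_{2k+1}` modulo `Γ(2)`, counted with multiplicity, whose orbits lie
in the set `S`. -/
def zeroCount (k : ℕ) (S : Set Orbits) : ℕ := ∑ᶠ q ∈ S, mult k q

/-- The orbits that are zeros of `G_{2k+1}`. -/
def zeroOrbits (k : ℕ) : Set Orbits := {q | ∃ z ∈ q.orbit, G k z = 0}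

/-- The orbits on which `λ` is real with values in `(-∞, 0]`. -/
def lamNonpos : Set Orbits := {q | ∀ z ∈ q.orbit, ∃ x : ℝ, x ≤ 0 ∧ lam z = x}

/-- The orbits that meet the boundary line `Re z = 1` of the fundamental domain. -/
def onLine : Set Orbits := {q | ∃ z ∈ q.orbit, z ∈ D ∧ z.re = 1}

end LevelTwoEisenstein

end

/-! In fact every zero lies on the line, so the proportion is 100% and multiplicities never have to
be computed. The plan is to bound the number of zeros algebraically and to produce that many on the
line by sign changes.

Upper bound. Multiplication by 2 L(2k+1, χ) removes the coprimality condition and turns G into the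
lattice sum ∑ (-1)^r ((2q+1) z + 2(r-q))^{-(2k+1)} (`tsum_lTerm_mul_G`). Up to the factor (2k)!,
this is the 2k-th derivative at u = z of an elliptic function f with poles on 2ℤz + 2ℤ. The point z
is critical for f, and with s = f(z) one has f'² = (f² - s²)(f² - t s²). Hence f^{(2k)}(z) =
s^{2k+1} p(t), where p = `critPoly k` has degree at most k (`factorial_mul_tsum_latticeTerm`). The
parameter t = `hauptmodul z` separates Γ(2)-orbits: equal parameters give the same differential
equation up to scaling, hence the same f up to scaling, and comparison of poles and zeros gives the
matrix (`exists_Gamma_two_of_hauptmodul_eq`). Since p(1) = 0 while t never equals 1, at most k - 1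
orbits are zeros.

Lower bound. At z = 1 + iy the lattice sum is real, and at y = tan(πl/(2k+1)) it has the sign (-1)^l
for 1 ≤ l ≤ k (`sign_lineRe`). For l in the middle range the four terms ±1 ± iy dominate, and their
common value is (-1)^l cos^{2k+1}(πl/(2k+1)). Near either end, Lipschitz summation in one direction
gives a series with a single dominant term. The intermediate value theorem yields k - 1 zeros at
different heights, which are inequivalent under Γ(2) and so exhaust the zeros
(`exists_finset_zeros`).

Finally λ is Γ(2)-invariant, and real and nonpositive on the line, by the transformation laws of the
theta functions. -/

/-! ### Uniqueness for linear second order equations -/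

section SecondOrder

open Filter Topology

/-- An analytic solution of a linear second order equation `g'' = q g` with vanishing initial data
vanishes identically near the initial point. -/
theorem AnalyticAt.eventually_eq_zero_of_deriv_deriv_eq_mul {g q : ℂ → ℂ} {z : ℂ}
    (hg : AnalyticAt ℂ g z) (hq : AnalyticAt ℂ q z) (h0 : g z = 0) (h1 : deriv g z = 0)
    (h : ∀ᶠ u in 𝓝 z, deriv (deriv g) u = q u * g u) : ∀ᶠ u in 𝓝 z, g u = 0 := by
  rw [← analyticOrderAt_eq_top]
  by_contra hne
  have e1 := hg.analyticOrderAt_deriv_add_one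
  have e2 := hg.deriv.analyticOrderAt_deriv_add_one
  simp only [h0, h1, sub_zero] at e1 e2
  -- If g has finite order n, then g'' has order n - 2, whereas q g has order at least n.
  have e3 : analyticOrderAt (deriv (deriv g)) z = analyticOrderAt q z + analyticOrderAt g z := by
    rw [← analyticOrderAt_mul hq hg]
    exact analyticOrderAt_congr h
  have e1' : analyticOrderAt (deriv g) z + 1 = analyticOrderAt g z := e1
  have e2' : analyticOrderAt (deriv (deriv g)) z + 1 = analyticOrderAt (deriv g) z := e2
  obtain ⟨n, hn⟩ := ENat.ne_top_iff_exists.mp hne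
  rw [← e2', e3, ← hn] at e1'
  rcases hqt : analyticOrderAt q z with _ | m
  · rw [hqt] at e1'
    change (⊤ : ℕ∞) + n + 1 + 1 = n at e1'
    simp at e1'
  · rw [hqt] at e1'
    change ((m : ℕ) : ℕ∞) + n + 1 + 1 = n at e1'
    norm_cast at e1'
    omega

end SecondOrder

/-! ### The Weierstrass function and its half periods -/

namespace PeriodPair

open Filter Topology

variable (L : PeriodPair)

lemma countable_lattice : (L.lattice : Set ℂ).Countable := by
  rw [← Set.countable_coe_iff]
  exact L.latticeEquivProd.injective.countable

lemma isPreconnected_compl_of_countable {s : Set ℂ} (hs : s.Countable) : IsPreconnected sᶜ :=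
  (hs.isConnected_compl_of_one_lt_rank (by simp [Complex.rank_real_complex])).isPreconnected

lemma isPreconnected_compl_translates {S T : Set ℂ} (hS : S.Countable) (hT : T.Countable)
    (c v w : ℂ) (hc : c ≠ 0) : IsPreconnected {u : ℂ | v + c * u ∉ S ∧ w + u ∉ T} := by
  have : {u : ℂ | v + c * u ∉ S ∧ w + u ∉ T} =
      (((fun u ↦ v + c * u) ⁻¹' S) ∪ ((fun u ↦ w + u) ⁻¹' T))ᶜ := by
    ext u; simp
  rw [this]
  apply isPreconnected_compl_of_countable
  refine (hS.preimage_of_injOn ?_).union (hT.preimage_of_injOn ?_)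
  · intro a _ b _ h
    simpa [hc] using h
  · intro a _ b _ h
    simpa using h

lemma analyticAt_weierstrassP {u : ℂ} (hu : u ∉ L.lattice) : AnalyticAt ℂ L.weierstrassP u :=
  L.analyticOnNhd_weierstrassP u hu

lemma analyticAt_derivWeierstrassP {u : ℂ} (hu : u ∉ L.lattice) :
    AnalyticAt ℂ L.derivWeierstrassP u :=
  L.analyticOnNhd_derivWeierstrassP u hu

lemma hasDerivAt_weierstrassP {u : ℂ} (hu : u ∉ L.lattice) :
    HasDerivAt L.weierstrassP (L.derivWeierstrassP u) u := by
  rw [← L.deriv_weierstrassP]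
  exact (L.analyticAt_weierstrassP hu).differentiableAt.hasDerivAt

lemma tendsto_weierstrassP_cobounded {u : ℂ} (hu : u ∈ L.lattice) :
    Tendsto L.weierstrassP (𝓝[≠] u) (Bornology.cobounded ℂ) := by
  apply tendsto_cobounded_of_meromorphicOrderAt_neg
  rw [L.order_weierstrassP u hu]
  exact WithTop.coe_lt_coe.mpr (by norm_num : (-2 : ℤ) < 0)

/-- Otherwise ℘ would be constant on the connected complement of the lattice, against its pole at 0.
-/
lemma exists_derivWeierstrassP_ne_zero : ∃ u, u ∉ L.lattice ∧ L.derivWeierstrassP u ≠ 0 := by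
  by_contra! h
  have hconst := (isPreconnected_compl_of_countable L.countable_lattice)
  have h1 := L.tendsto_weierstrassP_cobounded L.lattice.zero_mem
  have hw := L.ω₁_div_two_notMem_lattice
  have h2 : ∀ u ∉ L.lattice, L.weierstrassP u = L.weierstrassP (L.ω₁ / 2) := by
    intro u hu
    refine IsOpen.is_const_of_deriv_eq_zero (𝕜 := ℂ) L.isClosed_lattice.isOpen_compl
      hconst L.differentiableOn_weierstrassP (fun v hv ↦ ?_) hu hw
    rw [L.deriv_weierstrassP]
    exact h v hv
  have h3 : ∀ᶠ u in 𝓝[≠] (0 : ℂ), L.weierstrassP u = L.weierstrassP (L.ω₁ / 2) := by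
    have := L.compl_lattice_sdiff_singleton_mem_nhds 0
    filter_upwards [mem_nhdsWithin_of_mem_nhds this, self_mem_nhdsWithin] with u hu hu0
    apply h2
    intro hmem
    exact hu ⟨hmem, hu0⟩
  have h4 : Tendsto L.weierstrassP (𝓝[≠] (0 : ℂ)) (𝓝 (L.weierstrassP (L.ω₁ / 2))) :=
    tendsto_const_nhds.congr' (h3.mono fun u hu ↦ hu.symm)
  exact h1.not_tendsto (Metric.disjoint_cobounded_nhds _) h4

/-- Differentiating the cubic equation gives this multiplied by ℘'. The factor cancels because
analytic functions on a connected set have no zero divisors. -/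
lemma deriv_derivWeierstrassP {u : ℂ} (hu : u ∉ L.lattice) :
    deriv L.derivWeierstrassP u = 6 * L.weierstrassP u ^ 2 - L.g₂ / 2 := by
  have hpre := (isPreconnected_compl_of_countable L.countable_lattice)
  have key : ∀ v ∈ (L.lattice : Set ℂ)ᶜ,
      L.derivWeierstrassP v * (deriv L.derivWeierstrassP v - (6 * L.weierstrassP v ^ 2 - L.g₂ / 2))
        = 0 := by
    intro v hv
    have h1 : HasDerivAt (fun w ↦ L.derivWeierstrassP w ^ 2)
        (2 * L.derivWeierstrassP v * deriv L.derivWeierstrassP v) v := by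
      simpa using (L.analyticAt_derivWeierstrassP hv).differentiableAt.hasDerivAt.fun_pow 2
    have h2 : HasDerivAt (fun w ↦ 4 * L.weierstrassP w ^ 3 - L.g₂ * L.weierstrassP w - L.g₃)
        (4 * (3 * L.weierstrassP v ^ 2 * L.derivWeierstrassP v) - L.g₂ * L.derivWeierstrassP v) v := by
      have := L.hasDerivAt_weierstrassP hv
      simpa using (((this.pow 3).const_mul 4).sub (this.const_mul L.g₂)).sub_const L.g₃
    have h3 : (fun w ↦ L.derivWeierstrassP w ^ 2) =ᶠ[𝓝 v]
        (fun w ↦ 4 * L.weierstrassP w ^ 3 - L.g₂ * L.weierstrassP w - L.g₃) := by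
      filter_upwards [L.isClosed_lattice.isOpen_compl.mem_nhds hv] with w hw
      exact L.derivWeierstrassP_sq w hw
    have h4 := h1.unique (h2.congr_of_eventuallyEq h3)
    linear_combination h4 / 2
  have hA : AnalyticOnNhd ℂ (fun v ↦ deriv L.derivWeierstrassP v -
      (6 * L.weierstrassP v ^ 2 - L.g₂ / 2)) (L.lattice : Set ℂ)ᶜ := by
    intro v hv
    have := L.analyticAt_weierstrassP hv
    have := (L.analyticAt_derivWeierstrassP hv).deriv
    fun_prop
  rcases AnalyticOnNhd.eq_zero_or_eq_zero_of_mul_eq_zero L.analyticOnNhd_derivWeierstrassP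
    hA key hpre with h | h
  · obtain ⟨v, hv, hv'⟩ := L.exists_derivWeierstrassP_ne_zero
    exact absurd (h v hv) hv'
  · exact sub_eq_zero.mp (h u hu)

lemma derivWeierstrassP_eq_zero_of_two_mul_mem {w : ℂ} (hw : 2 * w ∈ L.lattice) :
    L.derivWeierstrassP w = 0 := by
  have h := L.derivWeierstrassP_add_coe (-w) ⟨2 * w, hw⟩
  simp only at h
  rw [show -w + 2 * w = w by ring, L.derivWeierstrassP_neg] at h
  exact CharZero.eq_neg_self_iff.mp h

lemma weierstrassP_add_of_mem (u : ℂ) {l : ℂ} (hl : l ∈ L.lattice) :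
    L.weierstrassP (u + l) = L.weierstrassP u :=
  L.weierstrassP_add_coe u ⟨l, hl⟩

lemma derivWeierstrassP_add_of_mem (u : ℂ) {l : ℂ} (hl : l ∈ L.lattice) :
    L.derivWeierstrassP (u + l) = L.derivWeierstrassP u :=
  L.derivWeierstrassP_add_coe u ⟨l, hl⟩

lemma hasDerivAt_weierstrassP_const_add {v u : ℂ} (hu : v + u ∉ L.lattice) :
    HasDerivAt (fun s ↦ L.weierstrassP (v + s)) (L.derivWeierstrassP (v + u)) u :=
  (L.hasDerivAt_weierstrassP hu).comp_const_add v u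

lemma hasDerivAt_derivWeierstrassP_const_add {v u : ℂ} (hu : v + u ∉ L.lattice) :
    HasDerivAt (fun s ↦ L.derivWeierstrassP (v + s))
      (6 * L.weierstrassP (v + u) ^ 2 - L.g₂ / 2) u := by
  have := (L.analyticAt_derivWeierstrassP hu).differentiableAt.hasDerivAt
  rw [L.deriv_derivWeierstrassP hu] at this
  exact this.comp_const_add v u

lemma analyticAt_weierstrassP_const_add {v u : ℂ} (hu : v + u ∉ L.lattice) :
    AnalyticAt ℂ (fun s ↦ L.weierstrassP (v + s)) u :=
  (L.analyticAt_weierstrassP hu).fun_comp (by fun_prop)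

lemma eventually_notMem {v u : ℂ} (hu : v + u ∉ L.lattice) :
    ∀ᶠ s in 𝓝 u, v + s ∉ L.lattice :=
  (continuous_const.add continuous_id).continuousAt.eventually
    (L.isClosed_lattice.isOpen_compl.mem_nhds hu)

/-- The Weierstrass function takes different values at inequivalent half periods. -/
lemma weierstrassP_ne_of_two_mul_mem {v w : ℂ} (hv : v ∉ L.lattice) (hw : w ∉ L.lattice)
    (hv2 : 2 * v ∈ L.lattice) (hw2 : 2 * w ∈ L.lattice) (hvw : w - v ∉ L.lattice) :
    L.weierstrassP v ≠ L.weierstrassP w := by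
  intro heq
  set V : Set ℂ := {u : ℂ | v + 1 * u ∉ L.lattice ∧ w + u ∉ L.lattice} with hV
  have hVp : IsPreconnected V := 
    isPreconnected_compl_translates L.countable_lattice L.countable_lattice 1 v w one_ne_zero
  have hVa : AnalyticOnNhd ℂ (fun s ↦ L.weierstrassP (v + s) - L.weierstrassP (w + s)) V := by
    intro u hu
    rw [hV, Set.mem_ofPred_eq, one_mul] at hu
    exact (L.analyticAt_weierstrassP_const_add hu.1).sub (L.analyticAt_weierstrassP_const_add hu.2)
  have h0V : (0 : ℂ) ∈ V := by simp [hV, hv, hw]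
  have hd : ∀ u ∈ V, HasDerivAt (fun s ↦ L.weierstrassP (v + s) - L.weierstrassP (w + s))
      (L.derivWeierstrassP (v + u) - L.derivWeierstrassP (w + u)) u := by
    intro u hu
    rw [hV, Set.mem_ofPred_eq, one_mul] at hu
    exact (L.hasDerivAt_weierstrassP_const_add hu.1).sub (L.hasDerivAt_weierstrassP_const_add hu.2)
  have hVn : ∀ u ∈ V, ∀ᶠ s in 𝓝 u, s ∈ V := by
    intro u hu
    rw [hV, Set.mem_ofPred_eq, one_mul] at hu
    filter_upwards [L.eventually_notMem hu.1, L.eventually_notMem hu.2] with s h1 h2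
    simp [hV, h1, h2]
  -- Both translates solve ℘'' = 6℘² - g₂/2, so their difference g satisfies g'' = 6(℘(v+u) +
  -- ℘(w+u)) g. If the values agreed at the half periods, where ℘' vanishes, the initial data of g
  -- would vanish.
  have hz : ∀ᶠ u in 𝓝 (0 : ℂ), L.weierstrassP (v + u) - L.weierstrassP (w + u) = 0 := by
    refine (hVa 0 h0V).eventually_eq_zero_of_deriv_deriv_eq_mul
      (q := fun s ↦ 6 * (L.weierstrassP (v + s) + L.weierstrassP (w + s))) ?_ ?_ ?_ ?_
    · have h1 := L.analyticAt_weierstrassP_const_add (v := v) (u := 0) (by simpa using hv)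
      have h2 := L.analyticAt_weierstrassP_const_add (v := w) (u := 0) (by simpa using hw)
      fun_prop
    · simp [heq]
    · rw [(hd 0 h0V).deriv]
      simp [L.derivWeierstrassP_eq_zero_of_two_mul_mem hv2,
        L.derivWeierstrassP_eq_zero_of_two_mul_mem hw2]
    · filter_upwards [hVn 0 h0V] with u hu
      have e : deriv (fun s ↦ L.weierstrassP (v + s) - L.weierstrassP (w + s)) =ᶠ[𝓝 u]
          fun s ↦ L.derivWeierstrassP (v + s) - L.derivWeierstrassP (w + s) := by
        filter_upwards [hVn u hu] with s hs using (hd s hs).deriv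
      rw [e.deriv_eq]
      rw [hV, Set.mem_ofPred_eq, one_mul] at hu
      rw [((L.hasDerivAt_derivWeierstrassP_const_add hu.1).fun_sub
        (L.hasDerivAt_derivWeierstrassP_const_add hu.2)).deriv]
      ring
  have hz' := hVa.eqOn_zero_of_preconnected_of_eventuallyEq_zero hVp h0V hz
  -- The translates would then coincide, but at u = -v only the first has a pole.
  have t1 : Tendsto (fun u ↦ L.weierstrassP (v + u)) (𝓝[≠] (-v)) (Bornology.cobounded ℂ) := by
    refine (L.tendsto_weierstrassP_cobounded L.lattice.zero_mem).comp ?_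
    refine tendsto_nhdsWithin_iff.mpr ⟨?_, ?_⟩
    · have : Tendsto (fun u : ℂ ↦ v + u) (𝓝 (-v)) (𝓝 (v + -v)) :=
        (continuous_const.add continuous_id).tendsto _
      rw [add_neg_cancel] at this
      exact this.mono_left nhdsWithin_le_nhds
    · filter_upwards [self_mem_nhdsWithin] with u hu h
      exact hu (by simpa [add_eq_zero_iff_neg_eq, eq_comm] using h)
  have hwv : w + -v ∉ L.lattice := by simpa [sub_eq_add_neg] using hvw
  have t2 : Tendsto (fun u ↦ L.weierstrassP (w + u)) (𝓝[≠] (-v)) (𝓝 (L.weierstrassP (w + -v))) :=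
    (L.analyticAt_weierstrassP_const_add hwv).continuousAt.tendsto.mono_left nhdsWithin_le_nhds
  refine (t1.congr' ?_).not_tendsto (Metric.disjoint_cobounded_nhds _) t2
  have hn := L.compl_lattice_sdiff_singleton_mem_nhds 0
  have hc : Tendsto (fun u : ℂ ↦ v + u) (𝓝 (-v)) (𝓝 0) := by
    have : Tendsto (fun u : ℂ ↦ v + u) (𝓝 (-v)) (𝓝 (v + -v)) :=
      (continuous_const.add continuous_id).tendsto _
    rwa [add_neg_cancel] at this
  filter_upwards [mem_nhdsWithin_of_mem_nhds (hc hn), self_mem_nhdsWithin,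
    mem_nhdsWithin_of_mem_nhds (L.eventually_notMem hwv)] with u h1 h2 h3
  refine sub_eq_zero.mp (hz' ⟨?_, h3⟩)
  rw [one_mul]
  intro hmem
  refine h1 ⟨hmem, fun h ↦ h2 ?_⟩
  simpa [add_eq_zero_iff_neg_eq, eq_comm] using h

end PeriodPair

/-! ### The elliptic function f attached to a half period -/

namespace PeriodPair

open Filter Topology

variable (L : PeriodPair)

/-- The value of `℘` at the first half period. -/
noncomputable def e₁ : ℂ := L.weierstrassP (L.ω₁ / 2)
/-- The value of `℘` at the second half period. -/
noncomputable def e₂ : ℂ := L.weierstrassP (L.ω₂ / 2)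
/-- The value of `℘` at the sum of the half periods. -/
noncomputable def e₃ : ℂ := L.weierstrassP (L.ω₁ / 2 + L.ω₂ / 2)

lemma half_sum_notMem_lattice : L.ω₁ / 2 + L.ω₂ / 2 ∉ L.lattice := by
  have := (L.mul_ω₁_add_mul_ω₂_mem_lattice (α := 1 / 2) (β := 1 / 2)).not.mpr (by norm_num)
  intro h
  apply this
  convert! h using 1
  push_cast; ring

lemma half_sub_notMem_lattice : L.ω₂ / 2 - L.ω₁ / 2 ∉ L.lattice := by
  intro h
  apply L.half_sum_notMem_lattice
  have := L.lattice.add_mem h L.ω₁_mem_lattice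
  convert! this using 1
  ring

lemma two_mul_half₁ : 2 * (L.ω₁ / 2) ∈ L.lattice := by
  rw [mul_div_cancel₀ _ two_ne_zero]; exact L.ω₁_mem_lattice

lemma two_mul_half₂ : 2 * (L.ω₂ / 2) ∈ L.lattice := by
  rw [mul_div_cancel₀ _ two_ne_zero]; exact L.ω₂_mem_lattice

lemma two_mul_half_sum : 2 * (L.ω₁ / 2 + L.ω₂ / 2) ∈ L.lattice := by
  rw [mul_add]; exact L.lattice.add_mem L.two_mul_half₁ L.two_mul_half₂

lemma e₁_ne_e₂ : L.e₁ ≠ L.e₂ :=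
  L.weierstrassP_ne_of_two_mul_mem L.ω₁_div_two_notMem_lattice L.ω₂_div_two_notMem_lattice
    L.two_mul_half₁ L.two_mul_half₂ L.half_sub_notMem_lattice

lemma e₁_ne_e₃ : L.e₁ ≠ L.e₃ :=
  L.weierstrassP_ne_of_two_mul_mem L.ω₁_div_two_notMem_lattice L.half_sum_notMem_lattice
    L.two_mul_half₁ L.two_mul_half_sum (by simpa using L.ω₂_div_two_notMem_lattice)

lemma e₂_ne_e₃ : L.e₂ ≠ L.e₃ :=
  L.weierstrassP_ne_of_two_mul_mem L.ω₂_div_two_notMem_lattice L.half_sum_notMem_lattice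
    L.two_mul_half₂ L.two_mul_half_sum (by simpa using L.ω₁_div_two_notMem_lattice)

lemma cubic_eq_zero_of_two_mul_mem {w : ℂ} (hw : w ∉ L.lattice) (h2 : 2 * w ∈ L.lattice) :
    4 * L.weierstrassP w ^ 3 - L.g₂ * L.weierstrassP w - L.g₃ = 0 := by
  rw [← L.derivWeierstrassP_sq w hw, L.derivWeierstrassP_eq_zero_of_two_mul_mem h2]
  simp

/-- The three distinct values are roots of a cubic without quadratic term; subtracting the equations
in pairs and dividing by the differences gives Vieta's relation. -/
lemma e_sum : L.e₁ + L.e₂ + L.e₃ = 0 := by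
  have h1 := L.cubic_eq_zero_of_two_mul_mem L.ω₁_div_two_notMem_lattice L.two_mul_half₁
  have h2 := L.cubic_eq_zero_of_two_mul_mem L.ω₂_div_two_notMem_lattice L.two_mul_half₂
  have h3 := L.cubic_eq_zero_of_two_mul_mem L.half_sum_notMem_lattice L.two_mul_half_sum
  rw [← e₁] at h1
  rw [← e₂] at h2
  rw [← e₃] at h3
  have a : 4 * (L.e₁ ^ 2 + L.e₁ * L.e₂ + L.e₂ ^ 2) = L.g₂ := by
    apply mul_left_cancel₀ (sub_ne_zero.mpr L.e₁_ne_e₂)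
    linear_combination h1 - h2
  have b : 4 * (L.e₁ ^ 2 + L.e₁ * L.e₃ + L.e₃ ^ 2) = L.g₂ := by
    apply mul_left_cancel₀ (sub_ne_zero.mpr L.e₁_ne_e₃)
    linear_combination h1 - h3
  apply mul_left_cancel₀ (sub_ne_zero.mpr L.e₂_ne_e₃)
  linear_combination (a - b) / 4

lemma g₂_eq : L.g₂ = 4 * (L.e₁ ^ 2 + L.e₁ * L.e₂ + L.e₂ ^ 2) := by
  have h1 := L.cubic_eq_zero_of_two_mul_mem L.ω₁_div_two_notMem_lattice L.two_mul_half₁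
  have h2 := L.cubic_eq_zero_of_two_mul_mem L.ω₂_div_two_notMem_lattice L.two_mul_half₂
  rw [← e₁] at h1
  rw [← e₂] at h2
  symm
  apply mul_left_cancel₀ (sub_ne_zero.mpr L.e₁_ne_e₂)
  linear_combination h1 - h2

/-- The Weierstrass function normalised to vanish at the half period `ω₂ / 2`. -/
noncomputable def xFun (u : ℂ) : ℂ := L.weierstrassP u - L.e₂

/-- The linear coefficient `a` in `℘'² = 4 x (x² + a x + b)`, where `x = ℘ - e₂`. -/
noncomputable def aCoeff : ℂ := 3 * L.e₂

/-- The constant coefficient `b` in `℘'² = 4 x (x² + a x + b)`, where `x = ℘ - e₂`. -/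
noncomputable def bCoeff : ℂ := (L.e₁ - L.e₂) * (L.e₃ - L.e₂)

lemma bCoeff_ne_zero : L.bCoeff ≠ 0 :=
  mul_ne_zero (sub_ne_zero.mpr L.e₁_ne_e₂) (sub_ne_zero.mpr L.e₂_ne_e₃.symm)

/-- This is the discriminant of x² + ax + b, whose roots are e₁ - e₂ and e₃ - e₂. -/
lemma aCoeff_sq_sub_ne_zero : L.aCoeff ^ 2 - 4 * L.bCoeff ≠ 0 := by
  have : L.aCoeff ^ 2 - 4 * L.bCoeff = (L.e₁ - L.e₃) ^ 2 := by
    have h : L.e₃ = -L.e₁ - L.e₂ := by linear_combination L.e_sum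
    rw [aCoeff, bCoeff, h]; ring
  rw [this]
  exact pow_ne_zero 2 (sub_ne_zero.mpr L.e₁_ne_e₃)

lemma derivWeierstrassP_sq_eq_xFun {u : ℂ} (hu : u ∉ L.lattice) :
    L.derivWeierstrassP u ^ 2 =
      4 * L.xFun u * (L.xFun u ^ 2 + L.aCoeff * L.xFun u + L.bCoeff) := by
  have h2 := L.cubic_eq_zero_of_two_mul_mem L.ω₂_div_two_notMem_lattice L.two_mul_half₂
  rw [← e₂] at h2
  have h3 : L.e₃ = -L.e₁ - L.e₂ := by linear_combination L.e_sum
  rw [L.derivWeierstrassP_sq u hu, xFun, aCoeff, bCoeff, h3]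
  linear_combination h2 + (L.e₂ - L.weierstrassP u) * L.g₂_eq

lemma second_deriv_eq_xFun (u : ℂ) :
    6 * L.weierstrassP u ^ 2 - L.g₂ / 2 =
      6 * L.xFun u ^ 2 + 4 * L.aCoeff * L.xFun u + 2 * L.bCoeff := by
  have h3 : L.e₃ = -L.e₁ - L.e₂ := by linear_combination L.e_sum
  rw [xFun, aCoeff, bCoeff, h3, L.g₂_eq]; ring

/-- The points where both `℘ u` and `℘ (u + ω₂ / 2)` are regular. -/
def regularSet : Set ℂ := {u | u ∉ L.lattice ∧ L.ω₂ / 2 + u ∉ L.lattice}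

lemma isPreconnected_regularSet : IsPreconnected L.regularSet := by
  have := isPreconnected_compl_translates L.countable_lattice L.countable_lattice 1 0
    (L.ω₂ / 2) one_ne_zero
  simpa [regularSet] using this

lemma eventually_mem_regularSet {u : ℂ} (hu : u ∈ L.regularSet) :
    ∀ᶠ s in 𝓝 u, s ∈ L.regularSet := by
  have h0 : (0 : ℂ) + u ∉ L.lattice := by simpa using hu.1
  filter_upwards [L.eventually_notMem hu.2, L.eventually_notMem h0] with s h1 h2
  exact ⟨by simpa using h2, h1⟩

lemma hasDerivAt_xFun {u : ℂ} (hu : u ∉ L.lattice) :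
    HasDerivAt L.xFun (L.derivWeierstrassP u) u :=
  (L.hasDerivAt_weierstrassP hu).sub_const _

lemma hasDerivAt_xFun_const_add {v u : ℂ} (hu : v + u ∉ L.lattice) :
    HasDerivAt (fun s ↦ L.xFun (v + s)) (L.derivWeierstrassP (v + u)) u :=
  (L.hasDerivAt_weierstrassP_const_add hu).sub_const _

lemma analyticAt_xFun {u : ℂ} (hu : u ∉ L.lattice) : AnalyticAt ℂ L.xFun u :=
  (L.analyticAt_weierstrassP hu).sub analyticAt_const

lemma analyticAt_xFun_const_add {v u : ℂ} (hu : v + u ∉ L.lattice) :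
    AnalyticAt ℂ (fun s ↦ L.xFun (v + s)) u :=
  (L.analyticAt_weierstrassP_const_add hu).sub analyticAt_const

lemma hasDerivAt_derivWeierstrassP_xFun {v u : ℂ} (hu : v + u ∉ L.lattice) :
    HasDerivAt (fun s ↦ L.derivWeierstrassP (v + s))
      (6 * L.xFun (v + u) ^ 2 + 4 * L.aCoeff * L.xFun (v + u) + 2 * L.bCoeff) u := by
  rw [← L.second_deriv_eq_xFun]
  exact L.hasDerivAt_derivWeierstrassP_const_add hu

lemma half₁_mem_regularSet : L.ω₁ / 2 ∈ L.regularSet :=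
  ⟨L.ω₁_div_two_notMem_lattice, by rw [add_comm]; exact L.half_sum_notMem_lattice⟩

/-- Translation by the half period `ω₂ / 2`. -/
lemma xFun_mul_xFun_add {u : ℂ} (hu : u ∈ L.regularSet) :
    L.xFun u * L.xFun (L.ω₂ / 2 + u) = L.bCoeff := by
  have hx0 : L.xFun (L.ω₁ / 2) ≠ 0 := sub_ne_zero.mpr L.e₁_ne_e₂
  have hw := L.half₁_mem_regularSet
  set w := L.ω₁ / 2 with hwdef
  have hxw : ∀ᶠ s in 𝓝 w, L.xFun s ≠ 0 :=
    (L.analyticAt_xFun hw.1).continuousAt.eventually_ne hx0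
  have hxv : L.xFun (L.ω₂ / 2 + w) = L.e₃ - L.e₂ := by rw [xFun, e₃, add_comm]
  have hd : ∀ s ∈ L.regularSet, L.xFun s ≠ 0 →
      HasDerivAt (fun t ↦ L.xFun (L.ω₂ / 2 + t) - L.bCoeff / L.xFun t)
      (L.derivWeierstrassP (L.ω₂ / 2 + s) + L.bCoeff * L.derivWeierstrassP s / L.xFun s ^ 2) s := by
    intro s hs hs0
    have := (L.hasDerivAt_xFun_const_add hs.2).fun_sub
      (((hasDerivAt_const s L.bCoeff).fun_div (L.hasDerivAt_xFun hs.1) hs0))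
    convert! this using 1
    ring
  -- Both x(ω₂/2 + u) and b/x(u) solve x'' = 6x² + 4ax + 2b; they share value and derivative at
  -- ω₁/2, and their difference solves a linear equation.
  have hz : ∀ᶠ s in 𝓝 w, L.xFun (L.ω₂ / 2 + s) - L.bCoeff / L.xFun s = 0 := by
    have hA1 := L.analyticAt_xFun_const_add hw.2
    have hA2 := L.analyticAt_xFun hw.1
    refine AnalyticAt.eventually_eq_zero_of_deriv_deriv_eq_mul
      (q := fun s ↦ 6 * (L.xFun (L.ω₂ / 2 + s) + L.bCoeff / L.xFun s) + 4 * L.aCoeff) ?_ ?_ ?_ ?_ ?_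
    · exact hA1.sub (analyticAt_const.div hA2 hx0)
    · have := analyticAt_const (v := L.bCoeff).div hA2 hx0
      fun_prop
    · rw [hxv, sub_eq_zero, eq_div_iff hx0, bCoeff, xFun, ← e₁]; ring
    · rw [(hd w hw hx0).deriv, L.derivWeierstrassP_eq_zero_of_two_mul_mem L.two_mul_half₁,
        L.derivWeierstrassP_eq_zero_of_two_mul_mem (by
          rw [add_comm]; exact L.two_mul_half_sum)]
      simp
    · have hnn := hxw.eventually_nhds
      have hrr := (L.eventually_mem_regularSet hw)
      filter_upwards [hnn, hrr] with s hs hsr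
      have hs0 : L.xFun s ≠ 0 := hs.self_of_nhds
      have e : deriv (fun t ↦ L.xFun (L.ω₂ / 2 + t) - L.bCoeff / L.xFun t) =ᶠ[𝓝 s] fun t ↦
          L.derivWeierstrassP (L.ω₂ / 2 + t) +
            L.bCoeff * L.derivWeierstrassP t / L.xFun t ^ 2 := by
        filter_upwards [hs, L.eventually_mem_regularSet hsr] with t ht1 ht2
        exact (hd t ht2 ht1).deriv
      rw [e.deriv_eq]
      have hP : HasDerivAt L.derivWeierstrassP
          (6 * L.xFun s ^ 2 + 4 * L.aCoeff * L.xFun s + 2 * L.bCoeff) s := by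
        simpa using L.hasDerivAt_derivWeierstrassP_xFun (v := 0) (u := s) (by simpa using hsr.1)
      have := (L.hasDerivAt_derivWeierstrassP_xFun hsr.2).fun_add
        ((hP.const_mul L.bCoeff).fun_div ((L.hasDerivAt_xFun hsr.1).fun_pow 2) (pow_ne_zero 2 hs0))
      rw [this.deriv]
      have hsq := L.derivWeierstrassP_sq_eq_xFun hsr.1
      field_simp
      simp only [Nat.add_one_sub_one, pow_one, Nat.cast_ofNat]
      linear_combination (-2 * L.bCoeff * L.xFun s) * hsq
  have hA : AnalyticOnNhd ℂ (fun s ↦ L.xFun s * L.xFun (L.ω₂ / 2 + s) - L.bCoeff) L.regularSet :=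
    fun s hs ↦ ((L.analyticAt_xFun hs.1).mul (L.analyticAt_xFun_const_add hs.2)).sub analyticAt_const
  refine sub_eq_zero.mp (hA.eqOn_zero_of_preconnected_of_eventuallyEq_zero
    L.isPreconnected_regularSet hw ?_ hu)
  filter_upwards [hz, hxw] with s h1 h2
  rw [sub_eq_zero, eq_div_iff h2] at h1
  simp only [Pi.zero_apply]
  rw [sub_eq_zero, mul_comm]; exact h1

lemma xFun_ne_zero {u : ℂ} (hu : u ∈ L.regularSet) : L.xFun u ≠ 0 := by
  intro h
  have := L.xFun_mul_xFun_add hu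
  rw [h, zero_mul] at this
  exact L.bCoeff_ne_zero this.symm

/-- The odd elliptic function `f` with simple poles and `f² = x(u) + x(u + ω₂ / 2) + a`. -/
noncomputable def fFun (u : ℂ) : ℂ := -L.derivWeierstrassP u / (2 * L.xFun u)

lemma analyticAt_fFun {u : ℂ} (hu : u ∈ L.regularSet) : AnalyticAt ℂ L.fFun u :=
  (L.analyticAt_derivWeierstrassP hu.1).neg.div
    (analyticAt_const.mul (L.analyticAt_xFun hu.1)) (mul_ne_zero two_ne_zero (L.xFun_ne_zero hu))

lemma fFun_sq {u : ℂ} (hu : u ∈ L.regularSet) :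
    L.fFun u ^ 2 = L.xFun u + L.xFun (L.ω₂ / 2 + u) + L.aCoeff := by
  have h0 := L.xFun_ne_zero hu
  have h1 := L.xFun_mul_xFun_add hu
  have hsq := L.derivWeierstrassP_sq_eq_xFun hu.1
  rw [fFun, div_pow, div_eq_iff (pow_ne_zero 2 (mul_ne_zero two_ne_zero h0)), neg_sq, hsq]
  linear_combination (-4 * L.xFun u) * h1

lemma hasDerivAt_fFun {u : ℂ} (hu : u ∈ L.regularSet) :
    HasDerivAt L.fFun (L.xFun (L.ω₂ / 2 + u) - L.xFun u) u := by
  have h0 := L.xFun_ne_zero hu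
  have h1 := L.xFun_mul_xFun_add hu
  have hsq := L.derivWeierstrassP_sq_eq_xFun hu.1
  have hP : HasDerivAt L.derivWeierstrassP
      (6 * L.xFun u ^ 2 + 4 * L.aCoeff * L.xFun u + 2 * L.bCoeff) u := by
    simpa using L.hasDerivAt_derivWeierstrassP_xFun (v := 0) (u := u) (by simpa using hu.1)
  have := hP.fun_neg.fun_div ((L.hasDerivAt_xFun hu.1).const_mul 2) (mul_ne_zero two_ne_zero h0)
  convert! this using 1
  rw [eq_div_iff (pow_ne_zero 2 (mul_ne_zero two_ne_zero h0))]
  linear_combination (4 * L.xFun u) * h1 - 2 * hsq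

/-- With x₁, x₂ the two translates of x, this is (x₂ - x₁)² = (x₁ + x₂)² - 4x₁x₂, where x₁x₂ = b and
x₁ + x₂ = f² - a. -/
lemma deriv_fFun_sq {u : ℂ} (hu : u ∈ L.regularSet) :
    deriv L.fFun u ^ 2 = (L.fFun u ^ 2 - L.aCoeff) ^ 2 - 4 * L.bCoeff := by
  rw [(L.hasDerivAt_fFun hu).deriv, L.fFun_sq hu, ← L.xFun_mul_xFun_add hu]; ring

lemma deriv_deriv_fFun {u : ℂ} (hu : u ∈ L.regularSet) :
    HasDerivAt (deriv L.fFun) (2 * L.fFun u * (L.fFun u ^ 2 - L.aCoeff)) u := by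
  have h0 := L.xFun_ne_zero hu
  have e : deriv L.fFun =ᶠ[𝓝 u] fun s ↦ L.xFun (L.ω₂ / 2 + s) - L.xFun s := by
    filter_upwards [L.eventually_mem_regularSet hu] with s hs using (L.hasDerivAt_fFun hs).deriv
  refine HasDerivAt.congr_of_eventuallyEq ?_ e
  have h1 := (L.hasDerivAt_xFun_const_add hu.2)
  have h2 := (L.hasDerivAt_xFun hu.1)
  -- The derivative of the constant product x₁x₂ = b.
  have h3 : L.derivWeierstrassP u * L.xFun (L.ω₂ / 2 + u) +
      L.xFun u * L.derivWeierstrassP (L.ω₂ / 2 + u) = 0 := by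
    have hc : (fun s ↦ L.xFun s * L.xFun (L.ω₂ / 2 + s)) =ᶠ[𝓝 u] fun _ ↦ L.bCoeff := by
      filter_upwards [L.eventually_mem_regularSet hu] with s hs using L.xFun_mul_xFun_add hs
    exact (h2.fun_mul h1).unique ((hasDerivAt_const u L.bCoeff).congr_of_eventuallyEq hc)
  have hf : L.derivWeierstrassP u = -2 * L.fFun u * L.xFun u := by
    rw [fFun]; field_simp
  convert! h1.fun_sub h2 using 1
  rw [hf] at h3 ⊢
  apply mul_left_cancel₀ h0
  rw [L.fFun_sq hu]
  linear_combination -h3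

end PeriodPair

/-! ### Critical points and poles of f, and its determination by the differential equation -/

namespace PeriodPair

open Filter Topology

variable (L : PeriodPair)

lemma countable_compl_regularSet : L.regularSetᶜ.Countable := by
  have : L.regularSetᶜ = (L.lattice : Set ℂ) ∪ ((fun u ↦ L.ω₂ / 2 + u) ⁻¹' L.lattice) := by
    ext u
    simp only [regularSet, Set.mem_compl_iff, Set.mem_ofPred_eq, Set.mem_union, SetLike.mem_coe,
      Set.mem_preimage]
    tauto
  rw [this]
  refine L.countable_lattice.union (L.countable_lattice.preimage_of_injOn ?_)
  intro a _ b _ h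
  simpa using h

lemma tendsto_const_add_punctured (v c u : ℂ) (hc : c ≠ 0) :
    Tendsto (fun s ↦ v + c * s) (𝓝[≠] u) (𝓝[≠] (v + c * u)) := by
  refine tendsto_nhdsWithin_iff.mpr ⟨?_, ?_⟩
  · exact (Continuous.tendsto (by fun_prop) u).mono_left nhdsWithin_le_nhds
  · filter_upwards [self_mem_nhdsWithin] with s hs h
    exact hs (by simpa [hc] using h)

lemma eventually_notMem_lattice (u : ℂ) : ∀ᶠ s in 𝓝[≠] u, s ∉ L.lattice := by
  filter_upwards [mem_nhdsWithin_of_mem_nhds (L.compl_lattice_sdiff_singleton_mem_nhds u),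
    self_mem_nhdsWithin] with s h1 h2 h
  exact h1 ⟨h, h2⟩

lemma eventually_mem_regularSet_punctured (u : ℂ) : ∀ᶠ s in 𝓝[≠] u, s ∈ L.regularSet := by
  have h := tendsto_const_add_punctured (L.ω₂ / 2) 1 u one_ne_zero
  simp only [one_mul] at h
  filter_upwards [L.eventually_notMem_lattice u, h.eventually (L.eventually_notMem_lattice _)]
    with s h1 h2 using ⟨h1, h2⟩

lemma fFun_add_of_mem (u : ℂ) {l : ℂ} (hl : l ∈ L.lattice) : L.fFun (u + l) = L.fFun u := by
  rw [fFun, fFun, xFun, xFun, L.weierstrassP_add_of_mem u hl, L.derivWeierstrassP_add_of_mem u hl]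

lemma xFun_add_of_mem (u : ℂ) {l : ℂ} (hl : l ∈ L.lattice) : L.xFun (u + l) = L.xFun u := by
  rw [xFun, xFun, L.weierstrassP_add_of_mem u hl]

lemma half_add_mem_regularSet_iff {u : ℂ} :
    L.ω₂ / 2 + u ∈ L.regularSet ↔ u ∈ L.regularSet := by
  simp only [regularSet, Set.mem_ofPred_eq, ← add_assoc]
  rw [add_halves, add_comm L.ω₂ u, L.lattice.add_mem_iff_left L.ω₂_mem_lattice, and_comm]

lemma fFun_half_add_sq {u : ℂ} (hu : u ∈ L.regularSet) :
    L.fFun (L.ω₂ / 2 + u) ^ 2 = L.fFun u ^ 2 := by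
  rw [L.fFun_sq hu, L.fFun_sq (L.half_add_mem_regularSet_iff.mpr hu), ← add_assoc, add_halves,
    add_comm L.ω₂ u, L.xFun_add_of_mem _ L.ω₂_mem_lattice]
  ring

lemma fFun_half₁ : L.fFun (L.ω₁ / 2) = 0 := by
  rw [fFun, L.derivWeierstrassP_eq_zero_of_two_mul_mem L.two_mul_half₁]; simp

lemma weierstrassP_half_add_eq {u : ℂ} (h : L.ω₂ / 2 + 2 * u ∈ L.lattice) :
    L.weierstrassP (L.ω₂ / 2 + u) = L.weierstrassP u := by
  have := L.weierstrassP_add_of_mem (-u) h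
  rw [L.weierstrassP_neg] at this
  rw [← this]; congr 1; ring

/-- At such a point u + ω₂/2 ≡ -u modulo the lattice, so the two values of ℘ whose difference is f'
agree. -/
lemma deriv_fFun_eq_zero {u : ℂ} (hu : u ∈ L.regularSet) (h : L.ω₂ / 2 + 2 * u ∈ L.lattice) :
    deriv L.fFun u = 0 := by
  rw [(L.hasDerivAt_fFun hu).deriv, xFun, xFun, L.weierstrassP_half_add_eq h]; simp

lemma fFun_sq_sub_sq {u : ℂ} (hu : u ∈ L.regularSet) (h : L.ω₂ / 2 + 2 * u ∈ L.lattice) :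
    (L.fFun u ^ 2 - L.aCoeff) ^ 2 = 4 * L.bCoeff := by
  have := L.deriv_fFun_sq hu
  rw [L.deriv_fFun_eq_zero hu h] at this
  linear_combination -this

lemma fFun_ne_zero {u : ℂ} (hu : u ∈ L.regularSet) (h : L.ω₂ / 2 + 2 * u ∈ L.lattice) :
    L.fFun u ≠ 0 := by
  intro h0
  have := L.fFun_sq_sub_sq hu h
  rw [h0] at this
  exact L.aCoeff_sq_sub_ne_zero (by linear_combination this)

lemma fFun_sq_ne_aCoeff {u : ℂ} (hu : u ∈ L.regularSet) (h : L.ω₂ / 2 + 2 * u ∈ L.lattice) :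
    L.fFun u ^ 2 ≠ L.aCoeff := by
  intro h0
  have := L.fFun_sq_sub_sq hu h
  rw [h0] at this
  exact L.bCoeff_ne_zero (by linear_combination -this / 4)

/-- In f² = x(u) + x(u + ω₂/2) + a exactly one summand has a pole at u. The square is used because
its expression as a sum of ℘-values shows the pole directly. -/
lemma tendsto_fFun_sq_cobounded {u : ℂ} (hu : u ∉ L.regularSet) :
    Tendsto (fun s ↦ L.fFun s ^ 2) (𝓝[≠] u) (Bornology.cobounded ℂ) := by
  have hev : (fun s ↦ L.fFun s ^ 2) =ᶠ[𝓝[≠] u]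
      fun s ↦ L.weierstrassP s + L.weierstrassP (L.ω₂ / 2 + s) - 2 * L.e₂ + L.aCoeff := by
    filter_upwards [L.eventually_mem_regularSet_punctured u] with s hs
    rw [L.fFun_sq hs, xFun, xFun]; ring
  have hcb : ∀ {p q : ℂ → ℂ} {c : ℂ}, Tendsto p (𝓝[≠] u) (Bornology.cobounded ℂ) →
      Tendsto q (𝓝[≠] u) (𝓝 c) → Tendsto (fun s ↦ p s + q s) (𝓝[≠] u) (Bornology.cobounded ℂ) := by
    intro p q c hp hq
    rw [← tendsto_norm_atTop_iff_cobounded] at hp ⊢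
    refine tendsto_atTop_mono (fun s ↦ ?_) (hp.atTop_add hq.norm.neg)
    have := norm_sub_le (p s + q s) (q s)
    rw [add_sub_cancel_right] at this
    linarith
  refine Tendsto.congr' hev.symm ?_
  have htr : Tendsto (fun s ↦ L.ω₂ / 2 + s) (𝓝[≠] u) (𝓝[≠] (L.ω₂ / 2 + u)) := by
    simpa using tendsto_const_add_punctured (L.ω₂ / 2) 1 u one_ne_zero
  by_cases h : u ∈ L.lattice
  · have h2 : L.ω₂ / 2 + u ∉ L.lattice := by
      rw [L.lattice.add_mem_iff_left h]; exact L.ω₂_div_two_notMem_lattice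
    have c := ((L.analyticAt_weierstrassP_const_add h2).continuousAt.tendsto.mono_left
      nhdsWithin_le_nhds : Tendsto _ (𝓝[≠] u) _)
    refine (hcb (L.tendsto_weierstrassP_cobounded h)
      ((c.sub_const (2 * L.e₂)).add_const L.aCoeff)).congr (fun s ↦ ?_)
    ring
  · have h2 : L.ω₂ / 2 + u ∈ L.lattice := by
      by_contra h2; exact hu ⟨h, h2⟩
    have c := ((L.analyticAt_weierstrassP h).continuousAt.tendsto.mono_left
      nhdsWithin_le_nhds : Tendsto _ (𝓝[≠] u) _)
    refine (hcb ((L.tendsto_weierstrassP_cobounded h2).comp htr)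
      ((c.sub_const (2 * L.e₂)).add_const L.aCoeff)).congr (fun s ↦ ?_)
    simp only [Function.comp_apply]
    ring

lemma hasDerivAt_comp_affine {h : ℂ → ℂ} {h' v c u : ℂ} (hh : HasDerivAt h h' (v + c * u)) :
    HasDerivAt (fun s ↦ h (v + c * s)) (c * h') u := by
  have := hh.comp u (((hasDerivAt_id u).const_mul c).const_add v)
  simpa [mul_comm, Function.comp_def] using this

lemma analyticAt_comp_affine {h : ℂ → ℂ} {v c u : ℂ} (hh : AnalyticAt ℂ h (v + c * u)) :
    AnalyticAt ℂ (fun s ↦ h (v + c * s)) u :=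
  AnalyticAt.fun_comp (g := h) (f := fun s ↦ v + c * s) hh (by fun_prop)

lemma analyticAt_comp_const_add {h : ℂ → ℂ} {v u : ℂ} (hh : AnalyticAt ℂ h (v + u)) :
    AnalyticAt ℂ (fun s ↦ h (v + s)) u :=
  AnalyticAt.fun_comp (g := h) (f := fun s ↦ v + s) hh (by fun_prop)

/-- Two of the functions `f`, for different lattices, which satisfy the same differential equation
up to scaling coincide up to scaling. -/
theorem fFun_unique (L₁ L₂ : PeriodPair) {c v w : ℂ} (hc : c ≠ 0)
    (hv : v ∈ L₁.regularSet) (hw : w ∈ L₂.regularSet)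
    (hv' : deriv L₁.fFun v = 0) (hw' : deriv L₂.fFun w = 0)
    (hval : c * L₁.fFun v = L₂.fFun w) (ha : c ^ 2 * L₁.aCoeff = L₂.aCoeff) (u : ℂ) :
    (v + c * u ∈ L₁.regularSet ↔ w + u ∈ L₂.regularSet) ∧
    (w + u ∈ L₂.regularSet → c * L₁.fFun (v + c * u) = L₂.fFun (w + u)) := by
  set V : Set ℂ := {u : ℂ | v + c * u ∉ L₁.regularSetᶜ ∧ w + u ∉ L₂.regularSetᶜ} with hV
  have hmem : ∀ u, u ∈ V ↔ v + c * u ∈ L₁.regularSet ∧ w + u ∈ L₂.regularSet := by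
    intro u; simp [hV]
  have hVp : IsPreconnected V := isPreconnected_compl_translates
    L₁.countable_compl_regularSet L₂.countable_compl_regularSet c v w hc
  have h0V : (0 : ℂ) ∈ V := by rw [hmem]; simp [hv, hw]
  have hd1 : ∀ u ∈ V, HasDerivAt (fun s ↦ c * L₁.fFun (v + c * s))
      (c ^ 2 * deriv L₁.fFun (v + c * u)) u := by
    intro u hu
    have := (hasDerivAt_comp_affine
      (L₁.analyticAt_fFun ((hmem u).mp hu).1).differentiableAt.hasDerivAt).const_mul c
    convert! this using 1; ring
  have hd2 : ∀ u ∈ V, HasDerivAt (fun s ↦ L₂.fFun (w + s)) (deriv L₂.fFun (w + u)) u := fun u hu ↦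
    (L₂.analyticAt_fFun ((hmem u).mp hu).2).differentiableAt.hasDerivAt.comp_const_add w u
  have hd : ∀ u ∈ V, HasDerivAt (fun s ↦ c * L₁.fFun (v + c * s) - L₂.fFun (w + s))
      (c ^ 2 * deriv L₁.fFun (v + c * u) - deriv L₂.fFun (w + u)) u :=
    fun u hu ↦ (hd1 u hu).fun_sub (hd2 u hu)
  have hVn : ∀ u ∈ V, ∀ᶠ s in 𝓝 u, s ∈ V := by
    intro u hu
    have c1 : Tendsto (fun s ↦ v + c * s) (𝓝 u) (𝓝 (v + c * u)) :=
      Continuous.tendsto (by fun_prop) u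
    have c2 : Tendsto (fun s ↦ w + s) (𝓝 u) (𝓝 (w + u)) := Continuous.tendsto (by fun_prop) u
    filter_upwards [c1.eventually (L₁.eventually_mem_regularSet ((hmem u).mp hu).1),
      c2.eventually (L₂.eventually_mem_regularSet ((hmem u).mp hu).2)] with s h1 h2
    exact (hmem s).mpr ⟨h1, h2⟩
  have hA1 : ∀ u ∈ V, AnalyticAt ℂ (fun s ↦ c * L₁.fFun (v + c * s)) u := fun u hu ↦
    analyticAt_const.mul (analyticAt_comp_affine (L₁.analyticAt_fFun ((hmem u).mp hu).1))
  have hA2 : ∀ u ∈ V, AnalyticAt ℂ (fun s ↦ L₂.fFun (w + s)) u := fun u hu ↦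
    analyticAt_comp_const_add (L₂.analyticAt_fFun ((hmem u).mp hu).2)
  have hA : AnalyticOnNhd ℂ (fun s ↦ c * L₁.fFun (v + c * s) - L₂.fFun (w + s)) V :=
    fun u hu ↦ (hA1 u hu).sub (hA2 u hu)
  -- After scaling, both functions satisfy Y'' = 2Y³ - 2aY with the same a; the difference of the
  -- nonlinear terms factors through the difference of the solutions.
  have hz : ∀ᶠ u in 𝓝 (0 : ℂ), c * L₁.fFun (v + c * u) - L₂.fFun (w + u) = 0 := by
    refine (hA 0 h0V).eventually_eq_zero_of_deriv_deriv_eq_mul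
      (q := fun s ↦ 2 * ((c * L₁.fFun (v + c * s)) ^ 2 + c * L₁.fFun (v + c * s) * L₂.fFun (w + s) +
        L₂.fFun (w + s) ^ 2) - 2 * L₂.aCoeff) ?_ ?_ ?_ ?_
    · have h1 := hA1 0 h0V
      have h2 := hA2 0 h0V
      exact (analyticAt_const.mul (((h1.pow 2).add (h1.mul h2)).add (h2.pow 2))).sub analyticAt_const
    · simp [hval]
    · rw [(hd 0 h0V).deriv]; simp [hv', hw']
    · filter_upwards [hVn 0 h0V] with u hu
      have e : deriv (fun s ↦ c * L₁.fFun (v + c * s) - L₂.fFun (w + s)) =ᶠ[𝓝 u]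
          fun s ↦ c ^ 2 * deriv L₁.fFun (v + c * s) - deriv L₂.fFun (w + s) := by
        filter_upwards [hVn u hu] with s hs using (hd s hs).deriv
      rw [e.deriv_eq]
      have hr := (hmem u).mp hu
      rw [(((hasDerivAt_comp_affine (L₁.deriv_deriv_fFun hr.1)).const_mul (c ^ 2)).fun_sub
        ((L₂.deriv_deriv_fFun hr.2).comp_const_add w u)).deriv, ← ha]
      ring
  have hz' := hA.eqOn_zero_of_preconnected_of_eventuallyEq_zero hVp h0V hz
  have hVe : ∀ u, ∀ᶠ s in 𝓝[≠] u, s ∈ V := by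
    intro u
    have c2 := tendsto_const_add_punctured w 1 u one_ne_zero
    simp only [one_mul] at c2
    filter_upwards [(tendsto_const_add_punctured v c u hc).eventually
        (L₁.eventually_mem_regularSet_punctured _),
      c2.eventually (L₂.eventually_mem_regularSet_punctured _)] with s h1 h2
    exact (hmem s).mpr ⟨h1, h2⟩
  have heq : (fun s ↦ L₂.fFun (w + s) ^ 2) =ᶠ[𝓝[≠] u]
      fun s ↦ (c * L₁.fFun (v + c * s)) ^ 2 := by
    filter_upwards [hVe u] with s hs
    rw [sub_eq_zero.mp (hz' hs)]
  have t1 : v + c * u ∉ L₁.regularSet →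
      Tendsto (fun s ↦ (c * L₁.fFun (v + c * s)) ^ 2) (𝓝[≠] u) (Bornology.cobounded ℂ) := by
    intro h
    have := (L₁.tendsto_fFun_sq_cobounded h).comp (tendsto_const_add_punctured v c u hc)
    have h2 := (tendsto_mul_left_cobounded (pow_ne_zero 2 hc)).comp this
    refine h2.congr (fun s ↦ ?_)
    simp only [Function.comp_apply]; ring
  have t2 : w + u ∉ L₂.regularSet →
      Tendsto (fun s ↦ L₂.fFun (w + s) ^ 2) (𝓝[≠] u) (Bornology.cobounded ℂ) := by
    intro h
    have c2 := tendsto_const_add_punctured w 1 u one_ne_zero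
    simp only [one_mul] at c2
    exact (L₂.tendsto_fFun_sq_cobounded h).comp c2
  -- The functions agree near each point away from the point itself, so a pole of one is a pole of
  -- the other.
  have hiff : v + c * u ∈ L₁.regularSet ↔ w + u ∈ L₂.regularSet := by
    constructor
    · intro h
      by_contra h'
      have ha : AnalyticAt ℂ (fun s ↦ (c * L₁.fFun (v + c * s)) ^ 2) u :=
        (analyticAt_const.mul (analyticAt_comp_affine (L₁.analyticAt_fFun h))).fun_pow 2
      exact ((t2 h').congr' heq).not_tendsto (Metric.disjoint_cobounded_nhds _)
        (ha.continuousAt.tendsto.mono_left nhdsWithin_le_nhds)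
    · intro h
      by_contra h'
      have ha : AnalyticAt ℂ (fun s ↦ (L₂.fFun (w + s)) ^ 2) u :=
        (analyticAt_comp_const_add (L₂.analyticAt_fFun h)).fun_pow 2
      exact ((t1 h').congr' heq.symm).not_tendsto (Metric.disjoint_cobounded_nhds _)
        (ha.continuousAt.tendsto.mono_left nhdsWithin_le_nhds)
  exact ⟨hiff, fun h ↦ sub_eq_zero.mp (hz' ((hmem u).mpr ⟨hiff.mpr h, h⟩))⟩

end PeriodPair

/-! ### The lattices attached to z, and a parameter separating Γ(2)-orbits -/

noncomputable section

namespace LevelTwoEisenstein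

open Complex UpperHalfPlane CongruenceSubgroup
open scoped MatrixGroups

lemma int_mul_add_int_eq_zero (z : ℍ) {a b : ℤ} (h : (a : ℂ) * z + b = 0) : a = 0 ∧ b = 0 := by
  have h1 := congrArg Complex.im h
  simp only [add_im, mul_im, intCast_re, intCast_im, zero_mul, add_zero, zero_im] at h1
  have ha : a = 0 := by
    rcases mul_eq_zero.mp h1 with h1 | h1
    · exact_mod_cast h1
    · exact absurd h1 z.im_ne_zero
  subst ha
  simpa using h

lemma int_mul_add_int_inj (z : ℍ) {a b c d : ℤ} (h : (a : ℂ) * z + b = c * z + d) :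
    a = c ∧ b = d := by
  have := int_mul_add_int_eq_zero z (a := a - c) (b := b - d) (by push_cast; linear_combination h)
  omega

/-- The period pair `(2z + 2, 4)`. -/
def periods (z : ℍ) : PeriodPair where
  ω₁ := 2 * z + 2
  ω₂ := 4
  indep := by
    rw [LinearIndependent.pair_iff]
    intro s t h
    have h1 := congrArg Complex.im h
    have h2 := congrArg Complex.re h
    simp at h1 h2
    have hs : s = 0 := by
      rcases h1 with h1 | h1
      · exact h1
      · exact absurd h1 z.im_ne_zero
    subst hs
    simpa using h2

/-- The lattice spanned by `2z` and `2`. -/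
def EvenPoint (z : ℍ) (u : ℂ) : Prop := ∃ m n : ℤ, u = 2 * m * z + 2 * n

lemma mem_periods_lattice (z : ℍ) (u : ℂ) :
    u ∈ (periods z).lattice ↔ ∃ m n : ℤ, m * (2 * (z : ℂ) + 2) + n * 4 = u :=
  PeriodPair.mem_lattice

/-- The period lattice has index two in 2ℤz + 2ℤ, and ω₂/2 = 2 represents the other coset; the
parity of n - m tells which coset a point lies in. -/
lemma mem_regularSet_iff (z : ℍ) (u : ℂ) : u ∈ (periods z).regularSet ↔ ¬ EvenPoint z u := by
  have hh : (periods z).ω₂ / 2 = 2 := by norm_num [periods]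
  rw [PeriodPair.regularSet, Set.mem_ofPred_eq, hh, mem_periods_lattice, mem_periods_lattice,
    ← not_or, not_iff_not]
  constructor
  · rintro (⟨m, n, h⟩ | ⟨m, n, h⟩)
    · exact ⟨m, m + 2 * n, by rw [← h]; push_cast; ring⟩
    · exact ⟨m, m + 2 * n - 1, by push_cast; linear_combination -h⟩
  · rintro ⟨m, n, h⟩
    rcases Int.even_or_odd (n - m) with ⟨r, hr⟩ | ⟨r, hr⟩
    · left
      refine ⟨m, r, ?_⟩
      have : (n : ℂ) = m + 2 * r := by
        have : n = m + 2 * r := by omega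
        exact_mod_cast this
      rw [h, this]; ring
    · right
      refine ⟨m, r + 1, ?_⟩
      have : (n : ℂ) = m + 2 * r + 1 := by
        have : n = m + 2 * r + 1 := by omega
        exact_mod_cast this
      rw [h, this]; push_cast; ring

lemma EvenPoint.add {z : ℍ} {u v : ℂ} (hu : EvenPoint z u) (hv : EvenPoint z v) :
    EvenPoint z (u + v) := by
  obtain ⟨m, n, rfl⟩ := hu
  obtain ⟨m', n', rfl⟩ := hv
  exact ⟨m + m', n + n', by push_cast; ring⟩

lemma EvenPoint.neg {z : ℍ} {u : ℂ} (hu : EvenPoint z u) : EvenPoint z (-u) := by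
  obtain ⟨m, n, rfl⟩ := hu
  exact ⟨-m, -n, by push_cast; ring⟩

lemma EvenPoint.add_iff {z : ℍ} {u v : ℂ} (hv : EvenPoint z v) :
    EvenPoint z (v + u) ↔ EvenPoint z u :=
  ⟨fun h ↦ by simpa using hv.neg.add h, fun h ↦ hv.add h⟩

lemma evenPoint_int_iff (z : ℍ) (a b : ℤ) : EvenPoint z (a * z + b) ↔ Even a ∧ Even b := by
  constructor
  · rintro ⟨m, n, h⟩
    have := int_mul_add_int_inj z (a := a) (b := b) (c := 2 * m) (d := 2 * n)
      (by push_cast; exact h)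
    exact ⟨⟨m, by omega⟩, ⟨n, by omega⟩⟩
  · rintro ⟨⟨m, hm⟩, ⟨n, hn⟩⟩
    exact ⟨m, n, by rw [hm, hn]; push_cast; ring⟩

lemma self_mem_regularSet (z : ℍ) : (z : ℂ) ∈ (periods z).regularSet := by
  rw [mem_regularSet_iff]
  have := evenPoint_int_iff z 1 0
  simp at this
  exact this

lemma one_mem_regularSet (z : ℍ) : (1 : ℂ) ∈ (periods z).regularSet := by
  rw [mem_regularSet_iff]
  have := evenPoint_int_iff z 0 1
  simp at this
  exact this

/-- This makes u = z a critical point of f, which is the reason for the choice of periods; u = 1 is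
another one. -/
lemma half_add_two_mul_self_mem (z : ℍ) :
    (periods z).ω₂ / 2 + 2 * z ∈ (periods z).lattice := by
  rw [mem_periods_lattice]
  exact ⟨1, 0, by simp [periods]; ring⟩

lemma half_add_two_mul_one_mem (z : ℍ) :
    (periods z).ω₂ / 2 + 2 * 1 ∈ (periods z).lattice := by
  rw [mem_periods_lattice]
  exact ⟨0, 1, by simp [periods]; norm_num⟩

lemma fFun_self_ne_zero (z : ℍ) : (periods z).fFun z ≠ 0 :=
  (periods z).fFun_ne_zero (self_mem_regularSet z) (half_add_two_mul_self_mem z)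

lemma fFun_one_ne_zero (z : ℍ) : (periods z).fFun 1 ≠ 0 :=
  (periods z).fFun_ne_zero (one_mem_regularSet z) (half_add_two_mul_one_mem z)

lemma fFun_add_one (z : ℍ) : (periods z).fFun (z + 1) = 0 := by
  rw [← (periods z).fFun_half₁]
  congr 1
  simp [periods]
  ring

lemma fFun_sq_add_evenPoint (z : ℍ) {u v : ℂ} (hu : u ∈ (periods z).regularSet)
    (hv : EvenPoint z v) : (periods z).fFun (v + u) ^ 2 = (periods z).fFun u ^ 2 := by
  obtain ⟨m, n, rfl⟩ := hv
  have hh : (periods z).ω₂ / 2 = 2 := by norm_num [periods]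
  rcases Int.even_or_odd (n - m) with ⟨r, hr⟩ | ⟨r, hr⟩
  · have : 2 * m * (z : ℂ) + 2 * n ∈ (periods z).lattice := by
      rw [mem_periods_lattice]
      refine ⟨m, r, ?_⟩
      have : (n : ℂ) = m + 2 * r := by
        have : n = m + 2 * r := by omega
        exact_mod_cast this
      rw [this]; ring
    rw [add_comm, PeriodPair.fFun_add_of_mem _ _ this]
  · have : 2 * m * (z : ℂ) + 2 * (n - 1) ∈ (periods z).lattice := by
      rw [mem_periods_lattice]
      refine ⟨m, r, ?_⟩
      have : (n : ℂ) = m + 2 * r + 1 := by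
        have : n = m + 2 * r + 1 := by omega
        exact_mod_cast this
      rw [this]; ring
    rw [show 2 * m * (z : ℂ) + 2 * n + u = ((periods z).ω₂ / 2 + u) + (2 * m * z + 2 * (n - 1)) by
      rw [hh]; ring, PeriodPair.fFun_add_of_mem _ _ this, PeriodPair.fFun_half_add_sq _ hu]

/-- A Hauptmodul of `Γ(2)` built from the Weierstrass function. -/
def hauptmodul (z : ℍ) : ℂ :=
  (2 * (periods z).aCoeff - (periods z).fFun z ^ 2) / (periods z).fFun z ^ 2

/-- The values of f² at critical points are roots of (Y - a)² = 4b, and the parameter is the ratio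
of the other root to f(z)². Ratio 1 would mean a double root, that is b = 0. -/
lemma hauptmodul_ne_one (z : ℍ) : hauptmodul z ≠ 1 := by
  intro h
  rw [hauptmodul, div_eq_one_iff_eq (pow_ne_zero 2 (fFun_self_ne_zero z))] at h
  refine (periods z).fFun_sq_ne_aCoeff (self_mem_regularSet z) (half_add_two_mul_self_mem z) ?_
  linear_combination -h / 2

lemma exists_mem_Gamma_two {z w : ℍ} {c : ℂ} (hc : c ≠ 0) {A B C D : ℤ}
    (h1 : c * w = A * z + B) (h2 : c = C * z + D) (hA : Odd A) (hB : Even B) (hC : Even C)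
    (hD : Odd D) (hdet : A * D - B * C = 1 ∨ A * D - B * C = -1) :
    ∃ γ ∈ CongruenceSubgroup.Gamma 2, γ • z = w := by
  have hw : (w : ℂ) = (A * z + B) / (C * z + D) := by
    rw [← h1, ← h2]; field_simp
  -- Im w · |c|² = (AD - BC) Im z, so positivity of both imaginary parts excludes determinant -1.
  have him : (w : ℂ).im * normSq c = (A * D - B * C) * (z : ℂ).im := by
    have e : (w : ℂ) * normSq c = (A * z + B) * (starRingEnd ℂ) (C * z + D) := by
      rw [← h1, ← h2, mul_comm c, mul_assoc, mul_conj]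
    have := congrArg Complex.im e
    simp [mul_im, mul_re] at this
    rw [coe_im, coe_im]
    linear_combination this
  have hpos : 0 < (w : ℂ).im * normSq c := mul_pos w.im_pos (normSq_pos.mpr hc)
  have hdet1 : A * D - B * C = 1 := by
    rcases hdet with h | h
    · exact h
    · have h' : (A * D - B * C : ℝ) = -1 := by exact_mod_cast h
      rw [him, h'] at hpos
      have := z.im_pos
      rw [coe_im] at hpos
      linarith
  obtain ⟨γ, hγ⟩ : ∃ γ : SL(2, ℤ), (γ : Matrix (Fin 2) (Fin 2) ℤ) = !![A, B; C, D] :=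
    ⟨⟨!![A, B; C, D], by rw [Matrix.det_fin_two_of]; exact hdet1⟩, rfl⟩
  refine ⟨γ, ?_, ?_⟩
  · rw [Gamma_mem]
    have odd1 : ∀ {n : ℤ}, Odd n → ((n : ZMod 2)) = 1 := by
      intro n hn; obtain ⟨k, rfl⟩ := hn; push_cast
      rw [show (2 : ZMod 2) = 0 from rfl]; simp
    have even0 : ∀ {n : ℤ}, Even n → ((n : ZMod 2)) = 0 := by
      intro n hn; exact (ZMod.intCast_zmod_eq_zero_iff_dvd _ 2).mpr hn.two_dvd
    simp [hγ, odd1 hA, odd1 hD, even0 hB, even0 hC]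
  · ext1
    rw [specialLinearGroup_apply]
    simp [hγ, hw]

/-- Equal parameters make the two functions f satisfy the same equation after scaling by c, so c
f_z(z + cu) = f_w(w + u). Matching poles shows that multiplication by c carries 2ℤw + 2ℤ onto 2ℤz +
2ℤ, which gives an integral matrix of determinant ±1. Its congruence class is read off from the
points modulo the pole lattice. -/
theorem exists_Gamma_two_of_hauptmodul_eq {z w : ℍ} (h : hauptmodul z = hauptmodul w) :
    ∃ γ ∈ CongruenceSubgroup.Gamma 2, γ • z = w := by
  have hz0 := fFun_self_ne_zero z
  have hw0 := fFun_self_ne_zero w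
  set c : ℂ := (periods w).fFun w / (periods z).fFun z with hcdef
  have hc : c ≠ 0 := div_ne_zero hw0 hz0
  have hval : c * (periods z).fFun z = (periods w).fFun w := by rw [hcdef]; field_simp
  have ha : c ^ 2 * (periods z).aCoeff = (periods w).aCoeff := by
    rw [hauptmodul, hauptmodul, div_eq_div_iff (pow_ne_zero 2 hz0) (pow_ne_zero 2 hw0)] at h
    rw [hcdef, div_pow]
    field_simp
    linear_combination h / 2
  have huniq := PeriodPair.fFun_unique (periods z) (periods w) hc (self_mem_regularSet z)
    (self_mem_regularSet w)
    ((periods z).deriv_fFun_eq_zero (self_mem_regularSet z) (half_add_two_mul_self_mem z))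
    ((periods w).deriv_fFun_eq_zero (self_mem_regularSet w) (half_add_two_mul_self_mem w)) hval ha
  have hiff : ∀ u, EvenPoint z (z + c * u) ↔ EvenPoint w (w + u) := by
    intro u
    have := (huniq u).1
    rwa [mem_regularSet_iff, mem_regularSet_iff, not_iff_not] at this
  have hdiff : EvenPoint z (z + c * -w) := by
    rw [hiff]; exact ⟨0, 0, by simp⟩
  have hmul : ∀ u, EvenPoint z (c * u) ↔ EvenPoint w u := by
    intro u
    have h1 := hiff (u - w)
    rw [show (z : ℂ) + c * (u - w) = (z + c * -w) + c * u by ring, hdiff.add_iff] at h1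
    rw [h1]; simp
  obtain ⟨m, n, hmn⟩ := hdiff
  obtain ⟨C, D, hCD⟩ : EvenPoint z (c * 2) := (hmul 2).mpr ⟨0, 1, by simp⟩
  have hcw : c * w = ((1 - 2 * m : ℤ) : ℂ) * z + ((-2 * n : ℤ) : ℂ) := by
    push_cast; linear_combination -hmn
  have hcCD : c = C * z + D := by linear_combination hCD / 2
  have hdiff : EvenPoint z (z + c * -w) := ⟨m, n, hmn⟩
  have hcreg : c ∈ (periods z).regularSet := by
    have h1 : (1 : ℂ) ∈ (periods w).regularSet := one_mem_regularSet w
    rw [mem_regularSet_iff] at h1 ⊢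
    rwa [← hmul 1, mul_one] at h1
  have hfc : (periods z).fFun c ≠ 0 := by
    have h1 := (huniq (1 - w)).2 (by rw [add_sub_cancel]; exact one_mem_regularSet w)
    rw [add_sub_cancel, show (z : ℂ) + c * (1 - w) = (z + c * -w) + c by ring] at h1
    have h2 := fFun_sq_add_evenPoint z hcreg hdiff
    intro h0
    rw [h0, zero_pow two_ne_zero, pow_eq_zero_iff two_ne_zero] at h2
    rw [h2, mul_zero] at h1
    exact fFun_one_ne_zero w h1.symm
  have hnot : ¬ EvenPoint z c := (mem_regularSet_iff z c).mp hcreg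
  -- Modulo the pole lattice, c is one of 0, 1, z, z + 1. The class z would make 1 - w a pole point
  -- for w, and z + 1 is a zero of f_z; the class 0 is a pole and is excluded next.
  have hC : Even C := by
    by_contra hC
    rw [Int.not_even_iff_odd] at hC
    rcases Int.even_or_odd D with hD | hD
    · have e1 : EvenPoint z (c * (1 - w)) := by
        have : c * (1 - w) = ((C - (1 - 2 * m) : ℤ) : ℂ) * z + ((D + 2 * n : ℤ) : ℂ) := by
          push_cast; push_cast at hcw; linear_combination hcCD - hcw
        rw [this, evenPoint_int_iff]
        refine ⟨hC.sub_odd ⟨-m, by ring⟩, hD.add ⟨n, by ring⟩⟩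
      rw [hmul] at e1
      have : (1 : ℂ) - w = ((-1 : ℤ) : ℂ) * w + ((1 : ℤ) : ℂ) := by push_cast; ring
      rw [this, evenPoint_int_iff] at e1
      exact absurd e1.2 (by decide)
    · apply hfc
      have e1 : EvenPoint z (c - (z + 1)) := by
        have : c - (z + 1) = ((C - 1 : ℤ) : ℂ) * z + ((D - 1 : ℤ) : ℂ) := by
          push_cast; linear_combination hcCD
        rw [this, evenPoint_int_iff]
        exact ⟨hC.sub_odd odd_one, hD.sub_odd odd_one⟩
      have hr : (z : ℂ) + 1 ∈ (periods z).regularSet := by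
        rw [mem_regularSet_iff]
        have := evenPoint_int_iff z 1 1
        simp at this
        exact this
      have h2 := fFun_sq_add_evenPoint z hr e1
      rw [sub_add_cancel, fFun_add_one] at h2
      simpa using h2
  have hD : Odd D := by
    by_contra hD
    rw [Int.not_odd_iff_even] at hD
    apply hnot
    rw [hcCD, evenPoint_int_iff]
    exact ⟨hC, hD⟩
  -- Expressing 2z/c and 2/c in the pole lattice of w supplies the inverse integer matrix.
  obtain ⟨p, q, hpq⟩ : EvenPoint w (2 * z / c) := by
    rw [← hmul, mul_div_cancel₀ _ hc]; exact ⟨1, 0, by simp⟩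
  obtain ⟨r, s, hrs⟩ : EvenPoint w (2 / c) := by
    rw [← hmul, mul_div_cancel₀ _ hc]; exact ⟨0, 1, by simp⟩
  set A : ℤ := 1 - 2 * m
  set B : ℤ := -2 * n
  have e1 := int_mul_add_int_inj z (a := p * A + q * C) (b := p * B + q * D) (c := 1) (d := 0) (by
    rw [div_eq_iff hc] at hpq
    push_cast
    linear_combination -hpq / 2 - p * hcw - q * hcCD)
  have e2 := int_mul_add_int_inj z (a := r * A + s * C) (b := r * B + s * D) (c := 0) (d := 1) (by
    rw [div_eq_iff hc] at hrs
    push_cast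
    linear_combination -hrs / 2 - r * hcw - s * hcCD)
  refine exists_mem_Gamma_two hc hcw hcCD ⟨-m, by ring⟩ ⟨-n, by ring⟩ hC hD ?_
  apply Int.isUnit_iff.mp
  refine IsUnit.of_mul_eq_one (p * s - q * r) ?_
  linear_combination (r * B + s * D) * e1.1 - (r * A + s * C) * e1.2 + e2.2

end LevelTwoEisenstein

end

/-! ### Even derivatives of f at z: lattice sums on one side, a polynomial in t on the other -/

noncomputable section

namespace PeriodPair

open Filter Topology
open scoped Nat

variable (L : PeriodPair)

lemma iteratedDeriv_weierstrassP {x : ℂ} (hx : x ∉ L.lattice) {n : ℕ} (hn : n ≠ 0) :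
    iteratedDeriv n L.weierstrassP x = (n + 1)! * L.sumInvPow x (n + 2) := by
  obtain ⟨r, hr0, hr⟩ := Metric.nhds_basis_closedBall.mem_iff.mp
    (L.isClosed_lattice.isOpen_compl.mem_nhds hx)
  have h1 := (L.hasFPowerSeriesOnBall_weierstrassP x ⟨r, hr0.le⟩ hr0 hr).hasFPowerSeriesAt
  have h2 := congr($((L.analyticAt_weierstrassP hx).hasFPowerSeriesAt
      |>.eq_formalMultilinearSeries h1).coeff n)
  simp [weierstrassPSeries, hn] at h2
  rw [div_eq_iff (by exact_mod_cast n.factorial_ne_zero)] at h2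
  rw [h2, Nat.factorial_succ]
  push_cast
  ring

lemma iteratedDeriv_fFun {u : ℂ} (hu : u ∈ L.regularSet) {n : ℕ} (hn : n ≠ 0) :
    iteratedDeriv (n + 1) L.fFun u =
      (n + 1)! * (L.sumInvPow (L.ω₂ / 2 + u) (n + 2) - L.sumInvPow u (n + 2)) := by
  have e : deriv L.fFun =ᶠ[𝓝 u]
      fun s ↦ L.weierstrassP (L.ω₂ / 2 + s) - L.weierstrassP s := by
    filter_upwards [L.eventually_mem_regularSet hu] with s hs
    rw [(L.hasDerivAt_fFun hs).deriv, xFun, xFun]; ring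
  rw [iteratedDeriv_succ', e.iteratedDeriv_eq, iteratedDeriv_fun_sub, iteratedDeriv_comp_const_add,
    L.iteratedDeriv_weierstrassP hu.1 hn]
  · simp only
    rw [L.iteratedDeriv_weierstrassP hu.2 hn]
    ring
  · exact (L.analyticAt_weierstrassP_const_add hu.2).contDiffAt
  · exact (L.analyticAt_weierstrassP hu.1).contDiffAt

end PeriodPair

namespace LevelTwoEisenstein

open Polynomial

/-- The even derivatives of a solution of `Y'² = (Y² - 1) (Y² - t)`, as polynomials in `Y` over the
ring of polynomials in `t`. -/
def evenDerivPoly : ℕ → ℂ[X][X]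
  | 0 => X
  -- Chain rule: P(Y)'' = P''(Y) Y'² + P'(Y) Y'' with Y'' = 2Y³ - (1 + t)Y.
  | k + 1 => derivative (derivative (evenDerivPoly k)) * ((X ^ 2 - 1) * (X ^ 2 - C X)) +
      derivative (evenDerivPoly k) * (2 * X ^ 3 - C (1 + X) * X)

/-- All coefficients have degree at most `k`. -/
def CoeffDegreeLE (k : ℕ) (p : ℂ[X][X]) : Prop := ∀ n, (p.coeff n).natDegree ≤ k

lemma CoeffDegreeLE.add {k : ℕ} {p q : ℂ[X][X]} (hp : CoeffDegreeLE k p) (hq : CoeffDegreeLE k q) :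
    CoeffDegreeLE k (p + q) := fun n ↦ by
  rw [coeff_add]
  exact natDegree_add_le_of_degree_le (hp n) (hq n)

lemma CoeffDegreeLE.sub {k : ℕ} {p q : ℂ[X][X]} (hp : CoeffDegreeLE k p) (hq : CoeffDegreeLE k q) :
    CoeffDegreeLE k (p - q) := fun n ↦ by
  rw [coeff_sub]
  exact (natDegree_sub_le_of_le (hp n) (hq n)).trans (max_self k).le

lemma CoeffDegreeLE.mono {k l : ℕ} {p : ℂ[X][X]} (hp : CoeffDegreeLE k p) (h : k ≤ l) :
    CoeffDegreeLE l p := fun n ↦ (hp n).trans h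

lemma CoeffDegreeLE.mul {k l : ℕ} {p q : ℂ[X][X]} (hp : CoeffDegreeLE k p)
    (hq : CoeffDegreeLE l q) : CoeffDegreeLE (k + l) (p * q) := fun n ↦ by
  rw [coeff_mul]
  exact natDegree_sum_le_of_forall_le _ _ fun x _ ↦ natDegree_mul_le_of_le (hp _) (hq _)

lemma coeffDegreeLE_X_pow (n : ℕ) : CoeffDegreeLE 0 (X ^ n) := fun m ↦ by
  rw [coeff_X_pow]
  split_ifs <;> simp

lemma coeffDegreeLE_C (p : ℂ[X]) : CoeffDegreeLE p.natDegree (C p) := fun m ↦ by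
  rw [coeff_C]
  split_ifs <;> simp

lemma CoeffDegreeLE.derivative {k : ℕ} {p : ℂ[X][X]} (hp : CoeffDegreeLE k p) :
    CoeffDegreeLE k (derivative p) := fun n ↦ by
  rw [coeff_derivative]
  have : ((n : ℂ[X]) + 1).natDegree ≤ 0 := by
    rw [← Nat.cast_succ]; exact (natDegree_natCast _).le
  simpa using natDegree_mul_le_of_le (hp (n + 1)) this

lemma coeffDegreeLE_evenDerivPoly (k : ℕ) : CoeffDegreeLE k (evenDerivPoly k) := by
  induction k with
  | zero => simpa [evenDerivPoly] using coeffDegreeLE_X_pow 1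
  | succ k ih =>
    have h1 : CoeffDegreeLE 0 (1 : ℂ[X][X]) := by simpa using coeffDegreeLE_X_pow 0
    have hX : CoeffDegreeLE 0 (X : ℂ[X][X]) := by simpa using coeffDegreeLE_X_pow 1
    have hT : CoeffDegreeLE 1 (C X : ℂ[X][X]) := by simpa using coeffDegreeLE_C X
    have hT1 : CoeffDegreeLE 1 (C (1 + X) : ℂ[X][X]) :=
      (coeffDegreeLE_C (1 + X)).mono (by compute_degree)
    have h2 : CoeffDegreeLE 0 (2 : ℂ[X][X]) := by
      have := coeffDegreeLE_C (2 : ℂ[X])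
      rw [natDegree_ofNat] at this
      exact this
    have e1 : CoeffDegreeLE (0 + 1) ((X ^ 2 - 1) * (X ^ 2 - C X) : ℂ[X][X]) :=
      ((coeffDegreeLE_X_pow 2).sub h1).mul (((coeffDegreeLE_X_pow 2).mono zero_le_one).sub hT)
    have e2 : CoeffDegreeLE 1 (2 * X ^ 3 - C (1 + X) * X : ℂ[X][X]) :=
      ((h2.mul (coeffDegreeLE_X_pow 3)).mono (by norm_num)).sub ((hT1.mul hX).mono (by norm_num))
    rw [evenDerivPoly]
    exact ((ih.derivative.derivative.mul e1).mono (by omega)).add (ih.derivative.mul e2)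

/-- The value at the critical point `Y = 1` of the even derivatives, as a polynomial in `t`. -/
def critPoly (k : ℕ) : ℂ[X] := (evenDerivPoly k).eval 1

lemma natDegree_critPoly_le (k : ℕ) : (critPoly k).natDegree ≤ k := by
  rw [critPoly, eval_eq_sum_range]
  refine natDegree_sum_le_of_forall_le _ _ fun i _ ↦ ?_
  simpa using coeffDegreeLE_evenDerivPoly k i

/-- Specialisation of `evenDerivPoly` at a value of `t`. -/
def evenDerivPolyAt (k : ℕ) (t : ℂ) : ℂ[X] := (evenDerivPoly k).map (evalRingHom t)

lemma eval_critPoly (k : ℕ) (t : ℂ) : (critPoly k).eval t = (evenDerivPolyAt k t).eval 1 := by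
  rw [critPoly, evenDerivPolyAt, eval_map, ← coe_evalRingHom, ← eval₂_hom, map_one]

lemma evenDerivPolyAt_succ (k : ℕ) (t : ℂ) : evenDerivPolyAt (k + 1) t =
    derivative (derivative (evenDerivPolyAt k t)) * ((X ^ 2 - 1) * (X ^ 2 - C t)) +
      derivative (evenDerivPolyAt k t) * (2 * X ^ 3 - C (1 + t) * X) := by
  simp [evenDerivPolyAt, evenDerivPoly, derivative_map]

/-- At Y = 1 the recursion leaves only the factor 2 - (1 + t), which vanishes at t = 1. This root is
never a value of `hauptmodul`, which lowers the bound on zeros from k to k - 1. -/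
lemma eval_one_critPoly {k : ℕ} (hk : k ≠ 0) : (critPoly k).eval 1 = 0 := by
  obtain ⟨k, rfl⟩ := Nat.exists_eq_succ_of_ne_zero hk
  rw [eval_critPoly, evenDerivPolyAt_succ]
  simp
  right; norm_num

open Filter Topology UpperHalfPlane
open scoped Nat

lemma hauptmodul_mul (z : ℍ) : hauptmodul z * (periods z).fFun z ^ 2 =
    2 * (periods z).aCoeff - (periods z).fFun z ^ 2 :=
  div_mul_cancel₀ _ (pow_ne_zero 2 (fFun_self_ne_zero z))

lemma deriv_fFun_sq_eq (z : ℍ) {u : ℂ} (hu : u ∈ (periods z).regularSet) :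
    deriv (periods z).fFun u ^ 2 = ((periods z).fFun u ^ 2 - (periods z).fFun z ^ 2) *
      ((periods z).fFun u ^ 2 - hauptmodul z * (periods z).fFun z ^ 2) := by
  rw [(periods z).deriv_fFun_sq hu, hauptmodul_mul, ← (periods z).fFun_sq_sub_sq
    (self_mem_regularSet z) (half_add_two_mul_self_mem z)]
  ring

lemma hasDerivAt_deriv_fFun (z : ℍ) {u : ℂ} (hu : u ∈ (periods z).regularSet) :
    HasDerivAt (deriv (periods z).fFun) ((periods z).fFun u *
      (2 * (periods z).fFun u ^ 2 - (1 + hauptmodul z) * (periods z).fFun z ^ 2)) u := by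
  convert! (periods z).deriv_deriv_fFun hu using 1
  linear_combination (-(periods z).fFun u) * hauptmodul_mul z

/-- With s = f(z), the function Y = f/s satisfies Y'² = s²(Y² - 1)(Y² - t), so each pair of
derivatives contributes a factor s² and one step of the recursion. -/
lemma iteratedDeriv_two_mul_fFun (z : ℍ) (k : ℕ) {u : ℂ} (hu : u ∈ (periods z).regularSet) :
    iteratedDeriv (2 * k) (periods z).fFun u = (periods z).fFun z ^ (2 * k + 1) *
      (evenDerivPolyAt k (hauptmodul z)).eval ((periods z).fFun u / (periods z).fFun z) := by
  have hs := fFun_self_ne_zero z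
  induction k generalizing u with
  | zero =>
    simp [evenDerivPolyAt, evenDerivPoly]
    field_simp
  | succ k ih =>
    set s := (periods z).fFun z with hsdef
    set t := hauptmodul z with htdef
    set p := evenDerivPolyAt k t
    have hf : ∀ {v}, v ∈ (periods z).regularSet →
        HasDerivAt (fun w ↦ (periods z).fFun w / s) (deriv (periods z).fFun v / s) v := fun hv ↦
      ((periods z).analyticAt_fFun hv).differentiableAt.hasDerivAt.div_const s
    have hq : ∀ (q : ℂ[X]) {v}, v ∈ (periods z).regularSet →
        HasDerivAt (fun w ↦ q.eval ((periods z).fFun w / s))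
        ((derivative q).eval ((periods z).fFun v / s) * (deriv (periods z).fFun v / s)) v :=
      fun q v hv ↦ (q.hasDerivAt _).comp v (hf hv)
    have h0 : ∀ {v}, v ∈ (periods z).regularSet → iteratedDeriv (2 * k) (periods z).fFun =ᶠ[𝓝 v]
        fun w ↦ s ^ (2 * k + 1) * p.eval ((periods z).fFun w / s) := fun hv ↦ by
      filter_upwards [(periods z).eventually_mem_regularSet hv] with w hw using ih hw
    have h1 : ∀ {v}, v ∈ (periods z).regularSet → deriv (iteratedDeriv (2 * k) (periods z).fFun) v =
        s ^ (2 * k + 1) * ((derivative p).eval ((periods z).fFun v / s) *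
          (deriv (periods z).fFun v / s)) := fun {v} hv ↦ by
      rw [(h0 hv).deriv_eq, ((hq p hv).const_mul _).deriv]
    have h1' : deriv (iteratedDeriv (2 * k) (periods z).fFun) =ᶠ[𝓝 u] fun v ↦
        s ^ (2 * k + 1) * ((derivative p).eval ((periods z).fFun v / s) *
          (deriv (periods z).fFun v / s)) := by
      filter_upwards [(periods z).eventually_mem_regularSet hu] with w hw using h1 hw
    rw [show 2 * (k + 1) = 2 * k + 1 + 1 by ring, iteratedDeriv_succ, iteratedDeriv_succ,
      h1'.deriv_eq, (((hq (derivative p) hu).fun_mul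
        ((hasDerivAt_deriv_fFun z hu).div_const s)).const_mul _).deriv, evenDerivPolyAt_succ]
    have e1 := deriv_fFun_sq_eq z hu
    simp only [eval_add, eval_mul, eval_sub, eval_pow, eval_X, eval_C, eval_one, eval_ofNat]
    rw [← hsdef, ← htdef] at e1
    rw [← hsdef]
    have e2 : (deriv (periods z).fFun u / s) * (deriv (periods z).fFun u / s) =
        s ^ 2 * ((((periods z).fFun u / s) ^ 2 - 1) * (((periods z).fFun u / s) ^ 2 - t)) := by
      rw [← pow_two, div_pow, e1]
      field_simp
    have e3 : (periods z).fFun u * (2 * (periods z).fFun u ^ 2 - (1 + t) * s ^ 2) / s =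
        s ^ 2 * (2 * ((periods z).fFun u / s) ^ 3 - (1 + t) * ((periods z).fFun u / s)) := by
      field_simp
    rw [mul_assoc (eval _ _), e2, e3]
    ring

lemma iteratedDeriv_fFun_self (z : ℍ) (k : ℕ) :
    iteratedDeriv (2 * k) (periods z).fFun z =
      (periods z).fFun z ^ (2 * k + 1) * (critPoly k).eval (hauptmodul z) := by
  rw [iteratedDeriv_two_mul_fFun z k (self_mem_regularSet z), div_self (fFun_self_ne_zero z),
    eval_critPoly]

/-- The terms of the lattice sum `∑ (-1)^r ((2q+1) z + 2 (r - q))^{-(2k+1)}`. -/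
def latticeTerm (k : ℕ) (z : ℍ) (x : ℤ × ℤ) : ℂ :=
  (-1) ^ x.2 * (((2 * x.1 + 1 : ℂ) * z + 2 * (x.2 - x.1)) ^ (2 * k + 1))⁻¹

lemma hasSum_sumInvPow_periods (z : ℍ) (x : ℂ) {r : ℕ} (hr : 2 < r) :
    HasSum (fun y : ℤ × ℤ ↦ ((y.1 * (2 * (z : ℂ) + 2) + y.2 * 4 - x) ^ r)⁻¹)
      ((periods z).sumInvPow x r) := by
  have := (periods z).hasSum_sumInvPow x hr
  rw [← (periods z).latticeEquivProd.symm.toEquiv.hasSum_iff] at this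
  convert! this using 2 with y
  have h := (periods z).latticeEquiv_symm_apply y
  simp only [Function.comp_apply, LinearEquiv.coe_toEquiv]
  change _ = ((((periods z).latticeEquivProd.symm y).1 - x) ^ r)⁻¹
  rw [h]
  rfl

/-- Even and odd second coordinates correspond to the two cosets of the period lattice; the shifts
are those that turn the terms into (m ω₁ + n ω₂ - x)^{-r} with x = 2 + z and x = z. -/
lemma hasSum_of_even_odd_snd {f : ℤ × ℤ → ℂ} {a b : ℂ}
    (ha : HasSum (fun y : ℤ × ℤ ↦ f (y.1 - 1, 2 * (y.1 - 1 + y.2))) a)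
    (hb : HasSum (fun y : ℤ × ℤ ↦ f (y.1 - 1, 2 * (y.1 - 1 + y.2) + 1)) b) :
    HasSum f (a + b) := by
  set g₀ : ℤ × ℤ → ℤ × ℤ := fun y ↦ (y.1 - 1, 2 * (y.1 - 1 + y.2))
  set g₁ : ℤ × ℤ → ℤ × ℤ := fun y ↦ (y.1 - 1, 2 * (y.1 - 1 + y.2) + 1)
  have h₀ : Function.Injective g₀ := by
    rintro ⟨a, b⟩ ⟨c, d⟩ h
    simp only [g₀, Prod.mk.injEq] at h ⊢
    omega
  have h₁ : Function.Injective g₁ := by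
    rintro ⟨a, b⟩ ⟨c, d⟩ h
    simp only [g₁, Prod.mk.injEq] at h ⊢
    omega
  have hc : IsCompl (Set.range g₀) (Set.range g₁) := by
    refine isCompl_iff.mpr ⟨Set.disjoint_iff_forall_ne.mpr ?_,
      codisjoint_iff.mpr (Set.eq_univ_iff_forall.mpr ?_)⟩
    · rintro _ ⟨⟨a, b⟩, rfl⟩ _ ⟨⟨c, d⟩, rfl⟩ h
      simp only [g₀, g₁, Prod.mk.injEq] at h
      omega
    · rintro ⟨q, r⟩
      rcases Int.even_or_odd' r with ⟨m, hm | hm⟩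
      · left
        exact ⟨(q + 1, m - q), by simp only [g₀, Prod.mk.injEq]; omega⟩
      · right
        exact ⟨(q + 1, m - q), by simp only [g₁, Prod.mk.injEq]; omega⟩
  exact HasSum.add_isCompl hc (h₀.hasSum_range_iff.mpr ha) (h₁.hasSum_range_iff.mpr hb)

lemma hasSum_latticeTerm {k : ℕ} (hk : k ≠ 0) (z : ℍ) :
    HasSum (latticeTerm k z) ((periods z).sumInvPow ((periods z).ω₂ / 2 + z) (2 * k + 1) -
      (periods z).sumInvPow z (2 * k + 1)) := by
  have hr : 2 < 2 * k + 1 := by omega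
  have hh : (periods z).ω₂ / 2 = 2 := by norm_num [periods]
  rw [sub_eq_add_neg, hh]
  apply hasSum_of_even_odd_snd
  · convert! hasSum_sumInvPow_periods z (2 + z) hr using 2 with y
    simp only [latticeTerm]
    rw [(even_two_mul _).neg_one_zpow, one_mul]
    congr 2
    push_cast
    ring
  · convert! (hasSum_sumInvPow_periods z z hr).neg using 2 with y
    simp only [latticeTerm]
    rw [(odd_two_mul_add_one _).neg_one_zpow, neg_one_mul]
    congr 3
    push_cast
    ring

/-- Since f' = ℘(u + 2) - ℘(u), the derivative f^{(2k)} is (2k)! times a difference of two lattice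
sums, and the sign (-1)^r records which of the two a term comes from. -/
theorem factorial_mul_tsum_latticeTerm {k : ℕ} (hk : k ≠ 0) (z : ℍ) :
    (2 * k)! * ∑' x, latticeTerm k z x =
      (periods z).fFun z ^ (2 * k + 1) * (critPoly k).eval (hauptmodul z) := by
  rw [← iteratedDeriv_fFun_self, (hasSum_latticeTerm hk z).tsum_eq]
  have := (periods z).iteratedDeriv_fFun (self_mem_regularSet z) (n := 2 * k - 1) (by omega)
  rw [show 2 * k - 1 + 1 = 2 * k by omega, show 2 * k - 1 + 2 = 2 * k + 1 by omega] at this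
  rw [this]

end LevelTwoEisenstein

end

/-! ### From the Eisenstein series to the lattice sum -/

noncomputable section

namespace LevelTwoEisenstein

open Complex UpperHalfPlane CongruenceSubgroup
open scoped MatrixGroups

/-- The summation range of the Eisenstein series. -/
abbrev CoprimePair : Type := {v : ℤ × ℤ // v.1 ≡ 0 [ZMOD 2] ∧ v.2 ≡ 1 [ZMOD 2] ∧ IsCoprime v.1 v.2}

lemma CoprimePair.even_fst (v : CoprimePair) : Even v.1.1 := by
  have := v.2.1
  rw [Int.even_iff]; exact this

lemma CoprimePair.odd_snd (v : CoprimePair) : Odd v.1.2 := by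
  have := v.2.2.1
  rw [Int.odd_iff]; exact this

lemma χ₄_intCast_two_mul_add_one (r : ℤ) :
    ((ZMod.χ₄ ((2 * r + 1 : ℤ) : ZMod 4) : ℤ) : ℂ) = (-1) ^ r := by
  rcases Int.even_or_odd' r with ⟨m, rfl | rfl⟩
  · rw [(even_two_mul m).neg_one_zpow, ZMod.χ₄_int_one_mod_four (by omega), Int.cast_one]
  · rw [(odd_two_mul_add_one m).neg_one_zpow, ZMod.χ₄_int_three_mod_four (by omega), Int.cast_neg,
      Int.cast_one]

/-- The index in the lattice sum of a pair `(c, d)` with `c` even and `d` odd. -/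
def latticeIndex (c d : ℤ) : ℤ × ℤ := ((c + d - 1) / 2, (d - 1) / 2)

lemma latticeTerm_latticeIndex (k : ℕ) (z : ℍ) {c d : ℤ} (hc : Even c) (hd : Odd d) :
    latticeTerm k z (latticeIndex c d) =
      ((ZMod.χ₄ (d : ZMod 4) : ℤ) : ℂ) * ((((c + d : ℤ) : ℂ) * z - c) ^ (2 * k + 1))⁻¹ := by
  obtain ⟨r, rfl⟩ := hd
  obtain ⟨p, rfl⟩ := hc
  have e1 : (p + p + (2 * r + 1) - 1) / 2 = p + r := by omega
  have e2 : (2 * r + 1 - 1) / 2 = r := by omega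
  rw [latticeTerm, latticeIndex, e1, e2, χ₄_intCast_two_mul_add_one]
  push_cast
  congr 3
  ring

/-- Each pair (even, odd) is uniquely its gcd times a coprime pair. The gcd divides an odd number,
so it is odd, and the parities pass to the quotient. -/
lemma bijective_latticeIndex : Function.Bijective
    (fun x : {n : ℕ // Odd n} × CoprimePair ↦
      latticeIndex (x.1.1 * x.2.1.1) (x.1.1 * x.2.1.2)) := by
  constructor
  · rintro ⟨⟨n, hn⟩, v⟩ ⟨⟨n', hn'⟩, v'⟩ h
    obtain ⟨p, hp⟩ := v.even_fst.mul_left (n : ℤ)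
    obtain ⟨p', hp'⟩ := v'.even_fst.mul_left (n' : ℤ)
    obtain ⟨r, hr⟩ := ((Int.odd_coe_nat n).mpr hn).mul v.odd_snd
    obtain ⟨r', hr'⟩ := ((Int.odd_coe_nat n').mpr hn').mul v'.odd_snd
    simp only [latticeIndex, Prod.mk.injEq] at h
    have h2 : (n : ℤ) * v.1.2 = n' * v'.1.2 := by omega
    have h1 : (n : ℤ) * v.1.1 = n' * v'.1.1 := by omega
    have g1 : Int.gcd (n * v.1.1) (n * v.1.2) = n := by
      rw [Int.gcd_mul_left, Int.isCoprime_iff_gcd_eq_one.mp v.2.2.2]; simp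
    have g2 : Int.gcd (n' * v'.1.1) (n' * v'.1.2) = n' := by
      rw [Int.gcd_mul_left, Int.isCoprime_iff_gcd_eq_one.mp v'.2.2.2]; simp
    have hnn : n = n' := by rw [← g1, ← g2, h1, h2]
    subst hnn
    have hn0 : (n : ℤ) ≠ 0 := by
      have := hn.pos; omega
    have e1 := mul_left_cancel₀ hn0 h1
    have e2 := mul_left_cancel₀ hn0 h2
    have : v = v' := Subtype.ext (Prod.ext e1 e2)
    rw [this]
  · rintro ⟨q, r⟩
    set c : ℤ := 2 * (q - r) with hc
    set d : ℤ := 2 * r + 1 with hd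
    have hd0 : d ≠ 0 := by omega
    have hg : 0 < Int.gcd c d := Int.gcd_pos_of_ne_zero_right _ hd0
    obtain ⟨c', hc'⟩ := Int.gcd_dvd_left c d
    obtain ⟨d', hd'⟩ := Int.gcd_dvd_right c d
    have hdodd : Odd d := ⟨r, hd⟩
    have hodd : Odd ((Int.gcd c d : ℤ) * d') := by rw [← hd']; exact hdodd
    rw [Int.odd_mul] at hodd
    have hev : Even ((Int.gcd c d : ℤ) * c') := by rw [← hc']; exact even_two_mul _
    have hc'e : Even c' := by
      rcases Int.even_mul.mp hev with h | h
      · exact absurd hodd.1 (Int.not_odd_iff_even.mpr h)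
      · exact h
    have hcop : IsCoprime c' d' := by
      rw [Int.isCoprime_iff_gcd_eq_one]
      have := Int.gcd_mul_left (Int.gcd c d : ℤ) c' d'
      rw [← hc', ← hd', Int.natAbs_natCast] at this
      exact (mul_eq_left₀ hg.ne').mp this.symm
    refine ⟨⟨⟨Int.gcd c d, (Int.odd_coe_nat _).mp hodd.1⟩, ⟨(c', d'), ?_, ?_, hcop⟩⟩, ?_⟩
    · exact Int.even_iff.mp hc'e
    · exact Int.odd_iff.mp hodd.2
    · simp only [← hc', ← hd']
      simp only [latticeIndex, Prod.mk.injEq]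
      omega

/-- The character `χ₄` with complex values. -/
def chi : DirichletCharacter ℂ 4 := ZMod.χ₄.ringHomComp (Int.castRingHom ℂ)

lemma chi_natCast (n : ℕ) : chi (n : ZMod 4) = ((ZMod.χ₄ ((n : ℤ) : ZMod 4) : ℤ) : ℂ) := by
  simp [chi]

/-- The terms of the series of `L(2k+1, χ)`. -/
def lTerm (k : ℕ) (n : ℕ) : ℂ := ((ZMod.χ₄ ((n : ℤ) : ZMod 4) : ℤ) : ℂ) * ((n : ℂ) ^ (2 * k + 1))⁻¹

lemma lTerm_eq (k n : ℕ) :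
    LSeries.term (fun n ↦ chi (n : ZMod 4)) ((2 * k + 1 : ℕ) : ℂ) n = lTerm k n := by
  rw [LSeries.term, lTerm]
  split_ifs with h
  · simp [h]
  · rw [chi_natCast, cpow_natCast, div_eq_mul_inv]

lemma one_lt_re_natCast {k : ℕ} (hk : k ≠ 0) : 1 < (((2 * k + 1 : ℕ) : ℂ)).re := by
  rw [natCast_re]
  have : 1 < 2 * k + 1 := by omega
  exact_mod_cast this

lemma summable_lTerm {k : ℕ} (hk : k ≠ 0) : Summable (lTerm k) := by
  have := DirichletCharacter.LSeriesSummable_of_one_lt_re chi (one_lt_re_natCast hk)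
  exact this.congr fun n ↦ (lTerm_eq k n)

lemma tsum_lTerm_ne_zero {k : ℕ} (hk : k ≠ 0) : ∑' n, lTerm k n ≠ 0 := by
  have := DirichletCharacter.LSeries_ne_zero_of_one_lt_re chi (one_lt_re_natCast hk)
  rw [LSeries] at this
  rwa [tsum_congr (lTerm_eq k)] at this

lemma summable_latticeTerm {k : ℕ} (hk : k ≠ 0) (z : ℍ) : Summable (latticeTerm k z) :=
  (hasSum_latticeTerm hk z).summable

/-- The substitution uses c(z - 1)/z + d = ((c + d)z - c)/z; the weight factor cancels the
denominator. -/
lemma two_mul_G_eq (k : ℕ) (z : ℍ) :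
    2 * G k z = ∑' v : CoprimePair, latticeTerm k z (latticeIndex v.1.1 v.1.2) := by
  have hz : (z : ℂ) ≠ 0 := z.ne_zero
  have hden : denom (γ₀ : SL(2, ℤ)) z = z := by
    rw [ModularGroup.denom_apply]
    simp [γ₀]
  have hact : ((γ₀ • z : ℍ) : ℂ) = (z - 1) / z := by
    rw [specialLinearGroup_apply]
    simp [γ₀, sub_eq_add_neg]
  rw [G, ModularForm.SL_slash_apply, E, hden, hact, mul_assoc, ← mul_assoc,
    mul_one_div_cancel two_ne_zero, one_mul, ← tsum_mul_right]
  refine tsum_congr fun v : CoprimePair ↦ ?_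
  rw [latticeTerm_latticeIndex k z v.even_fst v.odd_snd, mul_assoc]
  congr 1
  have e : ((v.1.1 : ℂ) * ((z - 1) / z) + v.1.2) = (((v.1.1 + v.1.2 : ℤ) : ℂ) * z - v.1.1) / z := by
    push_cast; field_simp; ring
  rw [e, ← zpow_natCast, ← zpow_neg]
  have hexp : -(2 * (k : ℤ) + 1) = -((2 * k + 1 : ℕ) : ℤ) := by push_cast; ring
  rw [hexp, ← mul_zpow, div_mul_cancel₀ _ hz]

/-- By multiplicativity of χ, the product of L(2k+1, χ) and the coprime sum regroups as the sum over
all pairs. The factor is nonzero, so G and the lattice sum have the same zeros. -/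
theorem tsum_lTerm_mul_G {k : ℕ} (hk : k ≠ 0) (z : ℍ) :
    (∑' n, lTerm k n) * (2 * G k z) = ∑' x, latticeTerm k z x := by
  have hs : Function.support (lTerm k) ⊆ {n | Odd n} := by
    intro n hn
    by_contra h
    rw [Set.mem_ofPred_eq, Nat.not_odd_iff_even] at h
    apply hn
    obtain ⟨m, rfl⟩ := h
    rw [lTerm, ZMod.χ₄_int_eq_if_mod_four, if_pos (by omega)]
    simp
  have hb : Summable fun v : CoprimePair ↦ latticeTerm k z (latticeIndex v.1.1 v.1.2) := by
    have h1 := (summable_latticeTerm hk z).comp_injective bijective_latticeIndex.1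
    have h2 := h1.comp_injective
      (i := fun v : CoprimePair ↦ ((⟨1, odd_one⟩, v) : {n : ℕ // Odd n} × CoprimePair))
      (fun v w h ↦ by simpa using h)
    refine h2.congr fun v ↦ ?_
    simp
  have ha : ∑' n, lTerm k n = ∑' n : {n : ℕ // Odd n}, lTerm k n.1 :=
    (tsum_subtype_eq_of_support_subset hs).symm
  have ha' : Summable fun n : {n : ℕ // Odd n} ↦ lTerm k n.1 := (summable_lTerm hk).subtype _
  rw [two_mul_G_eq, ha, tsum_mul_tsum_of_summable_norm ha'.norm hb.norm,
    ← (Equiv.ofBijective _ bijective_latticeIndex).tsum_eq (latticeTerm k z)]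
  refine tsum_congr fun x ↦ ?_
  obtain ⟨⟨n, hn⟩, v⟩ := x
  have hn' : Odd (n : ℤ) := (Int.odd_coe_nat n).mpr hn
  rw [Equiv.ofBijective_apply, latticeTerm_latticeIndex k z v.even_fst v.odd_snd,
    latticeTerm_latticeIndex k z (v.even_fst.mul_left _) (hn'.mul v.odd_snd)]
  simp only [lTerm]
  rw [Int.cast_mul, map_mul, Int.cast_mul]
  have : ((((n : ℤ) * v.1.1 + n * v.1.2 : ℤ) : ℂ) * z - (((n : ℤ) * v.1.1 : ℤ) : ℂ)) =
      n * (((v.1.1 + v.1.2 : ℤ) : ℂ) * z - v.1.1) := by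
    push_cast; ring
  rw [this, mul_pow, mul_inv]
  ring

lemma G_eq_zero_iff {k : ℕ} (hk : k ≠ 0) (z : ℍ) :
    G k z = 0 ↔ ∑' x, latticeTerm k z x = 0 := by
  rw [← tsum_lTerm_mul_G hk z]
  simp [tsum_lTerm_ne_zero hk]

lemma tsum_latticeTerm_eq_zero_iff {k : ℕ} (hk : k ≠ 0) (z : ℍ) :
    ∑' x, latticeTerm k z x = 0 ↔ (critPoly k).eval (hauptmodul z) = 0 := by
  have h := factorial_mul_tsum_latticeTerm hk z
  constructor
  · intro h0
    rw [h0, mul_zero] at h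
    exact (mul_eq_zero.mp h.symm).resolve_left (pow_ne_zero _ (fFun_self_ne_zero z))
  · intro h0
    rw [h0, mul_zero] at h
    exact (mul_eq_zero.mp h).resolve_left (by exact_mod_cast (2 * k).factorial_ne_zero)

end LevelTwoEisenstein

end

/-! ### Series with one dominant term -/

namespace LevelTwoEisenstein

open Real

/-- log x ≤ sinh(log x) = (x - 1/x)/2. The second order gain over log(1 + h) ≤ h is what makes the
neighbouring ratio small. -/
lemma log_succ_div_le {ν : ℝ} (hν : 0 < ν) :
    Real.log ((ν + 1) / ν) ≤ 1 / ν - 1 / (2 * ν * (ν + 1)) := by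
  have hx : 0 < (ν + 1) / ν := by positivity
  have h1 : 1 ≤ (ν + 1) / ν := by rw [le_div_iff₀ hν]; linarith
  have h2 := Real.self_le_sinh_iff.mpr (Real.log_nonneg h1)
  rw [Real.sinh_log hx] at h2
  refine h2.trans (le_of_eq ?_)
  field_simp
  ring

lemma log_one_sub_le {h : ℝ} (h0 : 0 ≤ h) (h1 : h < 1) : Real.log (1 - h) ≤ -h - h ^ 2 / 2 := by
  have hs := Real.hasSum_pow_div_log_of_abs_lt_one (x := h) (by rwa [abs_of_nonneg h0])
  have := sum_le_hasSum (Finset.range 2) (fun i _ ↦ by positivity) hs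
  simp [Finset.sum_range_succ] at this
  norm_num at this
  linarith

lemma five_le_exp : (5 : ℝ) ≤ Real.exp (7 / 4) := by
  have h : (5 : ℝ) ^ 4 ≤ Real.exp (7 / 4) ^ 4 := by
    rw [← Real.exp_nat_mul]
    have h1 := Real.exp_one_gt_d9
    have h2 : Real.exp ((4 : ℕ) * (7 / 4)) = Real.exp 1 ^ 7 := by
      rw [← Real.exp_nat_mul]; norm_num
    rw [h2]
    calc (5 : ℝ) ^ 4 ≤ 2.7 ^ 7 := by norm_num
      _ ≤ Real.exp 1 ^ 7 := by gcongr; linarith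
  exact le_of_pow_le_pow_left₀ (by norm_num) (Real.exp_pos _).le h

lemma exp_neg_le_fifth {x : ℝ} (hx : x ≤ -(7 / 4)) : Real.exp x ≤ 1 / 5 := by
  calc Real.exp x ≤ Real.exp (-(7 / 4)) := Real.exp_le_exp.mpr hx
    _ ≤ 1 / 5 := by
      rw [Real.exp_neg, ← one_div]
      exact one_div_le_one_div_of_le (by norm_num) five_le_exp

lemma cot_lower {φ : ℝ} (h0 : 0 < φ) (h1 : φ < π / 2) : 1 / φ - φ / 2 ≤ (Real.tan φ)⁻¹ := by
  have hs : 0 < Real.sin φ := Real.sin_pos_of_pos_of_lt_pi h0 (by linarith)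
  have hc : 0 < Real.cos φ := Real.cos_pos_of_mem_Ioo ⟨by linarith, h1⟩
  rw [Real.tan_eq_sin_div_cos, inv_div]
  calc 1 / φ - φ / 2 = (1 - φ ^ 2 / 2) / φ := by field_simp
    _ ≤ Real.cos φ / φ := by gcongr; exact Real.one_sub_sq_div_two_le_cos
    _ ≤ Real.cos φ / Real.sin φ := by gcongr; exact (Real.sin_lt h0).le

lemma cot_upper {φ : ℝ} (h0 : 0 < φ) (h1 : φ < π / 2) : (Real.tan φ)⁻¹ ≤ 1 / φ := by
  rw [← one_div]
  exact one_div_le_one_div_of_le h0 (Real.lt_tan h0 h1).le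

section Rate

variable {k : ℕ} {ν : ℝ}

lemma angle_bounds (hν : 1 / 2 ≤ ν) (hk : 4 * ν ^ 2 ≤ k) :
    0 < π * ν / (2 * k + 1) ∧ π * ν / (2 * k + 1) < π / 2 := by
  have hpi := Real.pi_pos
  refine ⟨by positivity, ?_⟩
  rw [div_lt_div_iff₀ (by positivity) two_pos]
  have : ν * 2 < 2 * k + 1 := by nlinarith
  nlinarith

/-- The decay rate `π cot (π ν / (2k+1))`. -/
noncomputable def rate (k : ℕ) (ν : ℝ) : ℝ := π * (Real.tan (π * ν / (2 * k + 1)))⁻¹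

lemma rate_le (hν : 1 / 2 ≤ ν) (hk : 4 * ν ^ 2 ≤ k) : rate k ν ≤ (2 * k + 1) / ν := by
  obtain ⟨h0, h1⟩ := angle_bounds hν hk
  have := mul_le_mul_of_nonneg_left (cot_upper h0 h1) Real.pi_pos.le
  refine this.trans (le_of_eq ?_)
  have : ν ≠ 0 := by linarith
  field_simp

lemma le_rate (hν : 1 / 2 ≤ ν) (hk : 4 * ν ^ 2 ≤ k) :
    (2 * k + 1) / ν - π ^ 2 * ν / (2 * (2 * k + 1)) ≤ rate k ν := by
  obtain ⟨h0, h1⟩ := angle_bounds hν hk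
  have := mul_le_mul_of_nonneg_left (cot_lower h0 h1) Real.pi_pos.le
  refine le_trans (le_of_eq ?_) this
  have : ν ≠ 0 := by linarith
  field_simp

/-- The error of the approximation π cot φ ≈ (2k+1)/ν. It fits in the exponent budget, since 3 - 5/4
= 7/4 and e^{-7/4} ≤ 1/5. -/
lemma correction_le (hν : 1 / 2 ≤ ν) (hk : 4 * ν ^ 2 ≤ k) :
    π ^ 2 * ν / (2 * (2 * k + 1)) ≤ 5 / 4 := by
  have hpi : π ^ 2 ≤ 10 := by
    have := Real.pi_lt_d2
    have := Real.pi_pos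
    nlinarith
  rw [div_le_iff₀ (by positivity)]
  have h1 : π ^ 2 * ν ≤ 10 * ν := by gcongr
  nlinarith

/-- For decay rate about (2k+1)/ν the function x^{2k} e^{-Xx} peaks near x = ν, with width of order
ν/√k. The condition 4ν² ≤ k makes this width less than the unit spacing, so the next term is at most
a fifth of the peak. -/
lemma up_ratio_le (hν : 1 / 2 ≤ ν) (hk : 4 * ν ^ 2 ≤ k) :
    ((ν + 1) / ν) ^ (2 * k) * Real.exp (-rate k ν) ≤ 1 / 5 := by
  have h0 : 0 < ν := by linarith
  have hx : 0 < (ν + 1) / ν := by positivity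
  have e : ((ν + 1) / ν) ^ (2 * k) = Real.exp ((2 * k : ℕ) * Real.log ((ν + 1) / ν)) := by
    rw [Real.exp_nat_mul, Real.exp_log hx]
  rw [e, ← Real.exp_add]
  apply exp_neg_le_fifth
  have h1 : ((2 * k : ℕ) : ℝ) * Real.log ((ν + 1) / ν) ≤
      (2 * k : ℕ) * (1 / ν - 1 / (2 * ν * (ν + 1))) := by
    gcongr; exact log_succ_div_le h0
  have h2 := le_rate hν hk
  have h3 := correction_le hν hk
  have h4 : ((2 * k : ℕ) : ℝ) * (1 / ν - 1 / (2 * ν * (ν + 1))) - (2 * k + 1) / ν =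
      -((k + (ν + 1)) / (ν * (ν + 1))) := by
    push_cast; field_simp; ring
  have h5 : 3 ≤ (k + (ν + 1)) / (ν * (ν + 1)) := by
    rw [le_div_iff₀ (by positivity)]
    nlinarith [sq_nonneg (ν - 1)]
  linarith

lemma down_ratio_le (hν : 1 ≤ ν) (hk : 4 * ν ^ 2 ≤ k) :
    ((ν - 1) / ν) ^ (2 * k) * Real.exp (rate k ν) ≤ 1 / 5 := by
  have h0 : 0 < ν := by linarith
  have hk0 : k ≠ 0 := by
    rintro rfl
    simp at hk
    nlinarith
  -- At ν = 1 the ratio is 0, where the logarithm cannot be used.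
  rcases hν.eq_or_lt with rfl | hlt
  · simp [hk0]
  have hx : 0 < (ν - 1) / ν := div_pos (by linarith) h0
  have e : ((ν - 1) / ν) ^ (2 * k) = Real.exp ((2 * k : ℕ) * Real.log ((ν - 1) / ν)) := by
    rw [Real.exp_nat_mul, Real.exp_log hx]
  rw [e, ← Real.exp_add]
  apply exp_neg_le_fifth
  have e1 : (ν - 1) / ν = 1 - 1 / ν := by field_simp
  have hlog : Real.log ((ν - 1) / ν) ≤ -(1 / ν) - (1 / ν) ^ 2 / 2 := by
    rw [e1]
    refine log_one_sub_le (by positivity) ?_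
    rw [div_lt_one h0]; exact hlt
  have h1 : ((2 * k : ℕ) : ℝ) * Real.log ((ν - 1) / ν) ≤
      (2 * k : ℕ) * (-(1 / ν) - (1 / ν) ^ 2 / 2) := by
    gcongr
  have h2 := rate_le (by linarith) hk
  have h4 : ((2 * k : ℕ) : ℝ) * (-(1 / ν) - (1 / ν) ^ 2 / 2) + (2 * k + 1) / ν =
      -((k - ν) / ν ^ 2) := by
    push_cast; field_simp; ring
  have h5 : 3 ≤ (k - ν) / ν ^ 2 := by
    rw [le_div_iff₀ (by positivity)]
    nlinarith
  linarith

end Rate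

/-- The terms `(n + δ)^{2k} e^{-(n + δ) X}`. -/
noncomputable def peakTerm (k : ℕ) (δ X : ℝ) (n : ℕ) : ℝ :=
  (n + δ) ^ (2 * k) * Real.exp (-((n + δ) * X))

section Peak

variable {k j : ℕ} {δ X : ℝ}

lemma peakTerm_nonneg (k : ℕ) (δ X : ℝ) (n : ℕ) : 0 ≤ peakTerm k δ X n :=
  mul_nonneg ((even_two_mul k).pow_nonneg _) (Real.exp_pos _).le

/-- The ratio of consecutive terms decreases in n, so the bound at the peak persists beyond it. -/
lemma peakTerm_succ_le (hj : 0 < j + δ)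
    (hup : ((j + δ + 1) / (j + δ)) ^ (2 * k) * Real.exp (-X) ≤ 1 / 5) {n : ℕ} (hn : j ≤ n) :
    peakTerm k δ X (n + 1) ≤ 1 / 5 * peakTerm k δ X n := by
  have hjn : (j : ℝ) ≤ n := by exact_mod_cast hn
  have hn0 : 0 < (n : ℝ) + δ := by linarith
  have h1 : (n + δ + 1) / (n + δ) ≤ (j + δ + 1) / (j + δ) := by
    rw [div_le_div_iff₀ hn0 hj]; nlinarith
  have h2 : ((n + δ + 1) / (n + δ)) ^ (2 * k) * Real.exp (-X) ≤ 1 / 5 :=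
    le_trans (by gcongr) hup
  have e : peakTerm k δ X (n + 1) =
      ((n + δ + 1) / (n + δ)) ^ (2 * k) * Real.exp (-X) * peakTerm k δ X n := by
    rw [peakTerm, peakTerm, div_pow]
    have : Real.exp (-((((n + 1 : ℕ) : ℝ) + δ) * X)) =
        Real.exp (-X) * Real.exp (-((n + δ) * X)) := by
      rw [← Real.exp_add]; congr 1; push_cast; ring
    rw [this]
    push_cast
    field_simp
    ring
  rw [e]
  exact mul_le_mul_of_nonneg_right h2 (peakTerm_nonneg _ _ _ _)

lemma peakTerm_le_succ (hδ : 0 ≤ δ)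
    (hdown : 1 ≤ j + δ → ((j + δ - 1) / (j + δ)) ^ (2 * k) * Real.exp X ≤ 1 / 5) {n : ℕ}
    (hn : n + 1 ≤ j) : peakTerm k δ X n ≤ 1 / 5 * peakTerm k δ X (n + 1) := by
  have hjn : (n : ℝ) + 1 ≤ j := by exact_mod_cast hn
  have hn0 : (0 : ℝ) ≤ n := n.cast_nonneg
  have hj : 0 < (j : ℝ) + δ := by linarith
  have hp : 0 < (n : ℝ) + 1 + δ := by linarith
  have h1 : (n + δ) / (n + 1 + δ) ≤ (j + δ - 1) / (j + δ) := by
    rw [div_le_div_iff₀ hp hj]; nlinarith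
  have h2 : ((n + δ) / (n + 1 + δ)) ^ (2 * k) * Real.exp X ≤ 1 / 5 :=
    le_trans (by gcongr) (hdown (by linarith))
  have e : peakTerm k δ X n =
      ((n + δ) / (n + 1 + δ)) ^ (2 * k) * Real.exp X * peakTerm k δ X (n + 1) := by
    rw [peakTerm, peakTerm, div_pow]
    have : Real.exp (-((n + δ) * X)) =
        Real.exp X * Real.exp (-((((n + 1 : ℕ) : ℝ) + δ) * X)) := by
      rw [← Real.exp_add]; congr 1; push_cast; ring
    rw [this]
    push_cast
    field_simp
  rw [e]
  exact mul_le_mul_of_nonneg_right h2 (peakTerm_nonneg _ _ _ _)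

lemma peakTerm_add_le (hj : 0 < j + δ)
    (hup : ((j + δ + 1) / (j + δ)) ^ (2 * k) * Real.exp (-X) ≤ 1 / 5) (m : ℕ) :
    peakTerm k δ X (j + m) ≤ (1 / 5) ^ m * peakTerm k δ X j := by
  induction m with
  | zero => simp
  | succ m ih =>
    have := peakTerm_succ_le hj hup (n := j + m) (by omega)
    rw [← add_assoc, pow_succ]
    linarith

lemma peakTerm_sub_le (hδ : 0 ≤ δ)
    (hdown : 1 ≤ j + δ → ((j + δ - 1) / (j + δ)) ^ (2 * k) * Real.exp X ≤ 1 / 5) {m : ℕ}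
    (hm : m ≤ j) : peakTerm k δ X (j - m) ≤ (1 / 5) ^ m * peakTerm k δ X j := by
  induction m with
  | zero => simp
  | succ m ih =>
    have h1 := peakTerm_le_succ (X := X) (k := k) hδ hdown (n := j - (m + 1)) (by omega)
    rw [show j - (m + 1) + 1 = j - m by omega] at h1
    have := ih (by omega)
    rw [pow_succ]
    linarith

/-- Geometric decay with ratio 1/5 on both sides: 5/4 from the peak onwards and 1/4 before it. -/
lemma summable_peakTerm_and_le (hδ : 0 ≤ δ) (hj : 0 < j + δ)
    (hup : ((j + δ + 1) / (j + δ)) ^ (2 * k) * Real.exp (-X) ≤ 1 / 5)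
    (hdown : 1 ≤ j + δ → ((j + δ - 1) / (j + δ)) ^ (2 * k) * Real.exp X ≤ 1 / 5) :
    Summable (peakTerm k δ X) ∧ ∑' n, peakTerm k δ X n ≤ 3 / 2 * peakTerm k δ X j := by
  have hg : HasSum (fun m : ℕ ↦ (1 / 5 : ℝ) ^ m * peakTerm k δ X j)
      ((1 - 1 / 5)⁻¹ * peakTerm k δ X j) :=
    (hasSum_geometric_of_lt_one (by norm_num) (by norm_num)).mul_right _
  have hs0 : Summable fun m ↦ peakTerm k δ X (m + j) :=
    Summable.of_nonneg_of_le (fun m ↦ peakTerm_nonneg _ _ _ _)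
      (fun m ↦ by rw [add_comm]; exact peakTerm_add_le hj hup m) hg.summable
  have hs : Summable (peakTerm k δ X) := (summable_nat_add_iff j).mp hs0
  refine ⟨hs, ?_⟩
  rw [← hs.sum_add_tsum_nat_add j]
  have h1 : ∑' m, peakTerm k δ X (m + j) ≤ (1 - 1 / 5)⁻¹ * peakTerm k δ X j := by
    rw [← hg.tsum_eq]
    exact hs0.tsum_le_tsum (fun m ↦ by rw [add_comm]; exact peakTerm_add_le hj hup m) hg.summable
  have h2 : ∑ i ∈ Finset.range j, peakTerm k δ X i ≤ 1 / 4 * peakTerm k δ X j := by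
    rw [← Finset.sum_range_reflect]
    calc ∑ i ∈ Finset.range j, peakTerm k δ X (j - 1 - i)
        ≤ ∑ i ∈ Finset.range j, (1 / 5 : ℝ) ^ i * (1 / 5 * peakTerm k δ X j) := by
          refine Finset.sum_le_sum fun i hi ↦ ?_
          rw [Finset.mem_range] at hi
          have := peakTerm_sub_le (X := X) (k := k) hδ hdown (m := i + 1) (by omega)
          rw [show j - (i + 1) = j - 1 - i by omega, pow_succ] at this
          linarith
      _ ≤ ∑' i : ℕ, (1 / 5 : ℝ) ^ i * (1 / 5 * peakTerm k δ X j) := by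
          refine Summable.sum_le_tsum _ (fun i _ ↦ ?_) ?_
          · have := peakTerm_nonneg k δ X j; positivity
          · exact (summable_geometric_of_lt_one (by norm_num) (by norm_num)).mul_right _
      _ = 1 / 4 * peakTerm k δ X j := by
          rw [tsum_mul_right, tsum_geometric_of_lt_one (by norm_num) (by norm_num)]
          ring
  linarith

/-- Alternating row sums `∑ (-1)^n (n + δ)^{2k} e^{-(n + δ) (2i + 1) X}`. -/
noncomputable def rowSum (k : ℕ) (δ X : ℝ) (i : ℕ) : ℝ :=
  ∑' n : ℕ, (-1) ^ n * peakTerm k δ ((2 * i + 1) * X) n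

/-- If `(n + δ)^{2k} e^{-(n + δ) X}` has a pronounced peak at `n = j`, then the peak determines the
sign of the double sum. -/
theorem sign_tsum_rowSum (hk : k ≠ 0) (hδ : δ = 0 ∨ 1 / 2 ≤ δ) (hj : 0 < j + δ) (hX : 0 ≤ X)
    (hup : ((j + δ + 1) / (j + δ)) ^ (2 * k) * Real.exp (-X) ≤ 1 / 5)
    (hdown : 1 ≤ j + δ → ((j + δ - 1) / (j + δ)) ^ (2 * k) * Real.exp X ≤ 1 / 5)
    {ε : ℕ → ℝ} (hε0 : ε 0 = 1) (hε : ∀ i, |ε i| ≤ 1) :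
    0 < (-1) ^ j * ∑' i, ε i * rowSum k δ X i := by
  have hδ0 : 0 ≤ δ := by rcases hδ with h | h <;> linarith
  obtain ⟨hs, hle⟩ := summable_peakTerm_and_le hδ0 hj hup hdown
  set b := peakTerm k δ X with hb
  have hbj : 0 < b j := mul_pos (pow_pos hj _) (Real.exp_pos _)
  have hb0 : ∀ n, 0 ≤ b n := peakTerm_nonneg k δ X
  have hE : Real.exp (-X) ≤ 1 / 5 := by
    refine le_trans ?_ hup
    refine le_mul_of_one_le_left (Real.exp_pos _).le (one_le_pow₀ ?_)
    rw [le_div_iff₀ hj]; linarith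
  -- Row i has the extra factor e^{-2i(n+δ)X}, at most e^{-iX} because n + δ ≥ 1/2. The only
  -- exception, n + δ = 0, gives a zero term since k ≠ 0.
  have hrow : ∀ i n : ℕ, peakTerm k δ ((2 * i + 1) * X) n ≤ Real.exp (-X) ^ i * b n := by
    intro i n
    by_cases hn : (n : ℝ) + δ = 0
    · simp [hb, peakTerm, hn, hk]
    · have hn' : 1 / 2 ≤ (n : ℝ) + δ := by
        have h0 : (0 : ℝ) ≤ n := n.cast_nonneg
        rcases hδ with rfl | h
        · rw [add_zero] at hn ⊢
          have : 1 ≤ n := Nat.one_le_iff_ne_zero.mpr (by exact_mod_cast hn)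
          have : (1 : ℝ) ≤ n := by exact_mod_cast this
          linarith
        · linarith
      rw [hb, peakTerm, peakTerm, ← Real.exp_nat_mul, mul_left_comm (Real.exp (i * -X)),
        ← Real.exp_add]
      gcongr
      have : (1 / 2) * (i * X) ≤ (n + δ) * (i * X) := by gcongr
      linarith
  have hsrow : ∀ i : ℕ, Summable (peakTerm k δ ((2 * i + 1) * X)) := fun i ↦
    Summable.of_nonneg_of_le (peakTerm_nonneg _ _ _) (hrow i) (hs.mul_left _)
  have habs : ∀ i : ℕ, |rowSum k δ X i| ≤ Real.exp (-X) ^ i * (3 / 2 * b j) := by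
    intro i
    have hn : Summable fun n : ℕ ↦ ‖(-1) ^ n * peakTerm k δ ((2 * i + 1) * X) n‖ := by
      refine (hsrow i).congr fun n ↦ ?_
      rw [norm_mul, norm_pow, norm_neg, norm_one, one_pow, one_mul, Real.norm_of_nonneg
        (peakTerm_nonneg _ _ _ _)]
    calc |rowSum k δ X i| ≤ ∑' n : ℕ, ‖(-1) ^ n * peakTerm k δ ((2 * i + 1) * X) n‖ :=
          norm_tsum_le_tsum_norm hn
      _ ≤ ∑' n, Real.exp (-X) ^ i * b n := by
          refine hn.tsum_le_tsum (fun n ↦ ?_) (hs.mul_left _)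
          rw [norm_mul, norm_pow, norm_neg, norm_one, one_pow, one_mul, Real.norm_of_nonneg
            (peakTerm_nonneg _ _ _ _)]
          exact hrow i n
      _ = Real.exp (-X) ^ i * ∑' n, b n := tsum_mul_left
      _ ≤ _ := by gcongr
  have hgeo := (summable_geometric_of_lt_one (Real.exp_pos (-X)).le (by linarith)).mul_right
    (3 / 2 * b j)
  have hsε : Summable fun i ↦ ε i * rowSum k δ X i := by
    refine Summable.of_norm_bounded hgeo fun i ↦ ?_
    rw [norm_mul]
    exact (mul_le_of_le_one_left (norm_nonneg _) (hε i)).trans (habs i)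
  rw [← hsε.sum_add_tsum_nat_add 1]
  -- As e^{-X} ≤ 1/5, the rows i ≥ 1 contribute at most (1/4)(3/2) = 3/8 of the peak.
  have htail : |∑' i, ε (i + 1) * rowSum k δ X (i + 1)| ≤ 3 / 8 * b j := by
    have hgeo' := (summable_nat_add_iff 1).mpr hgeo
    have : |∑' i, ε (i + 1) * rowSum k δ X (i + 1)| ≤
        ∑' i : ℕ, Real.exp (-X) ^ (i + 1) * (3 / 2 * b j) := by
      rw [← Real.norm_eq_abs]
      refine tsum_of_norm_bounded (g := fun i : ℕ ↦ Real.exp (-X) ^ (i + 1) * (3 / 2 * b j))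
        hgeo'.hasSum fun i ↦ ?_
      rw [norm_mul]
      exact (mul_le_of_le_one_left (norm_nonneg _) (hε _)).trans (habs _)
    refine this.trans ?_
    have h1 : ∑' i : ℕ, Real.exp (-X) ^ (i + 1) * (3 / 2 * b j) =
        Real.exp (-X) * (1 - Real.exp (-X))⁻¹ * (3 / 2 * b j) := by
      rw [tsum_mul_right]
      congr 1
      simp_rw [pow_succ']
      rw [tsum_mul_left, tsum_geometric_of_lt_one (Real.exp_pos (-X)).le (by linarith)]
    have h2 : Real.exp (-X) * (1 - Real.exp (-X))⁻¹ ≤ 1 / 4 := by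
      rw [← div_eq_mul_inv, div_le_iff₀ (by linarith)]; linarith
    rw [h1]
    calc _ ≤ 1 / 4 * (3 / 2 * b j) := by gcongr
      _ = _ := by ring
  -- In row 0 all terms but the peak add up to at most half of it; the total error is 1/2 + 3/8 < 1.
  have h0 : |rowSum k δ X 0 - (-1) ^ j * b j| ≤ 1 / 2 * b j := by
    have hsb : Summable fun n : ℕ ↦ (-1) ^ n * b n := by
      refine hs.of_norm_bounded fun n ↦ ?_
      rw [norm_mul, norm_pow, norm_neg, norm_one, one_pow, one_mul, Real.norm_of_nonneg (hb0 n)]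
    have e : rowSum k δ X 0 = ∑' n : ℕ, (-1) ^ n * b n := by simp [rowSum, hb]
    rw [e, hsb.tsum_eq_add_tsum_ite j, add_sub_cancel_left]
    have hsite := hs.tsum_eq_add_tsum_ite j
    have hs' : Summable fun n ↦ if n = j then 0 else b n :=
      hs.of_nonneg_of_le (fun n ↦ by split_ifs; exacts [le_rfl, hb0 n])
        (fun n ↦ by split_ifs; exacts [hb0 n, le_rfl])
    have : |∑' n, if n = j then 0 else (-1) ^ n * b n| ≤ ∑' n, if n = j then 0 else b n := by
      rw [← Real.norm_eq_abs]
      refine tsum_of_norm_bounded hs'.hasSum fun n ↦ ?_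
      split_ifs
      · simp
      · rw [norm_mul, norm_pow, norm_neg, norm_one, one_pow, one_mul, Real.norm_of_nonneg (hb0 n)]
    linarith
  rw [Finset.sum_range_one, hε0, one_mul]
  rw [abs_le] at h0 htail
  rcases neg_one_pow_eq_or ℝ j with h | h <;> rw [h] at h0 ⊢ <;> linarith

end Peak

end LevelTwoEisenstein

/-! ### The lattice sum on the line Re z = 1, by rows and by columns -/

noncomputable section

namespace LevelTwoEisenstein

open Complex
open UpperHalfPlane hiding I
open scoped Real Nat

/-- The point `1 + iy`. -/
def linePoint (y : ℝ) (hy : 0 < y) : ℍ := ⟨1 + y * I, by simpa using hy⟩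

@[simp] lemma coe_linePoint (y : ℝ) (hy : 0 < y) : (linePoint y hy : ℂ) = 1 + y * I := rfl

/-- The terms of the lattice sum at the point `1 + iy`. -/
def lineTerm (k : ℕ) (y : ℝ) (q r : ℤ) : ℂ :=
  (-1) ^ r * (((2 * r + 1 : ℂ) + (2 * q + 1) * y * I) ^ (2 * k + 1))⁻¹

lemma latticeTerm_linePoint (k : ℕ) {y : ℝ} (hy : 0 < y) (x : ℤ × ℤ) :
    latticeTerm k (linePoint y hy) x = lineTerm k y x.1 x.2 := by
  rw [latticeTerm, lineTerm, coe_linePoint]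
  congr 3
  ring

/-- The lattice sum at the point `1 + iy`. -/
def lineSum (k : ℕ) (y : ℝ) : ℂ := ∑' x : ℤ × ℤ, lineTerm k y x.1 x.2

lemma tsum_latticeTerm_linePoint (k : ℕ) {y : ℝ} (hy : 0 < y) :
    ∑' x, latticeTerm k (linePoint y hy) x = lineSum k y :=
  tsum_congr fun x ↦ latticeTerm_linePoint k hy x

lemma summable_lineTerm {k : ℕ} (hk : k ≠ 0) {y : ℝ} (hy : 0 < y) :
    Summable fun x : ℤ × ℤ ↦ lineTerm k y x.1 x.2 :=
  (summable_latticeTerm hk (linePoint y hy)).congr fun x ↦ latticeTerm_linePoint k hy x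

lemma neg_one_zpow_neg_one_sub (r : ℤ) : (-1 : ℂ) ^ (-1 - r) = -(-1) ^ r := by
  rcases Int.even_or_odd r with h | h
  · rw [h.neg_one_zpow, Odd.neg_one_zpow (by rw [Int.odd_sub]; simp [h])]
  · rw [h.neg_one_zpow, Even.neg_one_zpow (by rw [Int.even_sub]; simp [h])]; simp

lemma lineTerm_neg_neg (k : ℕ) (y : ℝ) (q r : ℤ) :
    lineTerm k y (-1 - q) (-1 - r) = lineTerm k y q r := by
  rw [lineTerm, lineTerm, neg_one_zpow_neg_one_sub]
  have : ((2 * ((-1 - r : ℤ) : ℂ) + 1) + (2 * ((-1 - q : ℤ) : ℂ) + 1) * y * I) =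
      -((2 * r + 1) + (2 * q + 1) * y * I) := by push_cast; ring
  rw [this, (odd_two_mul_add_one k).neg_pow, inv_neg]
  ring

lemma lineTerm_neg_left (k : ℕ) (y : ℝ) (q r : ℤ) :
    lineTerm k y (-1 - q) r = (starRingEnd ℂ) (lineTerm k y q r) := by
  rw [lineTerm, lineTerm]
  simp only [map_mul, map_zpow₀, map_inv₀, map_pow, map_add, map_neg, map_one, conj_I, conj_ofReal,
    map_intCast, map_ofNat]
  congr 3
  push_cast
  ring

lemma lineTerm_neg_right (k : ℕ) (y : ℝ) (q r : ℤ) :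
    lineTerm k y q (-1 - r) = (starRingEnd ℂ) (lineTerm k y q r) := by
  rw [← lineTerm_neg_left, ← lineTerm_neg_neg]
  congr 1
  ring

/-- Sum over a row of the lattice. -/
def rowTsum (k : ℕ) (y : ℝ) (q : ℤ) : ℂ := ∑' r : ℤ, lineTerm k y q r

/-- Sum over a column of the lattice. -/
def colTsum (k : ℕ) (y : ℝ) (r : ℤ) : ℂ := ∑' q : ℤ, lineTerm k y q r

lemma rowTsum_neg (k : ℕ) (y : ℝ) (q : ℤ) : rowTsum k y (-1 - q) = rowTsum k y q := by
  rw [rowTsum, ← (Equiv.subLeft (-1 : ℤ)).tsum_eq, rowTsum]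
  exact tsum_congr fun r ↦ lineTerm_neg_neg k y q r

lemma colTsum_neg (k : ℕ) (y : ℝ) (r : ℤ) : colTsum k y (-1 - r) = colTsum k y r := by
  rw [colTsum, ← (Equiv.subLeft (-1 : ℤ)).tsum_eq, colTsum]
  exact tsum_congr fun q ↦ lineTerm_neg_neg k y q r

lemma tsum_int_eq_two_mul {𝕜 : Type*} [NormedField 𝕜] [CompleteSpace 𝕜] {f : ℤ → 𝕜} (hf : Summable f) (h : ∀ n, f (-1 - n) = f n) :
    ∑' n, f n = 2 * ∑' n : ℕ, f n := by
  have h1 : Summable fun n : ℕ ↦ f n := hf.comp_injective Nat.cast_injective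
  have e : ∀ n : ℕ, f (-((n : ℤ) + 1)) = f n := fun n ↦ by
    rw [← h n]; congr 1; ring
  rw [tsum_of_nat_of_neg_add_one h1 (h1.congr fun n ↦ (e n).symm), tsum_congr e]
  ring

lemma lineSum_eq_rowTsum {k : ℕ} (hk : k ≠ 0) {y : ℝ} (hy : 0 < y) :
    lineSum k y = 2 * ∑' q : ℕ, rowTsum k y q := by
  have hs := summable_lineTerm hk hy
  rw [lineSum, hs.tsum_prod]
  exact tsum_int_eq_two_mul hs.prod (rowTsum_neg k y)

lemma lineSum_eq_colTsum {k : ℕ} (hk : k ≠ 0) {y : ℝ} (hy : 0 < y) :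
    lineSum k y = 2 * ∑' r : ℕ, colTsum k y r := by
  have hs := (Equiv.prodComm ℤ ℤ).summable_iff.mpr (summable_lineTerm hk hy)
  rw [lineSum, ← (Equiv.prodComm ℤ ℤ).tsum_eq]
  rw [Function.comp_def] at hs
  rw [hs.tsum_prod]
  exact tsum_int_eq_two_mul hs.prod (colTsum_neg k y)

/-- Lipschitz formula at a point with real part 1/2, where the parameter e^{2πiτ} is negative real;
hence the alternating sign. -/
lemma colTsum_eq {k : ℕ} (hk : k ≠ 0) {y : ℝ} (hy : 0 < y) (i : ℕ) :
    colTsum k y i = (((π / y) ^ (2 * k + 1) / (2 * k)! : ℝ) : ℂ) *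
      (((-1) ^ i * rowSum k 0 (π / y) i : ℝ) : ℂ) := by
  have hy' : (y : ℂ) ≠ 0 := by exact_mod_cast hy.ne'
  set τ : ℍ := ⟨1 / 2 + ((2 * i + 1) / (2 * y) : ℝ) * I, by
    have : 0 < (2 * i + 1) / (2 * y) := by positivity
    rw [add_im, im_ofReal_mul, Complex.I_im]
    simpa using this⟩ with hτ
  have hτc : (τ : ℂ) = 1 / 2 + ((2 * i + 1) / (2 * y) : ℝ) * I := rfl
  have hL := EisensteinSeries.qExpansion_identity (k := 2 * k) (by omega) τ
  have h1 : colTsum k y i = (-1) ^ i * ((-2 * y * I) ^ (2 * k + 1))⁻¹ *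
      ∑' n : ℤ, 1 / ((τ : ℂ) + n) ^ (2 * k + 1) := by
    rw [colTsum, ← (Equiv.subLeft (-1 : ℤ)).tsum_eq, ← tsum_mul_left]
    refine tsum_congr fun n ↦ ?_
    rw [lineTerm, zpow_natCast, one_div, mul_assoc ((-1 : ℂ) ^ i), ← mul_inv, ← mul_pow]
    congr 3
    rw [hτc]
    simp only [Equiv.subLeft_apply]
    push_cast
    field_simp
    ring_nf
    rw [I_sq]
    ring
  have hexp : cexp (2 * π * I * τ) = -((Real.exp (-((2 * i + 1) * (π / y))) : ℝ) : ℂ) := by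
    have : 2 * π * I * (τ : ℂ) = π * I + ((-((2 * i + 1) * (π / y)) : ℝ) : ℂ) := by
      rw [hτc]
      push_cast
      field_simp
      ring_nf
      rw [I_sq]
      ring
    rw [this, Complex.exp_add, Complex.exp_pi_mul_I, ← ofReal_exp]
    ring
  have h2 : ∑' n : ℕ, (n : ℂ) ^ (2 * k) * cexp (2 * π * I * τ) ^ n =
      (rowSum k 0 (π / y) i : ℂ) := by
    rw [rowSum, ofReal_tsum]
    refine tsum_congr fun n ↦ ?_
    rw [hexp, neg_pow, peakTerm, ← ofReal_pow, ← Real.exp_nat_mul]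
    push_cast
    rw [add_zero]
    ring_nf
  have hconst : ((-2 * y * I) ^ (2 * k + 1))⁻¹ * (-2 * π * I) ^ (2 * k + 1) =
      ((π / y : ℝ) : ℂ) ^ (2 * k + 1) := by
    rw [← inv_pow, ← mul_pow]
    congr 1
    push_cast
    field_simp
  rw [h1, hL, h2]
  push_cast at hconst ⊢
  rw [← hconst]
  ring

lemma tsum_int_even_odd {f : ℤ → ℂ} (hf : Summable f) :
    ∑' n, f n = ∑' n, f (2 * n) + ∑' n, f (2 * n + 1) := by
  have h0 : Function.Injective fun n : ℤ ↦ 2 * n := fun a b h ↦ by simpa using h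
  have h1 : Function.Injective fun n : ℤ ↦ 2 * n + 1 := fun a b h ↦ by simpa using h
  have hc : IsCompl (Set.range fun n : ℤ ↦ 2 * n) (Set.range fun n : ℤ ↦ 2 * n + 1) := by
    refine ⟨Set.disjoint_left.mpr ?_, codisjoint_iff_le_sup.mpr fun n _ ↦ ?_⟩
    · rintro _ ⟨m, rfl⟩ ⟨l, h⟩
      simp only at h
      omega
    · rcases Int.even_or_odd' n with ⟨m, rfl | rfl⟩
      · exact Or.inl ⟨m, rfl⟩
      · exact Or.inr ⟨m, rfl⟩
  exact (HasSum.add_isCompl hc (h0.hasSum_range_iff.mpr (hf.comp_injective h0).hasSum)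
    (h1.hasSum_range_iff.mpr (hf.comp_injective h1).hasSum)).tsum_eq

lemma summable_natCast_pow_mul_pow (m : ℕ) {w : ℂ} (hw : ‖w‖ < 1) :
    Summable fun n : ℕ ↦ (n : ℂ) ^ m * w ^ n :=
  summable_pow_mul_geometric_of_norm_lt_one m hw

lemma I_pow_sub_neg_I_pow_even (m : ℕ) : I ^ (2 * m) - (-I) ^ (2 * m) = 0 := by
  rw [(even_two_mul m).neg_pow, sub_self]

lemma I_pow_sub_neg_I_pow_odd (m : ℕ) :
    I ^ (2 * m + 1) - (-I) ^ (2 * m + 1) = 2 * I * (-1) ^ m := by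
  rw [(odd_two_mul_add_one m).neg_pow, pow_succ, pow_mul, I_sq]
  ring

lemma tsum_mul_I_pow_sub (k : ℕ) {x : ℝ} (hx : 0 < x) :
    ∑' n : ℕ, (n : ℂ) ^ (2 * k) * (I * Real.exp (-x)) ^ n -
      ∑' n : ℕ, (n : ℂ) ^ (2 * k) * (-I * Real.exp (-x)) ^ n =
      2 * I * 4 ^ k * ((∑' n : ℕ, (-1) ^ n * peakTerm k (1 / 2) (2 * x) n : ℝ) : ℂ) := by
  have hr : Real.exp (-x) < 1 := Real.exp_lt_one_iff.mpr (by linarith)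
  have hn1 : ‖I * (Real.exp (-x) : ℂ)‖ < 1 := by
    rw [norm_mul, norm_I, one_mul, Complex.norm_real, Real.norm_of_nonneg (Real.exp_pos _).le]
    exact hr
  have hn2 : ‖-I * (Real.exp (-x) : ℂ)‖ < 1 := by rwa [neg_mul, norm_neg]
  have s1 := summable_natCast_pow_mul_pow (2 * k) hn1
  have s2 := summable_natCast_pow_mul_pow (2 * k) hn2
  have hs := s1.sub s2
  rw [← s1.tsum_sub s2]
  set r : ℂ := (Real.exp (-x) : ℂ) with hrdef
  have e : ∀ n : ℕ, (n : ℂ) ^ (2 * k) * (I * r) ^ n - (n : ℂ) ^ (2 * k) * (-I * r) ^ n =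
      (n : ℂ) ^ (2 * k) * r ^ n * (I ^ n - (-I) ^ n) := fun n ↦ by
    rw [mul_pow, mul_pow]; ring
  rw [tsum_congr e]
  set f : ℕ → ℂ := fun n ↦ (n : ℂ) ^ (2 * k) * r ^ n * (I ^ n - (-I) ^ n) with hf
  replace hs : Summable f := hs.congr e
  have e0 : ∀ m : ℕ, f (2 * m) = 0 := fun m ↦ by
    simp only [hf]
    rw [I_pow_sub_neg_I_pow_even, mul_zero]
  have e1 : ∀ m : ℕ, f (2 * m + 1) =
      2 * I * 4 ^ k * (((-1) ^ m * peakTerm k (1 / 2) (2 * x) m : ℝ) : ℂ) := fun m ↦ by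
    have h2 : (2 : ℂ) ^ (2 * k) = 4 ^ k := by rw [pow_mul]; norm_num
    have hexp : r ^ (2 * m + 1) = (Real.exp (-(((m : ℝ) + 1 / 2) * (2 * x))) : ℂ) := by
      rw [hrdef, ← ofReal_pow, ← Real.exp_nat_mul]
      congr 2
      push_cast
      ring
    have hb : ((2 * m + 1 : ℕ) : ℂ) = 2 * (m + 1 / 2) := by push_cast; ring
    simp only [hf]
    rw [I_pow_sub_neg_I_pow_odd, peakTerm, hexp, hb, mul_pow, h2]
    generalize Real.exp (-(((m : ℝ) + 1 / 2) * (2 * x))) = R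
    push_cast
    ring
  have i0 : Function.Injective fun n : ℕ ↦ 2 * n := fun a b h ↦ by simpa using h
  have i1 : Function.Injective fun n : ℕ ↦ 2 * n + 1 := fun a b h ↦ by simpa using h
  rw [← tsum_even_add_odd (f := f) (hs.comp_injective i0) (hs.comp_injective i1), tsum_congr e0,
    tsum_congr e1, tsum_zero, zero_add, tsum_mul_left, ← ofReal_tsum]

/-- The sign (-1)^r has period 2, so a row splits into two Lipschitz sums at real parts 1/4 and 3/4,
with parameters ±i e^{-x}. In their difference only odd exponents 2m + 1 = 2(m + 1/2) survive, which
is the source of the shift 1/2. -/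
lemma rowTsum_eq {k : ℕ} (hk : k ≠ 0) {y : ℝ} (hy : 0 < y) (i : ℕ) :
    rowTsum k y i = (((-1) ^ k * (π ^ (2 * k + 1) / (2 * k)!) : ℝ) : ℂ) *
      (rowSum k (1 / 2) (π * y) i : ℂ) := by
  have him : 0 < (2 * i + 1) * y / 4 := by positivity
  set τ₁ : ℍ := ⟨1 / 4 + ((2 * i + 1) * y / 4 : ℝ) * I, by simpa using him⟩
  set τ₃ : ℍ := ⟨3 / 4 + ((2 * i + 1) * y / 4 : ℝ) * I, by simpa using him⟩
  have hτ₁ : (τ₁ : ℂ) = 1 / 4 + ((2 * i + 1) * y / 4 : ℝ) * I := rfl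
  have hτ₃ : (τ₃ : ℂ) = 3 / 4 + ((2 * i + 1) * y / 4 : ℝ) * I := rfl
  have hL₁ := EisensteinSeries.qExpansion_identity (k := 2 * k) (by omega) τ₁
  have hL₃ := EisensteinSeries.qExpansion_identity (k := 2 * k) (by omega) τ₃
  have hsum : Summable fun r : ℤ ↦ lineTerm k y i r :=
    (summable_lineTerm hk hy).prod_factor (i : ℤ)
  have h1 : rowTsum k y i = (4 ^ (2 * k + 1))⁻¹ * ∑' n : ℤ, 1 / ((τ₁ : ℂ) + n) ^ (2 * k + 1) -
      (4 ^ (2 * k + 1))⁻¹ * ∑' n : ℤ, 1 / ((τ₃ : ℂ) + n) ^ (2 * k + 1) := by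
    rw [rowTsum, tsum_int_even_odd hsum, ← tsum_mul_left, ← tsum_mul_left, sub_eq_add_neg,
      ← tsum_neg]
    congr 1 <;> refine tsum_congr fun n ↦ ?_
    · rw [lineTerm, (even_two_mul n).neg_one_zpow, one_mul, one_div, ← mul_inv, ← mul_pow, hτ₁]
      congr 2
      push_cast
      ring
    · rw [lineTerm, (odd_two_mul_add_one n).neg_one_zpow, neg_one_mul, one_div, ← mul_inv,
        ← mul_pow, hτ₃]
      congr 3
      push_cast
      ring
  set x : ℝ := π * ((2 * i + 1) * y) / 2 with hx
  have hx0 : 0 < x := by positivity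
  have e₁ : cexp (2 * π * I * τ₁) = I * Real.exp (-x) := by
    have : 2 * π * I * (τ₁ : ℂ) = π / 2 * I + ((-x : ℝ) : ℂ) := by
      rw [hτ₁, hx]
      push_cast
      ring_nf
      rw [I_sq]
      ring
    rw [this, Complex.exp_add, Complex.exp_pi_div_two_mul_I, ← ofReal_exp]
  have e₃ : cexp (2 * π * I * τ₃) = -I * Real.exp (-x) := by
    have : 2 * π * I * (τ₃ : ℂ) = π * I + (π / 2 * I + ((-x : ℝ) : ℂ)) := by
      rw [hτ₃, hx]
      push_cast
      ring_nf
      rw [I_sq]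
      ring
    rw [this, Complex.exp_add, Complex.exp_add, Complex.exp_pi_div_two_mul_I, Complex.exp_pi_mul_I,
      ← ofReal_exp]
    ring
  have h2 := tsum_mul_I_pow_sub k hx0
  rw [show 2 * x = (2 * i + 1) * (π * y) by rw [hx]; ring, ← rowSum, sub_eq_iff_eq_add] at h2
  rw [h1, hL₁, hL₃, e₁, e₃, h2]
  have hI : (-2 * π * I) ^ (2 * k + 1) * I = 2 * 4 ^ k * ((-1) ^ k * (π : ℂ) ^ (2 * k + 1)) := by
    rw [mul_pow, mul_pow, pow_succ I, pow_mul I, I_sq, pow_succ (-2 : ℂ), pow_mul (-2 : ℂ)]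
    have := I_mul_I
    linear_combination (-2 * 4 ^ k * (π : ℂ) ^ (2 * k + 1) * (-1) ^ k) * this
  have h4 : (4 : ℂ) ^ (2 * k + 1) = 4 * 4 ^ k * 4 ^ k := by ring
  have h40 : (4 : ℂ) ^ k ≠ 0 := pow_ne_zero _ (by norm_num)
  have hf : ((2 * k)! : ℂ) ≠ 0 := by exact_mod_cast (Nat.factorial_ne_zero _)
  rw [h4]
  push_cast
  field_simp
  linear_combination (2 * 4 ^ k * (rowSum k (1 / 2) (π * y) i : ℂ)) * hI

end LevelTwoEisenstein

end

/-! ### Signs of the lattice sum at y = tan(πl/(2k+1)) -/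

noncomputable section

namespace LevelTwoEisenstein

open Complex
open UpperHalfPlane hiding I
open scoped Real Nat

/-- The real part of the lattice sum at the point `1 + iy`. -/
def lineRe (k : ℕ) (y : ℝ) : ℝ := (lineSum k y).re

/-- Conjugation permutes the terms by q ↦ -1 - q. -/
lemma lineSum_eq_lineRe (k : ℕ) (y : ℝ) : lineSum k y = lineRe k y := by
  refine (conj_eq_iff_re.mp ?_).symm
  rw [lineSum, conj_tsum, ← ((Equiv.subLeft (-1 : ℤ)).prodCongr (Equiv.refl ℤ)).tsum_eq]
  refine tsum_congr fun x ↦ ?_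
  rw [← lineTerm_neg_left]
  simp

section SmallIndex

variable {k l : ℕ}

lemma angle_pos (hl : 1 ≤ l) : 0 < π * l / (2 * k + 1) := by
  have : (0 : ℝ) < l := by exact_mod_cast hl
  positivity

lemma angle_lt (hl : l ≤ k) : π * l / (2 * k + 1) < π / 2 := by
  have : (l : ℝ) ≤ k := by exact_mod_cast hl
  rw [div_lt_div_iff₀ (by positivity) two_pos]
  nlinarith [Real.pi_pos]

lemma tan_angle_pos (hl : 1 ≤ l) (hlk : l ≤ k) : 0 < Real.tan (π * l / (2 * k + 1)) :=
  Real.tan_pos_of_pos_of_lt_pi_div_two (angle_pos hl) (angle_lt hlk)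

/-- Small y: in the column expansion the decay rate π/y = π cot(πl/(2k+1)) puts the peak at n = l.
-/
lemma sign_lineRe_of_sq_le (hl : 1 ≤ l) (hlk : l ≤ k) (h : 4 * l ^ 2 ≤ k) :
    0 < (-1) ^ l * lineRe k (Real.tan (π * l / (2 * k + 1))) := by
  have hk : k ≠ 0 := by omega
  have hl' : (1 : ℝ) ≤ l := by exact_mod_cast hl
  have h' : 4 * (l : ℝ) ^ 2 ≤ k := by exact_mod_cast h
  set y := Real.tan (π * l / (2 * k + 1)) with hy
  have hy0 : 0 < y := tan_angle_pos hl hlk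
  have hX : π / y = rate k l := by rw [rate, hy, div_eq_mul_inv]
  have key := sign_tsum_rowSum (k := k) (j := l) (δ := 0) (X := π / y) (ε := fun i ↦ (-1) ^ i) hk
    (Or.inl rfl) (by linarith) (by positivity)
    (by rw [hX]; simpa using up_ratio_le (by linarith) h')
    (fun _ ↦ by rw [hX]; simpa using down_ratio_le hl' h') (by simp) (by simp)
  have hsum : lineRe k y = 2 * ((π / y) ^ (2 * k + 1) / (2 * k)!) *
      ∑' i : ℕ, (-1) ^ i * rowSum k 0 (π / y) i := by
    rw [lineRe, lineSum_eq_colTsum hk hy0, tsum_congr (colTsum_eq hk hy0), tsum_mul_left,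
      ← ofReal_tsum, ← mul_assoc]
    norm_cast
  rw [hsum, mul_left_comm]
  exact mul_pos (by positivity) key

/-- Large y: with j = k - l, the rate πy is π cot(π(j + 1/2)/(2k+1)), so the row expansion peaks at
n = j. Its sign (-1)^j and the prefactor (-1)^k combine to (-1)^l. -/
lemma sign_lineRe_of_sq_sub_le (hl : 1 ≤ l) (hlk : l ≤ k)
    (h : (2 * k + 1 - 2 * l) ^ 2 ≤ k) :
    0 < (-1) ^ l * lineRe k (Real.tan (π * l / (2 * k + 1))) := by
  have hk : k ≠ 0 := by omega
  obtain ⟨j, rfl⟩ := Nat.exists_eq_add_of_le hlk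
  have h' : 4 * ((j : ℝ) + 1 / 2) ^ 2 ≤ (l + j : ℕ) := by
    rw [show 2 * (l + j) + 1 - 2 * l = 2 * j + 1 by omega] at h
    have : ((2 * j + 1 : ℕ) : ℝ) ^ 2 ≤ (l + j : ℕ) := by exact_mod_cast h
    push_cast at this ⊢
    linarith
  have hj0 : (0 : ℝ) ≤ j := j.cast_nonneg
  set y := Real.tan (π * l / (2 * (l + j : ℕ) + 1)) with hy
  have hy0 : 0 < y := tan_angle_pos hl hlk
  have hX : π * y = rate (l + j) (j + 1 / 2) := by
    rw [rate, hy, ← Real.tan_pi_div_two_sub]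
    congr 2
    push_cast
    field_simp
    ring
  have key := sign_tsum_rowSum (k := l + j) (j := j) (δ := 1 / 2) (X := π * y) (ε := fun _ ↦ 1) hk
    (Or.inr le_rfl) (by linarith) (by positivity)
    (by rw [hX]; exact up_ratio_le (by linarith) h')
    (fun h1 ↦ by rw [hX]; exact down_ratio_le h1 h') (by simp) (by simp)
  have hsum : lineRe (l + j) y = 2 * ((-1) ^ (l + j) * (π ^ (2 * (l + j) + 1) / (2 * (l + j))!)) *
      ∑' i : ℕ, 1 * rowSum (l + j) (1 / 2) (π * y) i := by
    rw [lineRe, lineSum_eq_rowTsum hk hy0, tsum_congr (rowTsum_eq hk hy0), tsum_mul_left,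
      ← ofReal_tsum, ← mul_assoc]
    simp only [one_mul]
    norm_cast
  have e : (-1 : ℝ) ^ l * lineRe (l + j) y = 2 * (π ^ (2 * (l + j) + 1) / (2 * (l + j))!) *
      ((-1) ^ j * ∑' i : ℕ, 1 * rowSum (l + j) (1 / 2) (π * y) i) := by
    rw [hsum, pow_add (-1 : ℝ) l j]
    have : (-1 : ℝ) ^ l * (-1) ^ l = 1 := by rw [← mul_pow]; simp
    linear_combination (2 * (π ^ (2 * (l + j) + 1) / (2 * (l + j))!) * (-1) ^ j *
      ∑' i : ℕ, 1 * rowSum (l + j) (1 / 2) (π * y) i) * this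
  rw [e]
  exact mul_pos (by positivity) key

end SmallIndex

section Middle

/-- `1 / (1 + α i (i + 1))`. -/
def invQuad (α : ℝ) (i : ℕ) : ℝ := (1 + α * (i * (i + 1)))⁻¹

lemma invQuad_nonneg {α : ℝ} (hα : 0 < α) (i : ℕ) : 0 ≤ invQuad α i := by
  rw [invQuad]; positivity

/-- For i ≥ 1 the term is at most 1/(α i(i+1)), which telescopes. -/
lemma sum_range_invQuad_le {α : ℝ} (hα : 0 < α) (n : ℕ) :
    ∑ i ∈ Finset.range n, invQuad α i ≤ 1 + 1 / α := by
  have key : ∀ n : ℕ, ∑ i ∈ Finset.range (n + 1), invQuad α i ≤ 1 + 1 / α * (1 - 1 / (n + 1)) := by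
    intro n
    induction n with
    | zero => simp [invQuad]
    | succ n ih =>
      rw [Finset.sum_range_succ]
      have : invQuad α (n + 1) ≤ 1 / α * (1 / (n + 1) - 1 / (n + 2)) := by
        have e : 1 / α * (1 / ((n : ℝ) + 1) - 1 / (n + 2)) = (α * ((n + 1) * (n + 2)))⁻¹ := by
          field_simp
          ring
        rw [e, invQuad]
        push_cast
        refine inv_anti₀ (by positivity) ?_
        linarith
      push_cast
      have e2 : (n : ℝ) + 1 + 1 = n + 2 := by ring
      rw [e2]
      linarith [mul_sub (1 / α) (1 / ((n : ℝ) + 1)) (1 / (n + 2)),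
        mul_sub (1 / α) 1 (1 / ((n : ℝ) + 1)), mul_sub (1 / α) 1 (1 / ((n : ℝ) + 2))]
  rcases n with _ | n
  · simp; positivity
  · refine (key n).trans ?_
    have : 1 / α * (1 - 1 / ((n : ℝ) + 1)) ≤ 1 / α * 1 := by
      gcongr
      have : 0 ≤ 1 / ((n : ℝ) + 1) := by positivity
      linarith
    linarith

lemma summable_invQuad {α : ℝ} (hα : 0 < α) : Summable (invQuad α) :=
  summable_of_sum_range_le (invQuad_nonneg hα) (sum_range_invQuad_le hα)

lemma tsum_invQuad_le {α : ℝ} (hα : 0 < α) : ∑' i, invQuad α i ≤ 1 + 1 / α :=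
  Real.tsum_le_of_sum_range_le (invQuad_nonneg hα) (sum_range_invQuad_le hα)

/-- Concavity places sine above its chord on [0, π/4]. -/
lemma sin_cos_quarter_bounds {x : ℝ} (h0 : 0 ≤ x) (h1 : x ≤ π / 4) :
    8 * (x / π) ^ 2 ≤ Real.sin x ^ 2 ∧ 1 / 2 ≤ Real.cos x ^ 2 := by
  have hpi := Real.pi_pos
  have hs2 : (√2 : ℝ) ^ 2 = 2 := Real.sq_sqrt (by norm_num)
  constructor
  · have ht : 4 * x / π ≤ 1 := by rw [div_le_one hpi]; linarith
    have hc := strictConcaveOn_sin_Icc.concaveOn.2 (⟨le_rfl, hpi.le⟩ : (0 : ℝ) ∈ Set.Icc 0 π)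
      (⟨by positivity, by linarith⟩ : π / 4 ∈ Set.Icc 0 π) (by linarith : 0 ≤ 1 - 4 * x / π)
      (by positivity : 0 ≤ 4 * x / π) (by ring)
    simp only [smul_eq_mul, Real.sin_zero, mul_zero, zero_add, Real.sin_pi_div_four] at hc
    rw [show 4 * x / π * (π / 4) = x by field_simp] at hc
    calc 8 * (x / π) ^ 2 = (4 * x / π * (√2 / 2)) ^ 2 := by
          rw [mul_pow, div_pow (√2), hs2]; ring
      _ ≤ _ := by gcongr
  · have hc : √2 / 2 ≤ Real.cos x := by
      rw [← Real.cos_pi_div_four]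
      exact Real.cos_le_cos_of_nonneg_of_le_pi h0 (by linarith) h1
    calc (1 / 2 : ℝ) = (√2 / 2) ^ 2 := by rw [div_pow, hs2]; norm_num
      _ ≤ _ := by gcongr

/-- Write v² = 1 + A + B with A = 4aC and B = 4bS. Then (1 + A + B)² ≥ (1 + 2A)(1 + 2B), and
Bernoulli with exponent (2k+1)/4 ≥ 5/4 separates the two variables. The constants 5 and 8/5 are the
worst cases C = 1/2 and k = 2. -/
lemma pow_lower {k : ℕ} (hk : 2 ≤ k) {C S v : ℝ} (hv : 0 ≤ v) (hCS : C + S = 1) (hC : 1 / 2 ≤ C)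
    (hS : 2 * k / (2 * k + 1) ^ 2 ≤ S) {i j : ℕ}
    (h : v ^ 2 = (2 * i + 1) ^ 2 * C + (2 * j + 1) ^ 2 * S) :
    (invQuad 5 i * invQuad (8 / 5) j)⁻¹ ≤ v ^ (2 * k + 1) := by
  have hk' : (2 : ℝ) ≤ k := by exact_mod_cast hk
  have hS0 : 0 ≤ S := le_trans (by positivity) hS
  set a : ℝ := i * (i + 1) with ha
  set b : ℝ := j * (j + 1) with hb
  have ha0 : 0 ≤ a := by positivity
  have hb0 : 0 ≤ b := by positivity
  have hv2 : v ^ 2 = 1 + 4 * a * C + 4 * b * S := by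
    rw [h, ha, hb]; linear_combination hCS
  have hv4 : (1 + 8 * a * C) * (1 + 8 * b * S) ≤ v ^ 4 := by
    have : v ^ 4 = (v ^ 2) ^ 2 := by ring
    rw [this, hv2]
    nlinarith [sq_nonneg (4 * a * C - 4 * b * S)]
  have hp : (1 : ℝ) ≤ (2 * k + 1) / 4 := by rw [le_div_iff₀ (by norm_num)]; linarith
  have hpow : v ^ (2 * k + 1) = (v ^ 4) ^ (((2 * k + 1) / 4 : ℝ)) := by
    rw [← Real.rpow_natCast v (2 * k + 1), ← Real.rpow_natCast v 4, ← Real.rpow_mul hv]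
    congr 1
    push_cast
    ring
  have h1 : 1 + 5 * a ≤ (1 + 8 * a * C) ^ (((2 * k + 1) / 4 : ℝ)) := by
    have h0 : 0 ≤ 8 * a * C := by positivity
    refine le_trans ?_ (one_add_mul_self_le_rpow_one_add (by linarith) hp)
    have : 5 / 4 * (4 * a) ≤ (2 * k + 1) / 4 * (8 * a * C) := by
      apply mul_le_mul
      · linarith
      · nlinarith
      · positivity
      · positivity
    linarith
  have h2 : 1 + 8 / 5 * b ≤ (1 + 8 * b * S) ^ (((2 * k + 1) / 4 : ℝ)) := by
    have h0 : 0 ≤ 8 * b * S := by positivity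
    refine le_trans ?_ (one_add_mul_self_le_rpow_one_add (by linarith) hp)
    have h3 : (2 : ℝ) / 5 ≤ k / (2 * k + 1) := by
      rw [div_le_div_iff₀ (by norm_num) (by positivity)]; linarith
    have h4 : (4 : ℝ) * (k / (2 * k + 1)) = (2 * k + 1) / 4 * (8 * (2 * k / (2 * k + 1) ^ 2)) := by
      field_simp
      norm_num
    have h5 : (8 : ℝ) / 5 ≤ (2 * k + 1) / 4 * (8 * S) := by
      calc (8 : ℝ) / 5 ≤ 4 * (k / (2 * k + 1)) := by linarith
        _ = _ := h4
        _ ≤ _ := by gcongr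
    nlinarith
  rw [hpow, invQuad, invQuad, mul_inv, inv_inv, inv_inv]
  calc (1 + 5 * a) * (1 + 8 / 5 * b)
      ≤ (1 + 8 * a * C) ^ (((2 * k + 1) / 4 : ℝ)) * (1 + 8 * b * S) ^ (((2 * k + 1) / 4 : ℝ)) := by
        gcongr
    _ = ((1 + 8 * a * C) * (1 + 8 * b * S)) ^ (((2 * k + 1) / 4 : ℝ)) :=
        (Real.mul_rpow (by positivity) (by positivity)).symm
    _ ≤ _ := Real.rpow_le_rpow (by positivity) hv4 (by positivity)

lemma lineRe_eq_four_mul {k : ℕ} (hk : k ≠ 0) {y : ℝ} (hy : 0 < y) :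
    lineRe k y = 4 * ∑' x : ℕ × ℕ, (lineTerm k y x.1 x.2).re := by
  have hs : Summable fun x : ℤ × ℤ ↦ (lineTerm k y x.1 x.2).re :=
    (hasSum_re (summable_lineTerm hk hy).hasSum).summable
  have hrow : ∀ q : ℤ, ∑' r : ℤ, (lineTerm k y q r).re = 2 * ∑' r : ℕ, (lineTerm k y q r).re :=
    fun q ↦ tsum_int_eq_two_mul (hs.prod_factor q) fun r ↦ by rw [lineTerm_neg_right, conj_re]
  have hsq : Summable fun q : ℤ ↦ 2 * ∑' r : ℕ, (lineTerm k y q r).re :=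
    hs.prod.congr fun q ↦ (hrow q)
  have hnat : Summable fun x : ℕ × ℕ ↦ (lineTerm k y x.1 x.2).re :=
    hs.comp_injective (i := Prod.map Nat.cast Nat.cast)
      (Nat.cast_injective.prodMap Nat.cast_injective)
  rw [lineRe, lineSum, re_tsum (summable_lineTerm hk hy), hs.tsum_prod, tsum_congr hrow,
    tsum_int_eq_two_mul hsq fun q ↦ by simp_rw [lineTerm_neg_left, conj_re], tsum_mul_left,
    hnat.tsum_prod]
  ring

/-- The majorant includes the main term, so a product of sums below 2 leaves less than M for all the
others. -/
lemma pos_of_dominant {F : ℕ × ℕ → ℝ} {M s : ℝ} {g h : ℕ → ℝ} (hs : s = 1 ∨ s = -1) (hM : 0 < M)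
    (hF : F 0 = s * M) (hg : Summable g) (hh : Summable h) (hg0 : ∀ i, 0 ≤ g i)
    (hh0 : ∀ i, 0 ≤ h i) (hgz : g 0 = 1) (hhz : h 0 = 1)
    (hle : ∀ x, |F x| ≤ M * (g x.1 * h x.2)) (hlt : (∑' i, g i) * ∑' i, h i < 2) :
    0 < s * ∑' x, F x := by
  have hgh : Summable fun x : ℕ × ℕ ↦ g x.1 * h x.2 := hg.mul_of_nonneg hh hg0 hh0
  have hprod : ∑' x : ℕ × ℕ, g x.1 * h x.2 = (∑' i, g i) * ∑' i, h i :=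
    (hg.tsum_mul_tsum hh hgh).symm
  have hMg := hgh.mul_left M
  have hFs : Summable F := hMg.of_norm_bounded hle
  have h1 := hFs.tsum_eq_add_tsum_ite 0
  have h2 := hMg.tsum_eq_add_tsum_ite 0
  have hs' : Summable fun x : ℕ × ℕ ↦ if x = 0 then 0 else M * (g x.1 * h x.2) :=
    hMg.of_nonneg_of_le
      (fun x ↦ by split_ifs; exacts [le_rfl, mul_nonneg hM.le (mul_nonneg (hg0 _) (hh0 _))])
      (fun x ↦ by split_ifs; exacts [mul_nonneg hM.le (mul_nonneg (hg0 _) (hh0 _)), le_rfl])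
  have h3 : |∑' x, if x = 0 then 0 else F x| ≤
      ∑' x : ℕ × ℕ, if x = 0 then 0 else M * (g x.1 * h x.2) := by
    rw [← Real.norm_eq_abs]
    refine tsum_of_norm_bounded hs'.hasSum fun x ↦ ?_
    split_ifs
    · simp
    · exact hle x
  rw [tsum_mul_left, hprod] at h2
  simp only [Prod.fst_zero, Prod.snd_zero, hgz, hhz, mul_one] at h2
  have h4 : M * ((∑' i, g i) * ∑' i, h i) < M * 2 := by gcongr
  rw [h1, hF]
  rw [abs_le] at h3
  rcases hs with rfl | rfl <;> linarith

/-- Here 1 + i tan θ = e^{iθ}/cos θ with θ = πl/(2k+1), whose (2k+1)-st power is real; this dictates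
the sample points. -/
lemma lineTerm_zero_zero {k l : ℕ} (hlk : l ≤ k) :
    lineTerm k (Real.tan (π * l / (2 * k + 1))) 0 0 =
      (((-1) ^ l * Real.cos (π * l / (2 * k + 1)) ^ (2 * k + 1) : ℝ) : ℂ) := by
  set θ := π * l / (2 * k + 1) with hθ
  have hθ0 : 0 ≤ θ := by positivity
  have hc : 0 < Real.cos θ := Real.cos_pos_of_mem_Ioo ⟨by linarith [Real.pi_pos], angle_lt hlk⟩
  have hcC : (Real.cos θ : ℂ) ≠ 0 := by exact_mod_cast hc.ne'
  have e : (1 : ℂ) + Real.tan θ * I = cexp (θ * I) * (Real.cos θ : ℂ)⁻¹ := by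
    rw [exp_mul_I, Real.tan_eq_sin_div_cos]
    push_cast at hcC ⊢
    field_simp
  have hexp : cexp (θ * I) ^ (2 * k + 1) = (-1) ^ l := by
    rw [← Complex.exp_nat_mul, ← Complex.exp_pi_mul_I, ← Complex.exp_nat_mul, hθ]
    congr 1
    push_cast
    have : (2 * k + 1 : ℂ) ≠ 0 := by exact_mod_cast (by omega : 2 * k + 1 ≠ 0)
    field_simp
  rw [lineTerm]
  simp only [Int.cast_zero, mul_zero, zero_add, zpow_zero, one_mul]
  rw [e, mul_pow, hexp, mul_inv, inv_pow, inv_inv, ← inv_pow]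
  push_cast
  norm_num

lemma norm_lineTerm (k : ℕ) (y : ℝ) (q r : ℤ) :
    ‖lineTerm k y q r‖ = (‖(2 * r + 1 : ℂ) + (2 * q + 1) * y * I‖ ^ (2 * k + 1))⁻¹ := by
  rw [lineTerm, norm_mul, norm_zpow, norm_neg, norm_one, one_zpow, one_mul, norm_inv, norm_pow]

lemma sq_norm_lattice (y : ℝ) (q r : ℤ) :
    ‖(2 * r + 1 : ℂ) + (2 * q + 1) * y * I‖ ^ 2 = (2 * r + 1) ^ 2 + (2 * q + 1) ^ 2 * y ^ 2 := by
  have : (2 * r + 1 : ℂ) + (2 * q + 1) * y * I =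
      ((2 * r + 1 : ℝ) : ℂ) + (((2 * q + 1) * y : ℝ) : ℂ) * I := by push_cast; ring
  rw [this, ← normSq_eq_norm_sq, normSq_add_mul_I]
  ring

lemma norm_lineTerm_le {k : ℕ} {θ : ℝ} (hc : 0 < Real.cos θ) (q r : ℕ) {B : ℝ} (hB : 0 < B)
    (h : ∀ v : ℝ, 0 ≤ v → v ^ 2 = (2 * r + 1) ^ 2 * Real.cos θ ^ 2 +
      (2 * q + 1) ^ 2 * Real.sin θ ^ 2 → B⁻¹ ≤ v ^ (2 * k + 1)) :
    ‖lineTerm k (Real.tan θ) q r‖ ≤ Real.cos θ ^ (2 * k + 1) * B := by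
  set n : ℝ := ‖(2 * (r : ℤ) + 1 : ℂ) + (2 * (q : ℤ) + 1) * Real.tan θ * I‖ with hn
  have hsq : (Real.cos θ * n) ^ 2 = (2 * r + 1) ^ 2 * Real.cos θ ^ 2 +
      (2 * q + 1) ^ 2 * Real.sin θ ^ 2 := by
    rw [mul_pow, hn, sq_norm_lattice, Real.tan_eq_sin_div_cos]
    push_cast
    field_simp
  have hn0 : 0 ≤ n := norm_nonneg _
  have h1 := h (Real.cos θ * n) (by positivity) hsq
  have hn1 : 0 < n := by
    rcases hn0.eq_or_lt with h0 | h0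
    · rw [← h0, mul_zero, zero_pow (by omega)] at h1
      exact absurd (inv_pos.mpr hB) (not_lt.mpr h1)
    · exact h0
  rw [norm_lineTerm, ← hn, inv_le_iff_one_le_mul₀ (by positivity)]
  rw [inv_le_iff_one_le_mul₀ hB, mul_pow] at h1
  linarith

/-- The term (0,0) of the quadrant sum dominates, since (1 + 1/5)(1 + 5/8) = 1.95 < 2. The two
hypotheses on l keep sin²θ and cos²θ above 2k/(2k+1)². -/
lemma sign_lineRe_middle {k l : ℕ} (hl : 1 ≤ l) (hlk : l ≤ k) (h1 : k < 4 * l ^ 2)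
    (h2 : k < (2 * k + 1 - 2 * l) ^ 2) :
    0 < (-1) ^ l * lineRe k (Real.tan (π * l / (2 * k + 1))) := by
  have hk2 : 2 ≤ k := by
    by_contra! h
    obtain rfl : k = 1 := by omega
    obtain rfl : l = 1 := by omega
    norm_num at h2
  have hk : k ≠ 0 := by omega
  have hpi := Real.pi_pos
  set θ := π * l / (2 * k + 1) with hθ
  have hθ0 : 0 < θ := angle_pos hl
  have hθ1 : θ < π / 2 := angle_lt hlk
  have hc : 0 < Real.cos θ := Real.cos_pos_of_mem_Ioo ⟨by linarith, hθ1⟩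
  have hl' : (l : ℝ) ≤ k := by exact_mod_cast hlk
  have h1' : (k : ℝ) < 4 * l ^ 2 := by exact_mod_cast h1
  have h2' : (k : ℝ) < (2 * k + 1 - 2 * l) ^ 2 := by
    obtain ⟨m, hm⟩ : ∃ m, m + 2 * l = 2 * k + 1 := ⟨2 * k + 1 - 2 * l, by omega⟩
    rw [show 2 * k + 1 - 2 * l = m by omega] at h2
    have e : (2 * k + 1 - 2 * l : ℝ) = m := by
      have : ((m + 2 * l : ℕ) : ℝ) = (2 * k + 1 : ℕ) := by rw [hm]
      push_cast at this
      linarith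
    rw [e]
    exact_mod_cast h2
  have hs : ((-1 : ℝ) ^ l = 1 ∨ (-1 : ℝ) ^ l = -1) := neg_one_pow_eq_or ℝ l
  have hF0 : (lineTerm k (Real.tan θ) ((0 : ℕ × ℕ).1 : ℤ) ((0 : ℕ × ℕ).2 : ℤ)).re =
      (-1) ^ l * Real.cos θ ^ (2 * k + 1) := by
    have := lineTerm_zero_zero hlk
    rw [← hθ] at this
    simp only [Prod.fst_zero, Prod.snd_zero, Nat.cast_zero]
    rw [this, ofReal_re]
  have i5 : 0 < (5 : ℝ) := by norm_num
  have i8 : 0 < (8 / 5 : ℝ) := by norm_num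
  have hp5 : ∀ i, 0 < invQuad 5 i := fun i ↦ by rw [invQuad]; positivity
  have hp8 : ∀ i, 0 < invQuad (8 / 5) i := fun i ↦ by rw [invQuad]; positivity
  have hz : ∀ α, invQuad α 0 = 1 := fun α ↦ by simp [invQuad]
  have hprod : (∑' i, invQuad 5 i) * ∑' i, invQuad (8 / 5) i < 2 :=
    calc _ ≤ (1 + 1 / 5 : ℝ) * (1 + 1 / (8 / 5)) :=
          mul_le_mul (tsum_invQuad_le i5) (tsum_invQuad_le i8)
            (tsum_nonneg (invQuad_nonneg i8)) (by norm_num)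
      _ < 2 := by norm_num
  rw [lineRe_eq_four_mul hk (Real.tan_pos_of_pos_of_lt_pi_div_two hθ0 hθ1), mul_left_comm]
  refine mul_pos (by norm_num) ?_
  have hM : 0 < Real.cos θ ^ (2 * k + 1) := by positivity
  have hCS := Real.cos_sq_add_sin_sq θ
  -- The larger of cos²θ and sin²θ plays the role of C, so beyond π/4 rows and columns exchange
  -- roles.
  rcases le_total θ (π / 4) with hq | hq
  · obtain ⟨hS, hC⟩ := sin_cos_quarter_bounds hθ0.le hq
    have hS' : 2 * k / (2 * k + 1) ^ 2 ≤ Real.sin θ ^ 2 := by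
      refine le_trans ?_ hS
      rw [hθ, div_div, mul_comm _ π, mul_div_mul_left _ _ hpi.ne', div_pow, ← mul_div_assoc]
      exact div_le_div_of_nonneg_right (by linarith) (by positivity)
    refine pos_of_dominant hs hM hF0 (summable_invQuad i8) (summable_invQuad i5)
      (invQuad_nonneg i8) (invQuad_nonneg i5) (hz _) (hz _) (fun x ↦ ?_) (by rwa [mul_comm])
    refine (abs_re_le_norm _).trans (norm_lineTerm_le hc _ _ (mul_pos (hp8 _) (hp5 _)) ?_)
    intro v hv hv2
    rw [mul_comm (invQuad _ _)]
    exact pow_lower hk2 hv hCS hC hS' hv2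
  · have hφ0 : 0 ≤ π / 2 - θ := by linarith
    obtain ⟨hS, hC⟩ := sin_cos_quarter_bounds hφ0 (by linarith)
    rw [Real.sin_pi_div_two_sub] at hS
    rw [Real.cos_pi_div_two_sub] at hC
    have hS' : 2 * k / (2 * k + 1) ^ 2 ≤ Real.cos θ ^ 2 := by
      refine le_trans ?_ hS
      have e : (π / 2 - θ) / π = (2 * k + 1 - 2 * l) / (2 * (2 * k + 1)) := by
        rw [hθ]; field_simp
      rw [e, div_pow, mul_pow, ← mul_div_assoc, div_le_div_iff₀ (by positivity) (by positivity)]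
      have : (0 : ℝ) < (2 * k + 1) ^ 2 := by positivity
      nlinarith
    refine pos_of_dominant hs hM hF0 (summable_invQuad i5) (summable_invQuad i8)
      (invQuad_nonneg i5) (invQuad_nonneg i8) (hz _) (hz _) (fun x ↦ ?_) hprod
    refine (abs_re_le_norm _).trans (norm_lineTerm_le hc _ _ (mul_pos (hp5 _) (hp8 _)) ?_)
    intro v hv hv2
    refine pow_lower hk2 hv (by rw [add_comm]; exact hCS) hC hS' ?_
    rw [hv2]; ring

end Middle

/-- At `y = tan (π l / (2k + 1))`, the lattice sum has the sign of `(-1)^l`. -/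
theorem sign_lineRe {k l : ℕ} (hl : 1 ≤ l) (hlk : l ≤ k) :
    0 < (-1) ^ l * lineRe k (Real.tan (π * l / (2 * k + 1))) := by
  by_cases h1 : 4 * l ^ 2 ≤ k
  · exact sign_lineRe_of_sq_le hl hlk h1
  by_cases h2 : (2 * k + 1 - 2 * l) ^ 2 ≤ k
  · exact sign_lineRe_of_sq_sub_le hl hlk h2
  exact sign_lineRe_middle hl hlk (not_le.mp h1) (not_le.mp h2)

/-- The norm of every term decreases in y, so the terms at y = a dominate those on [a, ∞). -/
lemma continuousOn_lineRe {k : ℕ} (hk : k ≠ 0) {a : ℝ} (ha : 0 < a) :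
    ContinuousOn (lineRe k) (Set.Ici a) := by
  have hne : ∀ y : ℝ, 0 < y → ∀ q r : ℤ, 0 < ‖(2 * r + 1 : ℂ) + (2 * q + 1) * y * I‖ := by
    intro y hy q r
    have h1 : (0 : ℝ) < (2 * r + 1) ^ 2 := by
      have : (2 * r + 1 : ℝ) ≠ 0 := by exact_mod_cast (by omega : 2 * r + 1 ≠ 0)
      positivity
    have h2 : 0 < ‖(2 * r + 1 : ℂ) + (2 * q + 1) * y * I‖ ^ 2 := by
      rw [sq_norm_lattice]; positivity
    exact lt_of_le_of_ne (norm_nonneg _) fun h ↦ by rw [← h] at h2; norm_num at h2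
  have hsum : ContinuousOn (fun y ↦ ∑' x : ℤ × ℤ, lineTerm k y x.1 x.2) (Set.Ici a) := by
    refine continuousOn_tsum (u := fun x : ℤ × ℤ ↦ ‖lineTerm k a x.1 x.2‖) (fun x ↦ ?_)
      (summable_lineTerm hk ha).norm fun x y hy ↦ ?_
    · unfold lineTerm
      refine continuousOn_const.mul (ContinuousOn.inv₀ (by fun_prop) fun y hy ↦ ?_)
      exact pow_ne_zero _ (norm_pos_iff.mp (hne y (ha.trans_le hy) _ _))
    · rw [norm_lineTerm, norm_lineTerm]
      have hp := hne a ha x.1 x.2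
      gcongr
      refine le_of_sq_le_sq ?_ (norm_nonneg _)
      rw [sq_norm_lattice, sq_norm_lattice]
      have : a ≤ y := hy
      gcongr
  exact continuous_re.comp_continuousOn hsum

end LevelTwoEisenstein

end

/-! ### Counting: the zeros on the line are all the zeros -/

noncomputable section

namespace LevelTwoEisenstein

open Complex
open UpperHalfPlane hiding I
open scoped Real MatrixGroups

lemma odd_diag_of_mem_Gamma_two {γ : SL(2, ℤ)} (hγ : γ ∈ CongruenceSubgroup.Gamma 2) :
    Even (γ 1 0) ∧ Odd (γ 1 1) := by
  rw [CongruenceSubgroup.Gamma_mem] at hγ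
  obtain ⟨-, -, h10, h11⟩ := hγ
  constructor
  · exact (ZMod.intCast_eq_zero_iff_even).mp h10
  · exact (ZMod.intCast_eq_one_iff_odd).mp h11

/-- |c(1 + iy) + d|² ≥ (c + d)² ≥ 1, because c + d is odd. By symmetry, equivalent points of the
line have equal heights. -/
lemma im_smul_linePoint_le {γ : SL(2, ℤ)} (hγ : γ ∈ CongruenceSubgroup.Gamma 2) {y : ℝ}
    (hy : 0 < y) : (γ • linePoint y hy).im ≤ y := by
  obtain ⟨hc, hd⟩ := odd_diag_of_mem_Gamma_two hγ
  have hi : (linePoint y hy).im = y := by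
    rw [← coe_im, coe_linePoint]; simp
  have hden : 1 ≤ normSq (denom γ (linePoint y hy)) := by
    have e : denom γ (linePoint y hy) =
        (((γ 1 0 + γ 1 1 : ℤ) : ℝ) : ℂ) + ((γ 1 0 * y : ℝ) : ℂ) * I := by
      rw [ModularGroup.denom_apply, coe_linePoint]
      push_cast
      ring
    have h0 : (1 : ℝ) ≤ ((γ 1 0 + γ 1 1 : ℤ) : ℝ) ^ 2 := by
      have hne : γ 1 0 + γ 1 1 ≠ 0 := by
        intro h
        have := hc.add_odd hd
        rw [h] at this
        exact absurd this (by decide)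
      have : (1 : ℤ) ≤ (γ 1 0 + γ 1 1) ^ 2 := by have := sq_pos_of_ne_zero hne; omega
      exact_mod_cast this
    rw [e, normSq_add_mul_I]
    nlinarith [sq_nonneg (γ 1 0 * y : ℝ)]
  rw [ModularGroup.im_smul_eq_div_normSq, hi]
  exact div_le_self hy.le hden

lemma eq_of_hauptmodul_linePoint_eq {y y' : ℝ} (hy : 0 < y) (hy' : 0 < y')
    (h : hauptmodul (linePoint y hy) = hauptmodul (linePoint y' hy')) : y = y' := by
  have key : ∀ {y y' : ℝ} (hy : 0 < y) (hy' : 0 < y'),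
      hauptmodul (linePoint y hy) = hauptmodul (linePoint y' hy') → y' ≤ y := by
    intro y y' hy hy' h
    obtain ⟨γ, hγ, e⟩ := exists_Gamma_two_of_hauptmodul_eq h
    have h1 := im_smul_linePoint_le hγ hy
    rw [e, ← coe_im, coe_linePoint] at h1
    simpa using h1
  exact le_antisymm (key hy' hy h.symm) (key hy hy' h)

lemma lineRe_eq_zero_iff {k : ℕ} (hk : k ≠ 0) {y : ℝ} (hy : 0 < y) :
    lineRe k y = 0 ↔ (critPoly k).eval (hauptmodul (linePoint y hy)) = 0 := by
  rw [← tsum_latticeTerm_eq_zero_iff hk, tsum_latticeTerm_linePoint, lineSum_eq_lineRe,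
    ofReal_eq_zero]

lemma exists_zero_lineRe {k l : ℕ} (hl : 1 ≤ l) (hlk : l < k) :
    ∃ y, Real.tan (π * l / (2 * k + 1)) < y ∧ y < Real.tan (π * (l + 1 : ℕ) / (2 * k + 1)) ∧
      lineRe k y = 0 := by
  have hk : k ≠ 0 := by omega
  have ha := tan_angle_pos hl hlk.le
  have hab : Real.tan (π * l / (2 * k + 1)) < Real.tan (π * (l + 1 : ℕ) / (2 * k + 1)) := by
    refine Real.tan_lt_tan_of_nonneg_of_lt_pi_div_two (angle_pos hl).le (angle_lt hlk) ?_
    rw [div_lt_div_iff_of_pos_right (by positivity)]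
    push_cast
    linarith [Real.pi_pos]
  have h1 := sign_lineRe hl hlk.le
  have h2 := sign_lineRe (k := k) (l := l + 1) (by omega) hlk
  rw [pow_succ] at h2
  have hcont : ContinuousOn (fun y ↦ (-1) ^ l * lineRe k y)
      (Set.Icc (Real.tan (π * l / (2 * k + 1))) (Real.tan (π * (l + 1 : ℕ) / (2 * k + 1)))) :=
    continuousOn_const.mul ((continuousOn_lineRe hk ha).mono Set.Icc_subset_Ici_self)
  obtain ⟨y, hy, h0⟩ := intermediate_value_Ioo' hab.le hcont
    (⟨by linarith, h1⟩ : (0 : ℝ) ∈ Set.Ioo _ _)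
  refine ⟨y, hy.1, hy.2, ?_⟩
  exact (mul_eq_zero.mp h0).resolve_left (pow_ne_zero _ (by norm_num))

/-- Every zero of `G_{2k+1}` is `Γ(2)`-equivalent to one of finitely many points on the line
`Re z = 1`. -/
theorem exists_finset_zeros {k : ℕ} (hk : k ≠ 0) : ∃ s : Finset ℝ, ∀ z : ℍ, G k z = 0 →
    ∃ y ∈ s, ∃ hy : 0 < y, ∃ γ ∈ CongruenceSubgroup.Gamma 2, γ • z = linePoint y hy := by
  have hex : ∀ i : ℕ, ∃ y, 0 < y ∧ (i < k - 1 →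
      Real.tan (π * (i + 1 : ℕ) / (2 * k + 1)) < y ∧
      y < Real.tan (π * (i + 1 + 1 : ℕ) / (2 * k + 1)) ∧ lineRe k y = 0) := by
    intro i
    by_cases hi : i < k - 1
    · obtain ⟨y, h1, h2, h3⟩ := exists_zero_lineRe (k := k) (l := i + 1) (by omega) (by omega)
      exact ⟨y, (tan_angle_pos (by omega) (by omega)).trans h1, fun _ ↦ ⟨h1, h2, h3⟩⟩
    · exact ⟨1, one_pos, fun h ↦ absurd h hi⟩
  choose Y hY0 hY using hex
  have hlt : ∀ i j, i < j → j < k - 1 → Y i < Y j := by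
    intro i j hij hj
    refine (hY i (by omega)).2.1.trans_le (le_trans ?_ (hY j hj).1.le)
    rcases (Nat.succ_le_of_lt hij).eq_or_lt with h | h
    · rw [← h]
    · refine (Real.tan_lt_tan_of_nonneg_of_lt_pi_div_two (angle_pos (by omega)).le
        (angle_lt (by omega)) ?_).le
      rw [div_lt_div_iff_of_pos_right (by positivity)]
      have : ((i + 1 + 1 : ℕ) : ℝ) < (j + 1 : ℕ) := by exact_mod_cast (by omega)
      nlinarith [Real.pi_pos]
  set t : ℕ → ℂ := fun i ↦ hauptmodul (linePoint (Y i) (hY0 i)) with ht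
  have hinj : Set.InjOn t (Finset.range (k - 1)) := by
    intro i hi j hj hij
    simp only [Finset.coe_range, Set.mem_Iio] at hi hj
    have e := eq_of_hauptmodul_linePoint_eq (hY0 i) (hY0 j) hij
    rcases lt_trichotomy i j with h | h | h
    · exact absurd e (hlt i j h hj).ne
    · exact h
    · exact absurd e (hlt j i h hi).ne'
  have hp0 : critPoly k ≠ 0 := by
    intro h
    have h1 := sign_lineRe (k := k) (l := 1) le_rfl (by omega)
    have hy := tan_angle_pos (k := k) (l := 1) le_rfl (by omega)
    have : lineRe k (Real.tan (π * (1 : ℕ) / (2 * k + 1))) = 0 := by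
      rw [lineRe_eq_zero_iff hk hy, h, Polynomial.eval_zero]
    rw [this, mul_zero] at h1
    exact lt_irrefl _ h1
  -- The k - 1 values of t at the zeros found, together with the spurious root 1, make k distinct
  -- roots; as the degree is at most k, there are no others.
  set R : Finset ℂ := insert 1 ((Finset.range (k - 1)).image t) with hR
  have hcard : R.card = k := by
    rw [hR, Finset.card_insert_of_notMem, Finset.card_image_of_injOn hinj, Finset.card_range]
    · omega
    · intro h
      obtain ⟨i, -, h⟩ := Finset.mem_image.mp h
      exact hauptmodul_ne_one _ h
  have hsub : R ⊆ (critPoly k).roots.toFinset := by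
    intro x hx
    rw [Multiset.mem_toFinset, Polynomial.mem_roots hp0, Polynomial.IsRoot]
    rcases Finset.mem_insert.mp hx with rfl | hx
    · exact eval_one_critPoly hk
    · obtain ⟨i, hi, rfl⟩ := Finset.mem_image.mp hx
      exact (lineRe_eq_zero_iff hk (hY0 i)).mp (hY i (Finset.mem_range.mp hi)).2.2
  have hRe : R = (critPoly k).roots.toFinset := by
    refine Finset.eq_of_subset_of_card_le hsub ?_
    rw [hcard]
    exact ((Multiset.toFinset_card_le _).trans (Polynomial.card_roots' _)).trans
      (natDegree_critPoly_le k)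
  refine ⟨(Finset.range (k - 1)).image Y, fun z hz ↦ ?_⟩
  rw [G_eq_zero_iff hk, tsum_latticeTerm_eq_zero_iff hk] at hz
  have hmem : hauptmodul z ∈ R := by
    rw [hRe, Multiset.mem_toFinset, Polynomial.mem_roots hp0]
    exact hz
  obtain ⟨i, hi, h⟩ := Finset.mem_image.mp
    ((Finset.mem_insert.mp hmem).resolve_left (hauptmodul_ne_one z))
  exact ⟨Y i, Finset.mem_image_of_mem Y hi, hY0 i, exists_Gamma_two_of_hauptmodul_eq h.symm⟩

lemma linePoint_mem_D {y : ℝ} (hy : 0 < y) : linePoint y hy ∈ D ∧ (linePoint y hy).re = 1 := by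
  have hre : (linePoint y hy).re = 1 := by rw [← coe_re, coe_linePoint]; simp
  refine ⟨⟨by rw [hre]; norm_num, hre.le, ?_, ?_⟩, hre⟩
  · refine le_trans ?_ (abs_re_le_norm _)
    rw [coe_linePoint]
    norm_num
  · refine le_trans ?_ (abs_re_le_norm _)
    rw [coe_linePoint]
    norm_num

end LevelTwoEisenstein

end

/-! ### Theta functions: invariance of λ and its values on the line -/

noncomputable section

namespace LevelTwoEisenstein

open Complex ModularForm
open UpperHalfPlane hiding I
open scoped Real MatrixGroups ComplexConjugate

lemma Θ₂_eq (z : ℍ) : Θ₂ z = cexp (π * I * z / 4) * jacobiTheta₂ (z / 2) z := by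
  rw [Θ₂, jacobiTheta₂]
  congr 1
  refine tsum_congr fun n ↦ ?_
  rw [jacobiTheta₂_term]
  congr 1
  ring

lemma Θ₃_eq (z : ℍ) : Θ₃ z = jacobiTheta₂ 0 z :=
  tsum_congr fun n ↦ by rw [jacobiTheta₂_term, mul_zero, zero_add]

/-- The theta function `∑ (-1)^n q^{n²/2}`. -/
def Θ₄ (z : ℍ) : ℂ := jacobiTheta₂ (1 / 2) z

lemma jacobiTheta₂_add_one_right (w τ : ℂ) :
    jacobiTheta₂ w (τ + 1) = jacobiTheta₂ (w + 1 / 2) τ := by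
  refine tsum_congr fun n ↦ ?_
  obtain ⟨m, hm⟩ := Int.even_mul_pred_self n
  have hm' : (n : ℂ) * (n - 1) = m + m := by exact_mod_cast hm
  rw [jacobiTheta₂_term, jacobiTheta₂_term, Complex.exp_eq_exp_iff_exists_int]
  exact ⟨m, by linear_combination (π * I : ℂ) * hm'⟩

/-- The squared automorphy factor of the theta functions under `z ↦ -1/z`. -/
lemma cpow_half_pow_four (z : ℍ) : ((-I * z : ℂ) ^ (1 / 2 : ℂ)) ^ 4 = -(z : ℂ) ^ 2 := by
  rw [← cpow_nat_mul, show ((4 : ℕ) : ℂ) * (1 / 2) = (2 : ℕ) by norm_num, cpow_natCast, mul_pow,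
    neg_sq, I_sq]
  ring

lemma cpow_half_ne_zero (z : ℍ) : (-I * z : ℂ) ^ (1 / 2 : ℂ) ≠ 0 := by
  intro h
  have := cpow_half_pow_four z
  rw [h] at this
  exact z.ne_zero (by simpa using this)

lemma coe_S_smul (z : ℍ) : ((ModularGroup.S • z : ℍ) : ℂ) = -1 / z := by
  rw [modular_S_smul, coe_mk, neg_div, one_div, inv_neg]

lemma coe_T_smul (z : ℍ) : ((ModularGroup.T • z : ℍ) : ℂ) = z + 1 := by
  rw [modular_T_smul, coe_vadd, add_comm]
  norm_num

lemma Θ₂_T_smul (z : ℍ) : Θ₂ (ModularGroup.T • z) = cexp (π * I / 4) * Θ₂ z := by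
  rw [Θ₂_eq, Θ₂_eq, coe_T_smul, jacobiTheta₂_add_one_right,
    show ((z : ℂ) + 1) / 2 + 1 / 2 = z / 2 + 1 by ring, jacobiTheta₂_add_left, ← mul_assoc,
    ← Complex.exp_add]
  congr 2
  ring

lemma Θ₃_T_smul (z : ℍ) : Θ₃ (ModularGroup.T • z) = Θ₄ z := by
  rw [Θ₃_eq, Θ₄, coe_T_smul, jacobiTheta₂_add_one_right, zero_add]

lemma Θ₄_T_smul (z : ℍ) : Θ₄ (ModularGroup.T • z) = Θ₃ z := by
  rw [Θ₄, Θ₃_eq, coe_T_smul, jacobiTheta₂_add_one_right,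
    show (1 / 2 + 1 / 2 : ℂ) = 0 + 1 by norm_num, jacobiTheta₂_add_left]

lemma Θ₂_S_smul (z : ℍ) : Θ₂ (ModularGroup.S • z) = (-I * z) ^ (1 / 2 : ℂ) * Θ₄ z := by
  have hr := cpow_half_ne_zero z
  have hz := z.ne_zero
  rw [Θ₂_eq, Θ₄, coe_S_smul, jacobiTheta₂_functional_equation (1 / 2) z, ← jacobiTheta₂_neg_left,
    show -(-1 / (z : ℂ) / 2) = 1 / 2 / z by ring,
    show π * I * (-1 / (z : ℂ)) / 4 = -π * I * (1 / 2) ^ 2 / z by ring]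
  field_simp

lemma Θ₃_S_smul (z : ℍ) : Θ₃ (ModularGroup.S • z) = (-I * z) ^ (1 / 2 : ℂ) * Θ₃ z := by
  have hr := cpow_half_ne_zero z
  rw [Θ₃_eq, Θ₃_eq, coe_S_smul, jacobiTheta₂_functional_equation 0 z]
  simp only [zero_div, ne_eq, OfNat.ofNat_ne_zero, not_false_eq_true, zero_pow, mul_zero,
    Complex.exp_zero, mul_one]
  rw [← mul_assoc, mul_one_div_cancel hr, one_mul]

lemma Θ₄_S_smul (z : ℍ) : Θ₄ (ModularGroup.S • z) = (-I * z) ^ (1 / 2 : ℂ) * Θ₂ z := by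
  have hr := cpow_half_ne_zero z
  have hz := z.ne_zero
  have he : cexp (π * I * z / 4) * cexp (-π * I * (z / 2) ^ 2 / z) = 1 := by
    rw [← Complex.exp_add, ← Complex.exp_zero]
    congr 1
    field_simp
    ring
  rw [Θ₂_eq, Θ₄, coe_S_smul, jacobiTheta₂_functional_equation (z / 2) z,
    show (z : ℂ) / 2 / z = 1 / 2 by field_simp]
  calc _ = ((-I * z) ^ (1 / 2 : ℂ) * (1 / (-I * z) ^ (1 / 2 : ℂ))) * 1 *
        jacobiTheta₂ (1 / 2) (-1 / z) := by rw [mul_one_div_cancel hr]; ring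
    _ = _ := by rw [← he]; ring

/-- The forms `Θ₂⁴`, `Θ₄⁴`, `-Θ₃⁴`, indexed by the vectors `(0,1)`, `(1,0)`, `(1,1)`. -/
def thetaForm (v : Fin 2 → ZMod 2) (z : ℍ) : ℂ :=
  if v 0 = 0 then (if v 1 = 0 then 0 else Θ₂ z ^ 4)
  else (if v 1 = 0 then Θ₄ z ^ 4 else -Θ₃ z ^ 4)

/-- Reduction of `SL(2, ℤ)` modulo `2`. -/
def redTwo : SL(2, ℤ) →* SL(2, ZMod 2) :=
  Matrix.SpecialLinearGroup.map (Int.castRingHom (ZMod 2))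

lemma vec_two_cases (v : Fin 2 → ZMod 2) :
    v = ![0, 0] ∨ v = ![0, 1] ∨ v = ![1, 0] ∨ v = ![1, 1] := by
  revert v
  decide

lemma thetaForm_slash_T (v : Fin 2 → ZMod 2) : thetaForm v ∣[(2 : ℤ)] ModularGroup.T =
    (-1 : ℂ) • thetaForm (Matrix.vecMul v (redTwo ModularGroup.T).1) := by
  have hT : (redTwo ModularGroup.T).1 = !![1, 1; 0, 1] := by
    ext i j; fin_cases i <;> fin_cases j <;> simp [redTwo, ModularGroup.coe_T]
  have he : cexp (π * I / 4) ^ 4 = -1 := by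
    rw [← Complex.exp_nat_mul, ← Complex.exp_pi_mul_I]
    congr 1
    push_cast
    ring
  ext z
  rw [ModularForm.SL_slash_apply, ModularGroup.denom_apply, hT]
  have h11 : (1 : ZMod 2) + 1 = 0 := by decide
  rcases vec_two_cases v with rfl | rfl | rfl | rfl <;>
    simp only [thetaForm, Θ₂_T_smul, Θ₃_T_smul, Θ₄_T_smul, mul_pow, he] <;>
    simp [thetaForm, ModularGroup.coe_T, h11]

lemma thetaForm_slash_S (v : Fin 2 → ZMod 2) : thetaForm v ∣[(2 : ℤ)] ModularGroup.S =
    (-1 : ℂ) • thetaForm (Matrix.vecMul v (redTwo ModularGroup.S).1) := by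
  have hS : (redTwo ModularGroup.S).1 = !![0, 1; 1, 0] := by
    ext i j; fin_cases i <;> fin_cases j <;> simp [redTwo, ModularGroup.coe_S]
  ext z
  have hz := z.ne_zero
  rw [ModularForm.SL_slash_apply, ModularGroup.denom_apply, hS]
  rcases vec_two_cases v with rfl | rfl | rfl | rfl <;>
    simp only [thetaForm, Θ₂_S_smul, Θ₃_S_smul, Θ₄_S_smul, mul_pow, cpow_half_pow_four] <;>
    simp [thetaForm, ModularGroup.coe_S] <;> field_simp

/-- With the sign of Θ₃⁴ reversed, S and T permute the three forms as they permute the nonzero row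
vectors over 𝔽₂, up to one factor -1 common to all forms. The relation extends from generators to
SL(2, ℤ), and Γ(2) then scales all three by the same factor, which cancels in λ. -/
theorem exists_thetaForm_slash (γ : SL(2, ℤ)) : ∃ c : ℂ, c ≠ 0 ∧ ∀ v,
    thetaForm v ∣[(2 : ℤ)] γ = c • thetaForm (Matrix.vecMul v (redTwo γ).1) := by
  have hγ : γ ∈ Subgroup.closure {ModularGroup.S, ModularGroup.T} := by
    simp [SpecialLinearGroup.SL2Z_generators]
  induction hγ using Subgroup.closure_induction with
  | one => exact ⟨1, one_ne_zero, fun v ↦ by simp⟩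
  | mem g hg =>
    rcases hg with rfl | rfl
    · exact ⟨-1, by norm_num, thetaForm_slash_S⟩
    · exact ⟨-1, by norm_num, thetaForm_slash_T⟩
  | mul g h _ _ ig ih =>
    obtain ⟨c, hc, ig⟩ := ig
    obtain ⟨d, hd, ih⟩ := ih
    refine ⟨c * d, mul_ne_zero hc hd, fun v ↦ ?_⟩
    rw [SlashAction.slash_mul, ig, ModularForm.SL_smul_slash, ih, smul_smul, map_mul,
      Matrix.SpecialLinearGroup.coe_mul, Matrix.vecMul_vecMul]
  | inv g _ ig =>
    obtain ⟨c, hc, ig⟩ := ig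
    refine ⟨c⁻¹, inv_ne_zero hc, fun v ↦ ?_⟩
    have hv : Matrix.vecMul (Matrix.vecMul v (redTwo g⁻¹).1) (redTwo g).1 = v := by
      rw [Matrix.vecMul_vecMul, ← Matrix.SpecialLinearGroup.coe_mul, ← map_mul, inv_mul_cancel,
        map_one, Matrix.SpecialLinearGroup.coe_one, Matrix.vecMul_one]
    have h := ig (Matrix.vecMul v (redTwo g⁻¹).1)
    rw [hv] at h
    have h2 : thetaForm v = c⁻¹ • (thetaForm (Matrix.vecMul v (redTwo g⁻¹).1) ∣[(2 : ℤ)] g) := by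
      rw [h, smul_smul, inv_mul_cancel₀ hc, one_smul]
    conv_lhs => rw [h2]
    rw [ModularForm.SL_smul_slash, ← SlashAction.slash_mul, mul_inv_cancel, SlashAction.slash_one]

/-- The lambda function is invariant under `Γ(2)`. -/
theorem lam_smul {γ : SL(2, ℤ)} (hγ : γ ∈ CongruenceSubgroup.Gamma 2) (z : ℍ) :
    lam (γ • z) = lam z := by
  obtain ⟨c, hc, h⟩ := exists_thetaForm_slash γ
  have hred : (redTwo γ).1 = 1 := by
    have : redTwo γ = 1 := hγ
    rw [this, Matrix.SpecialLinearGroup.coe_one]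
  have hd : denom γ z ≠ 0 := denom_ne_zero γ z
  have key : ∀ v, thetaForm v (γ • z) = (denom γ z ^ 2 * c) * thetaForm v z := by
    intro v
    have h1 := congrFun (h v) z
    rw [ModularForm.SL_slash_apply, hred, Matrix.vecMul_one, Pi.smul_apply, smul_eq_mul,
      zpow_neg] at h1
    have hd2 : (denom γ z ^ (2 : ℤ)) = denom γ z ^ 2 := by norm_cast
    rw [hd2] at h1
    field_simp at h1
    linear_combination h1
  have h2 : Θ₂ (γ • z) ^ 4 = (denom γ z ^ 2 * c) * Θ₂ z ^ 4 := by
    simpa [thetaForm] using key ![0, 1]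
  have h3 : Θ₃ (γ • z) ^ 4 = (denom γ z ^ 2 * c) * Θ₃ z ^ 4 := by
    have := key ![1, 1]
    simpa [thetaForm] using this
  rw [lam, lam, h2, h3, mul_div_mul_left _ _ (mul_ne_zero (pow_ne_zero 2 hd) hc)]

/-- The lambda function is real and nonpositive on the line `Re z = 1`. -/
theorem lam_linePoint {y : ℝ} (hy : 0 < y) : ∃ x : ℝ, x ≤ 0 ∧ lam (linePoint y hy) = x := by
  have hcy : -conj ((y : ℂ) * I) = y * I := by simp
  obtain ⟨a, ha⟩ : ∃ a : ℝ, jacobiTheta₂ (y * I / 2) (y * I) = a := by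
    refine ⟨_, (conj_eq_iff_re.mp ?_).symm⟩
    rw [jacobiTheta₂_conj, hcy, ← jacobiTheta₂_neg_left]
    congr 1
    simp [neg_div, Complex.conj_ofNat]
  obtain ⟨b, hb⟩ : ∃ b : ℝ, jacobiTheta₂ (1 / 2) (y * I) = b := by
    refine ⟨_, (conj_eq_iff_re.mp ?_).symm⟩
    rw [jacobiTheta₂_conj, hcy]
    congr 1
    simp [Complex.conj_ofNat]
  have h2 : Θ₂ (linePoint y hy) = cexp (π * I / 4) * Real.exp (-(π * y / 4)) * a := by
    rw [Θ₂_eq, coe_linePoint, add_comm (1 : ℂ), jacobiTheta₂_add_one_right,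
      show ((y * I : ℂ) + 1) / 2 + 1 / 2 = y * I / 2 + 1 by ring, jacobiTheta₂_add_left, ha]
    congr 1
    rw [ofReal_exp, ← Complex.exp_add]
    congr 1
    push_cast
    linear_combination (π * y / 4 : ℂ) * I_sq
  have h3 : Θ₃ (linePoint y hy) = b := by
    rw [Θ₃_eq, coe_linePoint, add_comm (1 : ℂ), jacobiTheta₂_add_one_right, zero_add, hb]
  have he : cexp (π * I / 4) ^ 4 = -1 := by
    rw [← Complex.exp_nat_mul, ← Complex.exp_pi_mul_I]
    congr 1
    push_cast
    ring
  -- The sign comes from (e^{πi/4})⁴ = -1. Nonvanishing of b is not needed: both sides use the same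
  -- convention for division by zero.
  refine ⟨-((Real.exp (-(π * y / 4)) * a) ^ 4 / b ^ 4), ?_, ?_⟩
  · rw [neg_nonpos]; positivity
  · rw [lam, h2, h3, mul_assoc, mul_pow, he]
    push_cast
    ring

lemma mem_orbit_Gamma_iff {z w : ℍ} :
    z ∈ MulAction.orbit (CongruenceSubgroup.Gamma 2) w ↔
      ∃ γ ∈ CongruenceSubgroup.Gamma 2, γ • w = z :=
  ⟨fun ⟨γ, h⟩ ↦ ⟨γ.1, γ.2, h⟩, fun ⟨γ, hγ, h⟩ ↦ ⟨⟨γ, hγ⟩, h⟩⟩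

/-- All zeros of `G_{2k+1}` lie on the line `Re z = 1` up to `Γ(2)`. -/
theorem exists_finset_zeroOrbits {k : ℕ} (hk : k ≠ 0) : ∃ s : Finset ℝ, ∀ q ∈ zeroOrbits k,
    ∃ y ∈ s, ∃ hy : 0 < y, q = Quotient.mk'' (linePoint y hy) := by
  obtain ⟨s, hs⟩ := exists_finset_zeros hk
  refine ⟨s, fun q ⟨z, hz, hG⟩ ↦ ?_⟩
  obtain ⟨y, hys, hy, γ, hγ, h⟩ := hs z hG
  refine ⟨y, hys, hy, ?_⟩
  rw [MulAction.orbitRel.Quotient.mem_orbit] at hz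
  rw [← hz, Quotient.eq'', MulAction.orbitRel_apply, ← h]
  exact mem_orbit_Gamma_iff.mpr ⟨γ⁻¹, inv_mem hγ, by rw [inv_smul_smul]⟩

lemma mk_linePoint_mem_onLine {y : ℝ} (hy : 0 < y) :
    (Quotient.mk'' (linePoint y hy) : Orbits) ∈ onLine :=
  ⟨linePoint y hy, by rw [MulAction.orbitRel.Quotient.mem_orbit], linePoint_mem_D hy⟩

lemma mk_linePoint_mem_lamNonpos {y : ℝ} (hy : 0 < y) :
    (Quotient.mk'' (linePoint y hy) : Orbits) ∈ lamNonpos := by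
  intro z hz
  rw [MulAction.orbitRel.Quotient.mem_orbit, Quotient.eq'', MulAction.orbitRel_apply,
    mem_orbit_Gamma_iff] at hz
  obtain ⟨γ, hγ, rfl⟩ := hz
  rw [lam_smul hγ]
  exact lam_linePoint hy

lemma zeroOrbits_finite {k : ℕ} (hk : k ≠ 0) : (zeroOrbits k).Finite := by
  obtain ⟨s, hs⟩ := exists_finset_zeroOrbits hk
  refine ((s : Set ℝ).toFinite.image fun y ↦
    if hy : 0 < y then (Quotient.mk'' (linePoint y hy) : Orbits)
    else Quotient.mk'' UpperHalfPlane.I).subset ?_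
  intro q hq
  obtain ⟨y, hys, hy, rfl⟩ := hs q hq
  exact ⟨y, hys, dif_pos hy⟩

lemma zeroOrbits_subset_onLine {k : ℕ} (hk : k ≠ 0) : zeroOrbits k ⊆ onLine := by
  obtain ⟨s, hs⟩ := exists_finset_zeroOrbits hk
  intro q hq
  obtain ⟨y, -, hy, rfl⟩ := hs q hq
  exact mk_linePoint_mem_onLine hy

lemma zeroOrbits_subset_lamNonpos {k : ℕ} (hk : k ≠ 0) : zeroOrbits k ⊆ lamNonpos := by
  obtain ⟨s, hs⟩ := exists_finset_zeroOrbits hk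
  intro q hq
  obtain ⟨y, -, hy, rfl⟩ := hs q hq
  exact mk_linePoint_mem_lamNonpos hy

end LevelTwoEisenstein

end

theorem theorem1p1 (k : ℕ) (hk : 1 ≤ k) :
    (LevelTwoEisenstein.zeroOrbits k).Finite ∧
    (9 / 10 : ℝ) * LevelTwoEisenstein.zeroCount k (LevelTwoEisenstein.zeroOrbits k) ≤
      LevelTwoEisenstein.zeroCount k
        (LevelTwoEisenstein.zeroOrbits k ∩ LevelTwoEisenstein.lamNonpos) ∧
    (9 / 10 : ℝ) * LevelTwoEisenstein.zeroCount k (LevelTwoEisenstein.zeroOrbits k) ≤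
      LevelTwoEisenstein.zeroCount k
        (LevelTwoEisenstein.zeroOrbits k ∩ LevelTwoEisenstein.onLine) := by
  have hk' : k ≠ 0 := by omega
  -- All zero orbits satisfy both conditions, so both intersections are the full zero set and all
  -- three counts coincide.
  rw [Set.inter_eq_left.mpr (LevelTwoEisenstein.zeroOrbits_subset_lamNonpos hk'),
    Set.inter_eq_left.mpr (LevelTwoEisenstein.zeroOrbits_subset_onLine hk')]
  have h : (0 : ℝ) ≤ LevelTwoEisenstein.zeroCount k (LevelTwoEisenstein.zeroOrbits k) :=
    Nat.cast_nonneg _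
  exact ⟨LevelTwoEisenstein.zeroOrbits_finite hk', by linarith, by linarith⟩
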